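/- Let $(\mathbb M,g)$ be a smooth compact connected Riemannian manifold of dimension $n+m$ with a totally geodesic Riemannian foliation $\mathcal F$ by $m$-dimensional leaves and bundle-like metric; let $\mathcal V$ be the vertical bundle (tangent to the leaves) and $\mathcal H=\mathcal V^{\perp}$ the horizontal bundle. Let $\nabla^R$ be the Levi-Civita connection and $\nabla$ the Bott connection, i.e. $\nabla_XY=\pi_{\mathcal H}(\nabla^R_XY)$ for $X,Y$ horizontal, $\pi_{\mathcal H}([X,Y])$ for $X$ vertical and $Y$ horizontal, $\pi_{\mathcal V}([X,Y])$ for $X$ horizontal and $Y$ vertical, and $\pi_{\mathcal V}(\nabla^R_XY)$ for $X,Y$ vertical; let $T$ be its torsion. Call a smooth connection $D$ on $T\mathbb M$ *admissible* if $Dg=0$, $D$ preserves $\Gamma^\infty(\mathcal H)$ and $\Gamma^\infty(\mathcal V)$, and $D_XY=\nabla_XY$ for all smooth vector fields $X,Y$ with $X$ horizontal. Fix $x_0\in\mathbb M$ and a horizontal orthonormal frame $u_0$ at $x_0$: a linear isometry $u_0:\mathbb R^{n+m}=\mathbb R^n\times\mathbb R^m\to T_{x_0}\mathbb M$ with $u_0(\mathbb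 R^n\times 0)\subset\mathcal H_{x_0}$ and $u_0(0\times\mathbb R^m)\subset\mathcal V_{x_0}$. Let $D$ be admissible. For a smooth path $\gamma:[0,1]\to\mathbb M$ with $\gamma(0)=x_0$ let $u=u(\gamma)$ be its $D$-lift to the orthonormal frame bundle (the $D$-parallel frame along $\gamma$ starting at $u_0$), and let $\phi^{-1}(\gamma)=\omega$ be its anti-development, the smooth path in $\mathbb R^{n+m}$ with $\omega(0)=0$ and $\gamma'(s)=u_s\,\omega'(s)$. Let $v:[0,1]\to\mathbb R^{n+m}$ be a smooth path with $v(0)=0$, let $\mathbf D_v(\gamma)_s=u_s(\gamma)v(s)$, and let $\{\zeta^v_t\}_{t\in\mathbb R}$ be the flow generated by $\mathbf D_v$ on the smooth paths starting at $x_0$: $(t,s)\mapsto(\zeta^v_t\gamma)_s$ is smooth, $\zeta^v_0\gamma=\gamma$ and $\frac{d}{dt}(\zeta^v_t\gamma)_s=\mathbf D_v(\zeta^v_t\gamma)_s$. Let $\gamma$ be a smooth horizontal path from $x_0$ (that is, $\gamma'(s)\in\mathcal H_{\gamma(s)}$ for all $s\in[0,1]$), $u$ its $D$-lift and $\omega^{\mathcal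 H}$ its horizontal anti-development (the $\mathbb R^n$-valued anti-development of $\gamma$). Call $v$ *tangent* to $\gamma$ (with respect to $D$) if $\frac{d}{dt}\big|_{t=0}\phi^{-1}(\zeta^v_t\gamma)_s$ exists and lies in $\mathbb R^n=\mathbb R^n\times 0$ for every $s\in[0,1]$. For a frame $u$ write $A a+V a$ for the $D$-lift of $u a$ to the frame bundle, where $A a$ and $Va$ are the lifts of the images of the $\mathbb R^n$- and the $\mathbb R^m$-component of $a\in\mathbb R^{n+m}$, and view torsion and curvature as forms on the frame bundle: $T_u$, $T^D_u$ and $\Omega^D_u$ evaluated on the lifts of $ua$ and $ub$ are $u^{-1}T(ua,ub)$, $u^{-1}T^D(ua,ub)$ and $u^{-1}R^D(ua,ub)u$, with $R^D(X,Y)=D_XD_Y-D_YD_X-D_{[X,Y]}$. Then: 1. $v$ is tangent to $\gamma$ if and only if $$v(s)-\int_0^s T_{u_r}\big(A\,d\omega^{\mathcal H}_r,\;A v(r)\big)\in\mathbb R^n\qquad\text{for all } s\in[0,1],$$ where $T$ is the torsion of the Bott connection. 2. For every $s\in[0,1]$ (whether or not $v$ is tangent to $\gamma$) the first variation exists and $$\frac{d}{dt}\Big|_{t=0}\phi^{-1}(\zeta^v_t\gamma)_s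 = p_v(\omega^{\mathcal H})_s := v(s)-\int_0^s T^D_{u_r}\big(A\,d\omega^{\mathcal H}_r,\,Av(r)+Vv(r)\big)-\int_0^s\Big(\int_0^r\Omega^D_{u_\tau}\big(A\,d\omega^{\mathcal H}_\tau,\,Av(\tau)+Vv(\tau)\big)\Big)d\omega^{\mathcal H}_r .$$ 3. The notion of tangent path does not depend on $D$: if $D$ and $D'$ are admissible connections, then $v$ is tangent to $\gamma$ with respect to $D$ if and only if it is tangent to $\gamma$ with respect to $D'$. -/

import Mathlib

open Set Bundle
open scoped Manifold ContDiff Bundle Topology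

noncomputable section

namespace FoliatedPaths

/-! ### Foliations -/

/-- A foliation of codimension `n` on a manifold `M` modelled on `E`, given by disintegrating maps:
submersions `p α` from the open sets `U α` of a cover of `M` to `ℝⁿ` which differ, on overlaps, by
local diffeomorphisms of `ℝⁿ`. -/
structure Foliation (E : Type*) [NormedAddCommGroup E] [NormedSpace ℝ E]
    (n : ℕ) (M : Type*) [TopologicalSpace M] [ChartedSpace E M] where
  ι : Type*
  U : ι → Set M
  p : ι → M → EuclideanSpace ℝ (Fin n)
  isOpen_U : ∀ α, IsOpen (U α)
  iUnion_U : ⋃ α, U α = Set.univ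
  contMDiffOn_p : ∀ α, ContMDiffOn 𝓘(ℝ, E) (𝓡 n) ∞ (p α) (U α)
  surjective_mfderiv : ∀ α, ∀ x ∈ U α,
    Function.Surjective (mfderiv 𝓘(ℝ, E) (𝓡 n) (p α) x)
  transition : ∀ α β, (U α ∩ U β).Nonempty →
    ∃ Ψ : EuclideanSpace ℝ (Fin n) → EuclideanSpace ℝ (Fin n),
      IsLocalDiffeomorphOn (𝓡 n) (𝓡 n) ∞ Ψ (p β '' (U α ∩ U β)) ∧
      ∀ x ∈ U α ∩ U β, p α x = Ψ (p β x)

section Geometry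

variable {E : Type*} [NormedAddCommGroup E] [NormedSpace ℝ E] [FiniteDimensional ℝ E] {n : ℕ}
  {M : Type*} [TopologicalSpace M] [ChartedSpace E M] [IsManifold 𝓘(ℝ, E) ∞ M]

/-- A (not necessarily smooth) vector field on `M`. -/
abbrev VField (E : Type*) [NormedAddCommGroup E] [NormedSpace ℝ E]
    (M : Type*) [TopologicalSpace M] [ChartedSpace E M] : Type _ :=
  (x : M) → TangentSpace 𝓘(ℝ, E) x

/-- `X` is a smooth vector field. -/
def IsSmoothField (X : VField E M) : Prop :=
  ContMDiff 𝓘(ℝ, E) 𝓘(ℝ, E).tangent ∞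
    (fun x => (⟨x, X x⟩ : TangentBundle 𝓘(ℝ, E) M))

/-- A vector field extending the tangent vector `a` at `x`, smooth near `x`. -/
abbrev ext {x : M} (a : TangentSpace 𝓘(ℝ, E) x) : VField E M :=
  FiberBundle.extend E a

/-- The vertical space at `x`: the common kernel of the differentials of the disintegrating maps
defined at `x`. -/
def Foliation.vertical (F : Foliation E n M) (x : M) :
    Submodule ℝ (TangentSpace 𝓘(ℝ, E) x) :=
  ⨅ (α : F.ι) (_ : x ∈ F.U α),
    LinearMap.ker (mfderiv 𝓘(ℝ, E) (𝓡 n) (F.p α) x).toLinearMap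

variable [RiemannianBundle (fun x : M => TangentSpace 𝓘(ℝ, E) x)]

instance finiteDimensional_tangentSpace (x : M) :
    FiniteDimensional ℝ (TangentSpace 𝓘(ℝ, E) x) :=
  inferInstanceAs (FiniteDimensional ℝ E)

/-- The horizontal space at `x`: the orthogonal complement of the vertical space. -/
def Foliation.horizontal (F : Foliation E n M) (x : M) :
    Submodule ℝ (TangentSpace 𝓘(ℝ, E) x) :=
  (F.vertical x)ᗮ

/-- The vector field `π_𝓗 X`. -/
def Foliation.hor (F : Foliation E n M) (X : VField E M) : VField E M :=
  fun x => (F.horizontal x).starProjection (X x)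

/-- The vector field `π_𝓥 X`. -/
def Foliation.ver (F : Foliation E n M) (X : VField E M) : VField E M :=
  fun x => (F.vertical x).starProjection (X x)

/-- The right-hand side of the Koszul formula, `g(∇ᴿ_X Y, Z)` at `x`. -/
def koszul (X Y Z : VField E M) (x : M) : ℝ :=
  (mvfderiv 𝓘(ℝ, E) (fun y => inner ℝ (Y y) (Z y)) x (X x)
    + mvfderiv 𝓘(ℝ, E) (fun y => inner ℝ (X y) (Z y)) x (Y x)
    - mvfderiv 𝓘(ℝ, E) (fun y => inner ℝ (X y) (Y y)) x (Z x)
    + inner ℝ (VectorField.mlieBracket 𝓘(ℝ, E) X Y x) (Z x)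
    - inner ℝ (VectorField.mlieBracket 𝓘(ℝ, E) X Z x) (Y x)
    - inner ℝ (VectorField.mlieBracket 𝓘(ℝ, E) Y Z x) (X x)) / 2

/-- The Levi-Civita covariant derivative `∇ᴿ_X Y` of the metric: the vector whose inner products
with an orthonormal basis of the tangent space are given by the Koszul formula. -/
def leviCivita (X Y : VField E M) : VField E M :=
  fun x => ∑ i, koszul X Y (ext (stdOrthonormalBasis ℝ (TangentSpace 𝓘(ℝ, E) x) i)) x •
    stdOrthonormalBasis ℝ (TangentSpace 𝓘(ℝ, E) x) i

/-- The metric is bundle-like: every disintegrating map is a Riemannian submersion onto its open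
image, for some smooth Riemannian metric `h` on this image. -/
def Foliation.IsBundleLike (F : Foliation E n M) : Prop :=
  ∀ α, ∃ h : EuclideanSpace ℝ (Fin n) →
      (EuclideanSpace ℝ (Fin n) →L[ℝ] EuclideanSpace ℝ (Fin n) →L[ℝ] ℝ),
    ContDiffOn ℝ ∞ h (F.p α '' F.U α) ∧
    (∀ y ∈ F.p α '' F.U α, (∀ a b, h y a b = h y b a) ∧ ∀ a, a ≠ 0 → 0 < h y a a) ∧
    ∀ x ∈ F.U α, ∀ a ∈ F.horizontal x, ∀ b ∈ F.horizontal x,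
      h (F.p α x) (mfderiv 𝓘(ℝ, E) (𝓡 n) (F.p α) x a)
        (mfderiv 𝓘(ℝ, E) (𝓡 n) (F.p α) x b) = inner ℝ a b

/-- The leaves are totally geodesic: their second fundamental form vanishes, that is, `∇ᴿ_X Y` is
vertical for all vertical smooth vector fields `X` and `Y`. -/
def Foliation.IsTotallyGeodesic (F : Foliation E n M) : Prop :=
  ∀ X Y : VField E M, IsSmoothField X → IsSmoothField Y →
    (∀ x, X x ∈ F.vertical x) → (∀ x, Y x ∈ F.vertical x) →
    ∀ x, leviCivita X Y x ∈ F.vertical x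

/-- The Bott connection `∇_X Y`. For `X` and `Y` horizontal or vertical only one of the four terms
is present. -/
def Foliation.bott (F : Foliation E n M) (X Y : VField E M) : VField E M :=
  F.hor (leviCivita (F.hor X) (F.hor Y))
    + F.hor (VectorField.mlieBracket 𝓘(ℝ, E) (F.ver X) (F.hor Y))
    + F.ver (VectorField.mlieBracket 𝓘(ℝ, E) (F.hor X) (F.ver Y))
    + F.ver (leviCivita (F.ver X) (F.ver Y))

/-- The torsion tensor `T(a, b)` of the Bott connection at `x`. -/
def Foliation.bottTorsion (F : Foliation E n M) (x : M)
    (a b : TangentSpace 𝓘(ℝ, E) x) : TangentSpace 𝓘(ℝ, E) x :=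
  F.bott (ext a) (ext b) x - F.bott (ext b) (ext a) x
    - VectorField.mlieBracket 𝓘(ℝ, E) (ext a) (ext b) x

/-- A connection on the tangent bundle of `M`; `D Y x (X x)` is `(D_X Y)(x)`. -/
abbrev Connection (E : Type*) [NormedAddCommGroup E] [NormedSpace ℝ E]
    (M : Type*) [TopologicalSpace M] [ChartedSpace E M] [IsManifold 𝓘(ℝ, E) ∞ M] : Type _ :=
  CovariantDerivative 𝓘(ℝ, E) E (TangentSpace 𝓘(ℝ, E) : M → Type _)

/-- The curvature tensor `R(a, b)c`, where `R(X, Y) = D_X D_Y - D_Y D_X - D_[X,Y]`. -/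
def curvature (D : Connection E M) (x : M) (a b c : TangentSpace 𝓘(ℝ, E) x) :
    TangentSpace 𝓘(ℝ, E) x :=
  D (fun y => D (ext c) y (ext b y)) x a - D (fun y => D (ext c) y (ext a y)) x b
    - D (ext c) x (VectorField.mlieBracket 𝓘(ℝ, E) (ext a) (ext b) x)

/-- `D` is a smooth metric connection, adapted to the foliation, which agrees with the Bott
connection in horizontal directions. -/
structure IsAdapted [IsContMDiffRiemannianBundle 𝓘(ℝ, E) ∞ E
      (fun x : M => TangentSpace 𝓘(ℝ, E) x)]
    (F : Foliation E n M) (D : Connection E M) : Prop where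
  smooth : CovariantDerivative.ContMDiffCovariantDerivative D ∞
  metric : CovariantDerivative.IsMetricCompatible
    (V := (TangentSpace 𝓘(ℝ, E) : M → Type _)) D
  horizontal : ∀ X Y : VField E M, IsSmoothField X → IsSmoothField Y →
    (∀ x, Y x ∈ F.horizontal x) → ∀ x, D Y x (X x) ∈ F.horizontal x
  vertical : ∀ X Z : VField E M, IsSmoothField X → IsSmoothField Z →
    (∀ x, Z x ∈ F.vertical x) → ∀ x, D Z x (X x) ∈ F.vertical x
  eq_bott : ∀ X Y : VField E M, IsSmoothField X → IsSmoothField Y →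
    (∀ x, X x ∈ F.horizontal x) → ∀ x, D Y x (X x) = F.bott X Y x

end Geometry

/-! ### Frames, lifts and developments

Paths are functions on `ℝ` of which only the restriction to `[0, 1]` matters. -/

/-- The Euclidean space `ℝⁿ⁺ᵐ = ℝⁿ × ℝᵐ`. -/
abbrev Eucl (n m : ℕ) : Type := EuclideanSpace ℝ (Fin n ⊕ Fin m)

/-- The vector `a ∈ ℝⁿ⁺ᵐ` lies in `ℝⁿ`. -/
def IsHorVec {n m : ℕ} (a : Eucl n m) : Prop := ∀ j : Fin m, a (Sum.inr j) = 0

/-- The component of `a ∈ ℝⁿ⁺ᵐ` in `ℝⁿ`. -/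
def horPart {n m : ℕ} (a : Eucl n m) : Eucl n m :=
  WithLp.toLp 2 (Sum.elim (fun i => a (Sum.inl i)) (fun _ => 0))

/-- Smooth paths `[0, 1] → ℝⁿ⁺ᵐ` starting at `0`. -/
def IsSmoothPath₀ {n m : ℕ} (v : ℝ → Eucl n m) : Prop :=
  ContDiffOn ℝ ∞ v (Icc 0 1) ∧ v 0 = 0

/-- The derivative on `[0, 1]` of a path in `ℝⁿ⁺ᵐ`. -/
def dot {n m : ℕ} (v : ℝ → Eucl n m) (s : ℝ) : Eucl n m := derivWithin v (Icc 0 1) s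

section Paths

variable {E : Type*} [NormedAddCommGroup E] [NormedSpace ℝ E] [FiniteDimensional ℝ E] {n m : ℕ}
  {M : Type*} [TopologicalSpace M] [ChartedSpace E M] [IsManifold 𝓘(ℝ, E) ∞ M]

/-- Smooth paths `[0, 1] → M` starting at `x₀`. -/
abbrev SmoothPath (E : Type*) [NormedAddCommGroup E] [NormedSpace ℝ E]
    {M : Type*} [TopologicalSpace M] [ChartedSpace E M] (x₀ : M) : Type _ :=
  {γ : ℝ → M // ContMDiffOn 𝓘(ℝ, ℝ) 𝓘(ℝ, E) ∞ γ (Icc 0 1) ∧ γ 0 = x₀}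

/-- The velocity `γ'(s)`, `s ∈ [0, 1]`, of a path in `M`. -/
def velocity (γ : ℝ → M) (s : ℝ) : TangentSpace 𝓘(ℝ, E) (γ s) :=
  mfderivWithin 𝓘(ℝ, ℝ) 𝓘(ℝ, E) γ (Icc 0 1) s (1 : ℝ)

/-- The covariant derivative along its base path of a vector field `W` along a path in `M`, written
as a path in `TM`. If `W = ∑ wⁱ Xᵢ` in a local frame `(Xᵢ)` and `γ` is the base path, then it is
`∑ (wⁱ)' Xᵢ + ∑ wⁱ D_{γ'} Xᵢ`; the frame used at time `s` is the one given by the preferred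
trivialization `e` of `TM` at `γ(s)`. -/
def covDerivAlong (D : Connection E M) (W : ℝ → TangentBundle 𝓘(ℝ, E) M) (s : ℝ) :
    TangentSpace 𝓘(ℝ, E) (W s).proj :=
  let e := trivializationAt E (TangentSpace 𝓘(ℝ, E) : M → Type _) (W s).proj
  e.symm (W s).proj (derivWithin (fun r => (e (W r)).2) (Icc 0 1) s)
    + D (fun y => e.symm y (e (W s)).2) (W s).proj
        (velocity (E := E) (fun r => (W r).proj) s)

variable [RiemannianBundle (fun x : M => TangentSpace 𝓘(ℝ, E) x)]

/-- The orthonormal frame bundle `𝒪(M)`: an element is a point `x` with a linear isometry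
`u : ℝⁿ⁺ᵐ → T_x M`. -/
structure OFrame (E : Type*) [NormedAddCommGroup E] [NormedSpace ℝ E] (n m : ℕ)
    (M : Type*) [TopologicalSpace M] [ChartedSpace E M]
    [RiemannianBundle (fun x : M => TangentSpace 𝓘(ℝ, E) x)] where
  pt : M
  iso : Eucl n m ≃ₗᵢ[ℝ] TangentSpace 𝓘(ℝ, E) pt

/-- The frame `u` is horizontal: `u(ℝⁿ × 0) ⊆ 𝓗` and `u(0 × ℝᵐ) ⊆ 𝓥`. -/
def Foliation.IsHorFrame (F : Foliation E n M) (u : OFrame E n m M) : Prop :=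
  (∀ a : Eucl n m, (∀ j, a (Sum.inr j) = 0) → u.iso a ∈ F.horizontal u.pt) ∧
  (∀ a : Eucl n m, (∀ i, a (Sum.inl i) = 0) → u.iso a ∈ F.vertical u.pt)

/-- The path `u` in `𝒪(M)` is smooth, starts at `u₀` and is horizontal for the connection `D`:
for every `a ∈ ℝⁿ⁺ᵐ` the vector field `u a` is smooth and `D`-parallel along the path `π(u)`. -/
structure IsLift (D : Connection E M) (u₀ : OFrame E n m M) (u : ℝ → OFrame E n m M) : Prop where
  smooth : ∀ a : Eucl n m, ContMDiffOn 𝓘(ℝ, ℝ) 𝓘(ℝ, E).tangent ∞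
    (fun s => (⟨(u s).pt, (u s).iso a⟩ : TangentBundle 𝓘(ℝ, E) M)) (Icc 0 1)
  start : u 0 = u₀
  parallel : ∀ a : Eucl n m, ∀ s ∈ Icc (0 : ℝ) 1,
    covDerivAlong D (fun r => (⟨(u r).pt, (u r).iso a⟩ : TangentBundle 𝓘(ℝ, E) M)) s = 0

/-- The path `u` in `𝒪(M)` solves `du_s = A_{u_s} dw_s + V_{u_s} dw_s` with initial value `u₀`:
`du_s / ds` is the `D`-lift of the tangent vector `u_s (dw_s / ds)`. -/
def IsRolling (D : Connection E M) (u₀ : OFrame E n m M) (w : ℝ → Eucl n m)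
    (u : ℝ → OFrame E n m M) : Prop :=
  IsLift D u₀ u ∧ ∀ s ∈ Icc (0 : ℝ) 1,
    velocity (E := E) (fun r => (u r).pt) s = (u s).iso (dot w s)

/-- `w` is the anti-development of `γ`. -/
def IsAntiDev (D : Connection E M) (u₀ : OFrame E n m M) (γ : ℝ → M) (w : ℝ → Eucl n m) : Prop :=
  IsSmoothPath₀ w ∧ ∃ u, IsRolling D u₀ w u ∧ ∀ s ∈ Icc (0 : ℝ) 1, (u s).pt = γ s

open Classical in
/-- The `D`-lift to `𝒪(M)` of the path `γ`, starting at `u₀`. -/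
def dLift (D : Connection E M) (u₀ : OFrame E n m M) (γ : ℝ → M) : ℝ → OFrame E n m M :=
  if h : ∃ u, IsLift D u₀ u ∧ ∀ s ∈ Icc (0 : ℝ) 1, (u s).pt = γ s then h.choose else fun _ => u₀

open Classical in
/-- The anti-development `φ⁻¹(γ)`. -/
def antiDev (D : Connection E M) (u₀ : OFrame E n m M) (γ : ℝ → M) : ℝ → Eucl n m :=
  if h : ∃ w, IsAntiDev D u₀ γ w then h.choose else 0

open Classical in
/-- The horizontal anti-development `φ_𝓗⁻¹(γ)`: the path `w` with values in `ℝⁿ` for which the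
solution of `du_s = A_{u_s} dw_s` projects to `γ` (the term `V_{u_s} dw_s` vanishes). -/
def horAntiDev (D : Connection E M) (u₀ : OFrame E n m M) (γ : ℝ → M) : ℝ → Eucl n m :=
  if h : ∃ w, IsAntiDev D u₀ γ w ∧ ∀ s ∈ Icc (0 : ℝ) 1, IsHorVec (w s) then h.choose else 0

/-- The path `γ` is horizontal: `γ'(s) ∈ 𝓗` for every `s ∈ [0, 1]`. -/
def Foliation.IsHorPath (F : Foliation E n M) (γ : ℝ → M) : Prop :=
  ∀ s ∈ Icc (0 : ℝ) 1, velocity (E := E) γ s ∈ F.horizontal (γ s)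

/-! ### Flows and tangent paths -/

/-- The vector field `𝐃_v` on path space: `𝐃_v(γ)_s = u_s(γ) v_s`, an element of `T_{γ_s} M`. -/
def pathField (D : Connection E M) (u₀ : OFrame E n m M) (v : ℝ → Eucl n m) (γ : ℝ → M) (s : ℝ) :
    TangentBundle 𝓘(ℝ, E) M :=
  ⟨(dLift D u₀ γ s).pt, (dLift D u₀ γ s).iso (v s)⟩

/-- `ζ` is the flow of `𝐃_v` on the space of smooth paths from `x₀ = π(u₀)`: for every path `γ`,
`(t, s) ↦ (ζ_t γ)_s` is smooth on `ℝ × [0, 1]`, `ζ_0 γ = γ` and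
`d/dt (ζ_t γ)_s = 𝐃_v(ζ_t γ)_s`. -/
structure IsFlow (D : Connection E M) (u₀ : OFrame E n m M) (v : ℝ → Eucl n m)
    (ζ : ℝ → SmoothPath E u₀.pt → SmoothPath E u₀.pt) : Prop where
  smooth : ∀ γ, ContMDiffOn 𝓘(ℝ, ℝ × ℝ) 𝓘(ℝ, E) ∞
    (fun p : ℝ × ℝ => (ζ p.1 γ).1 p.2) (univ ×ˢ Icc 0 1)
  zero : ∀ γ, ∀ s ∈ Icc (0 : ℝ) 1, (ζ 0 γ).1 s = γ.1 s
  deriv : ∀ γ, ∀ t : ℝ, ∀ s ∈ Icc (0 : ℝ) 1,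
    (⟨(ζ t γ).1 s, mfderiv 𝓘(ℝ, ℝ) 𝓘(ℝ, E) (fun t' => (ζ t' γ).1 s) t (1 : ℝ)⟩ :
      TangentBundle 𝓘(ℝ, E) M) = pathField D u₀ v (ζ t γ).1 s

/-- The path `v` with flow `ζ` is tangent to `γ`: for every `s ∈ [0, 1]`, the first variation
`d/dt|_{t=0} φ⁻¹(ζ_t γ)_s` exists and lies in `ℝⁿ`. -/
def IsTangent (D : Connection E M) (u₀ : OFrame E n m M)
    (ζ : ℝ → SmoothPath E u₀.pt → SmoothPath E u₀.pt) (γ : SmoothPath E u₀.pt) : Prop :=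
  ∀ s ∈ Icc (0 : ℝ) 1, ∃ w : Eucl n m,
    HasDerivAt (fun t => antiDev D u₀ (ζ t γ).1 s) w 0 ∧ IsHorVec w

/-- The torsion form of `D` at the frame `u`, on the lifts of `u a` and `u b`. -/
def torsionForm (D : Connection E M) (u : OFrame E n m M) (a b : Eucl n m) : Eucl n m :=
  u.iso.symm (D.torsion u.pt (u.iso a) (u.iso b))

/-- The torsion form of the Bott connection at the frame `u`, on the lifts of `u a` and `u b`. -/
def Foliation.bottTorsionForm (F : Foliation E n M) (u : OFrame E n m M) (a b : Eucl n m) :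
    Eucl n m :=
  u.iso.symm (F.bottTorsion u.pt (u.iso a) (u.iso b))

/-- The curvature form of `D` at the frame `u`, on the lifts of `u a` and `u b`, an endomorphism of
`ℝⁿ⁺ᵐ` applied to `c`. -/
def curvatureForm (D : Connection E M) (u : OFrame E n m M) (a b c : Eucl n m) : Eucl n m :=
  u.iso.symm (curvature D u.pt (u.iso a) (u.iso b) (u.iso c))

/-- `v(s) - ∫₀ˢ T_{u_r}(A dω^𝓗_r, A v(r))`, where `T` is the torsion of the Bott connection. -/
def Foliation.bottVariation (F : Foliation E n M) (D : Connection E M) (u₀ : OFrame E n m M)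
    (v : ℝ → Eucl n m) (γ : ℝ → M) (s : ℝ) : Eucl n m :=
  v s - ∫ r in (0 : ℝ)..s,
    F.bottTorsionForm (dLift D u₀ γ r) (dot (horAntiDev D u₀ γ) r) (horPart (v r))

/-- `p_v(ω^𝓗)_s = v(s) - ∫₀ˢ Tᴰ_{u_r}(A dω^𝓗_r, A v(r) + V v(r))
  - ∫₀ˢ (∫₀ʳ Ωᴰ_{u_τ}(A dω^𝓗_τ, A v(τ) + V v(τ))) dω^𝓗_r`; the endomorphism given by the inner
integral is applied to `dω^𝓗_r` under the integral sign. -/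
def hsuVariation (D : Connection E M) (u₀ : OFrame E n m M)
    (v : ℝ → Eucl n m) (γ : ℝ → M) (s : ℝ) : Eucl n m :=
  v s
    - (∫ r in (0 : ℝ)..s, torsionForm D (dLift D u₀ γ r) (dot (horAntiDev D u₀ γ) r) (v r))
    - ∫ r in (0 : ℝ)..s, ∫ τ in (0 : ℝ)..r,
        curvatureForm D (dLift D u₀ γ τ) (dot (horAntiDev D u₀ γ) τ) (v τ)
          (dot (horAntiDev D u₀ γ) r)

end Paths

end FoliatedPaths

end

/-!
The manifold is compact, so it carries finitely many smooth vector fields `Xₖ` and one-forms `ξᵏ`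
with `a = ∑ ξᵏ(a) Xₖ` for every tangent vector `a` (`exists_spanningFields`). They replace a global
frame. For a connection `D`, put `D_a Xⱼ = ∑ θᵏⱼ(a) Xₖ`. A field `∑ cᵏ Xₖ` along a path is parallel
as soon as `c' = -θ(γ') c`, so the parallel frame `Uᵢ = u eᵢ` and the components
`wᵢ = ∫ ⟪Uᵢ, γ'⟫` of the anti-development come from one linear differential equation
(`SpanningFields.system`, `SpanningFields.exists_isSolution`,
`SpanningFields.IsSolution.dLift_antiDev`).

For the first variation let `Γ(t, s)` be the flow applied to the path, so that `∂ₜΓ = u v` at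
`t = 0`. Solutions of a linear equation are differentiable in a parameter
(`hasDerivAt_solution_param`), hence the derivative `ηᵢ` of `wᵢ` and the covariant derivative `Qᵢ`
of `Uᵢ` in the direction of `t` exist at `t = 0` (`SpanningFields.exists_variation`). The identity
`∂ₜ(θ(∂ₛΓ)) = ∂ₛ(θ(∂ₜΓ)) + dθ(∂ₜΓ, ∂ₛΓ)` for one-forms (`IsSmoothForm.fderiv_pullback_sub`), applied
to the connection forms `θᵏⱼ` and to the forms `⟪Xₖ, ·⟫`, gives

* `∂ₛ⟪Qᵢ, Uⱼ⟫ = ⟪R(∂ₛΓ, ∂ₜΓ) Uᵢ, Uⱼ⟫` (`IsVariation.hasDerivWithinAt_inner_frameVar`),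
* `∂ₛ(ηᵢ - ⟪Uᵢ, ∂ₜΓ⟫) = ⟪Qᵢ, ∂ₛΓ⟫ + ⟪Uᵢ, T(∂ₜΓ, ∂ₛΓ)⟫`
  (`IsVariation.hasDerivWithinAt_antiDev_sub`),

where `R` and `T` belong to `D`. As the frames are orthonormal, `⟪Qᵢ, Uⱼ⟫` is skew-symmetric
(`IsVariation.inner_add_inner`), and two integrations from `s = 0`, where everything vanishes, give
the variation formula `η = p_v(ω)` (`IsVariation.hsuVariation_apply`).

For the characterization of tangent paths the vertical part of `η` is needed. An admissible `D`
preserves the horizontal and vertical bundles, so `Qᵢ` is horizontal for horizontal `Uᵢ`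
(`IsVariation.inner_frameVar_inl_inr`) and the curvature term of a horizontal path has no vertical
part. The vertical part of `T(a, ·)` for horizontal `a` is the Bott torsion of the horizontal part
of the argument (`IsAdapted.verProj_torsion`). Thus `η` has the same vertical part as
`v - ∫ T(A dω, A v)` with the torsion of the Bott connection (`IsVariation.bottVariation_inr`,
`IsFlow.isTangent_iff`). The latter expression involves `D` only through the lift and the
anti-development of a horizontal path, and admissible connections agree in horizontal directions, so
tangency does not depend on `D` (`bottVariation_eq_of_isHorPath`).

The frames and variations are differentiated on the closed interval `[0, 1]`, whereas the identity
for `dθ` is proved at interior points of the domain of `Γ`. Curvature and torsion along `Γ` are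
therefore first written by means of the partial derivatives of `θ(∂ₜΓ)` and `θ(∂ₛΓ)`
(`extCoeff`, `SpanningFields.curvCoeff`, `SpanningFields.torsionCoeff`); these expressions are
continuous on `[0, 1]` and agree with the tensors on `(0, 1)`, which suffices for the integrals.
-/

namespace FoliatedPaths

/-! ### Linear differential equations on `[0, 1]` -/

section LinearODE

variable {V : Type*} [NormedAddCommGroup V] [NormedSpace ℝ V]

lemma hasDerivWithinAt_Ici_of_Icc {f : ℝ → V} {f' : V} {s : ℝ} (hs : s ∈ Ico (0 : ℝ) 1)
    (h : HasDerivWithinAt f f' (Icc 0 1) s) : HasDerivWithinAt f f' (Ici s) s :=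
  h.mono_of_mem_nhdsWithin (Icc_mem_nhdsGE_of_mem hs)

/-- A linear differential equation with continuous coefficients has a solution on all of `[0, 1]`.
The right-hand side is cut off outside a large ball to make it bounded and Lipschitz; by Grönwall's
inequality the solution of the modified equation never leaves that ball. -/
lemma exists_solution_linear [FiniteDimensional ℝ V] {A : ℝ → V →L[ℝ] V}
    (hA : ContinuousOn A (Icc 0 1)) (y₀ : V) :
    ∃ y : ℝ → V, y 0 = y₀ ∧ ∀ s ∈ Icc (0 : ℝ) 1, HasDerivWithinAt y (A s (y s)) (Icc 0 1) s := by
  obtain ⟨K, hK⟩ := isCompact_Icc.exists_bound_of_continuousOn hA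
  have hK0 : 0 ≤ K := (norm_nonneg _).trans (hK 0 (by simp))
  set R : ℝ := ‖y₀‖ * Real.exp (K * 1) + 1 with hR
  have hRpos : 0 < R := by positivity
  let χ : ContDiffBump (0 : V) := ⟨R, R + 1, hRpos, by linarith⟩
  set g : V → V := fun y => χ y • y with hg
  have hgs : ContDiff ℝ 1 g := χ.contDiff.smul contDiff_id
  have hgc : HasCompactSupport g := χ.hasCompactSupport.smul_right
  obtain ⟨C, hC⟩ := hgs.lipschitzWith_of_hasCompactSupport hgc (by simp)
  obtain ⟨B, hB⟩ := hgc.exists_bound_of_continuous hgs.continuous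
  have hB0 : 0 ≤ B := (norm_nonneg _).trans (hB 0)
  have hgn : ∀ y, ‖g y‖ ≤ ‖y‖ := fun y => by
    simp only [hg, norm_smul, Real.norm_eq_abs, abs_of_nonneg χ.nonneg]
    exact mul_le_of_le_one_left (norm_nonneg _) χ.le_one
  have hPL : IsPicardLindelof (fun s y => A s (g y)) (tmin := 0) (tmax := 1) ⟨0, by simp⟩ y₀
      (K.toNNReal * B.toNNReal) 0 (K.toNNReal * B.toNNReal) (K.toNNReal * C) := by
    refine ⟨fun s hs => ?_, fun y _ => hA.clm_apply continuousOn_const, fun s hs y _ => ?_, ?_⟩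
    · refine LipschitzWith.lipschitzOnWith ?_
      refine ((A s).lipschitz.weaken ?_).comp hC
      rw [← NNReal.coe_le_coe, Real.coe_toNNReal _ hK0]
      exact hK s hs
    · rw [NNReal.coe_mul, Real.coe_toNNReal _ hK0, Real.coe_toNNReal _ hB0]
      exact ((A s).le_opNorm _).trans (mul_le_mul (hK s hs) (hB y) (norm_nonneg _) hK0)
    · simp
  obtain ⟨y, hy0, hy⟩ := hPL.exists_eq_forall_mem_Icc_hasDerivWithinAt₀
  refine ⟨y, hy0, ?_⟩
  have hbd : ∀ s ∈ Icc (0 : ℝ) 1, ‖y s‖ ≤ gronwallBound ‖y₀‖ K 0 (s - 0) := by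
    refine norm_le_gronwallBound_of_norm_deriv_right_le
      (fun s hs => (hy s hs).continuousWithinAt)
      (fun s hs => hasDerivWithinAt_Ici_of_Icc hs (hy s (Ico_subset_Icc_self hs)))
      (by simp at hy0; rw [hy0]) fun s hs => ?_
    rw [add_zero]
    exact ((A s).le_opNorm _).trans
      (mul_le_mul (hK s (Ico_subset_Icc_self hs)) (hgn _) (norm_nonneg _) hK0)
  intro s hs
  have hys : ‖y s‖ ≤ R := by
    refine (hbd s hs).trans ?_
    rw [gronwallBound_ε0, sub_zero, hR]
    have : Real.exp (K * s) ≤ Real.exp (K * 1) :=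
      Real.exp_le_exp.2 (mul_le_mul_of_nonneg_left hs.2 hK0)
    nlinarith [norm_nonneg y₀]
  have hone : χ (y s) = 1 := χ.one_of_mem_closedBall (by simpa using hys)
  simpa [hg, hone] using hy s hs

/-- Solutions of a family of linear equations `y' = B_t y` with a common initial value are
differentiable in the parameter at `0`, and the derivative `b` solves the linearized equation. -/
lemma hasDerivAt_solution_param {B : ℝ → ℝ → V →L[ℝ] V} {B' : ℝ → V →L[ℝ] V}
    {y : ℝ → ℝ → V} {b : ℝ → V}
    (hB0 : ContinuousOn (B 0) (Icc 0 1)) (hB' : ContinuousOn B' (Icc 0 1))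
    (hunif : ∀ ε > 0, ∀ᶠ t in 𝓝 (0 : ℝ), ∀ s ∈ Icc (0 : ℝ) 1,
      ‖B t s - B 0 s - t • B' s‖ ≤ ε * |t|)
    (hy0 : ∀ t, y t 0 = y 0 0)
    (hy : ∀ t, ∀ s ∈ Icc (0 : ℝ) 1, HasDerivWithinAt (y t) (B t s (y t s)) (Icc 0 1) s)
    (hb0 : b 0 = 0)
    (hb : ∀ s ∈ Icc (0 : ℝ) 1,
      HasDerivWithinAt b (B 0 s (b s) + B' s (y 0 s)) (Icc 0 1) s)
    {s : ℝ} (hs : s ∈ Icc (0 : ℝ) 1) :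
    HasDerivAt (fun t => y t s) (b s) 0 := by
  obtain ⟨K₀, hK₀⟩ := isCompact_Icc.exists_bound_of_continuousOn hB0
  obtain ⟨K₁, hK₁⟩ := isCompact_Icc.exists_bound_of_continuousOn hB'
  obtain ⟨Y, hY⟩ := isCompact_Icc.exists_bound_of_continuousOn
    (f := y 0) (fun s hs => (hy 0 s hs).continuousWithinAt)
  obtain ⟨C, hC⟩ := isCompact_Icc.exists_bound_of_continuousOn
    (f := b) (fun s hs => (hb s hs).continuousWithinAt)
  have h01 : (0 : ℝ) ∈ Icc (0 : ℝ) 1 := by simp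
  have hK₀0 : 0 ≤ K₀ := (norm_nonneg _).trans (hK₀ 0 h01)
  have hK₁0 : 0 ≤ K₁ := (norm_nonneg _).trans (hK₁ 0 h01)
  have hY0 : 0 ≤ Y := (norm_nonneg _).trans (hY 0 h01)
  have hC0 : 0 ≤ C := (norm_nonneg _).trans (hC 0 h01)
  set K : ℝ := K₀ + K₁ + 1 with hKdef
  have hKpos : 0 < K := by positivity
  set G : ℝ := (Real.exp K - 1) / K with hG
  have hG0 : 0 ≤ G := div_nonneg (by linarith [Real.add_one_le_exp K]) hKpos.le
  rw [hasDerivAt_iff_isLittleO, Asymptotics.isLittleO_iff]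
  intro c hc
  -- The constant is chosen such that the Grönwall bound below is at most `c |t|`.
  set ε : ℝ := min 1 (c / (2 * (Y + 1) * (G + 1))) with hε
  have hε0 : 0 < ε := by positivity
  set δ : ℝ := c / (2 * (K * C + 1) * (G + 1)) with hδ
  have hδ0 : 0 < δ := by positivity
  filter_upwards [hunif ε hε0, Metric.ball_mem_nhds (0 : ℝ) (lt_min one_pos hδ0)] with t ht ht1
  rw [Metric.mem_ball, dist_zero_right, Real.norm_eq_abs, lt_min_iff] at ht1
  have hd : ∀ r ∈ Icc (0 : ℝ) 1, ‖B t r - B 0 r‖ ≤ |t| * (K₁ + 1) := fun r hr => by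
    have h1 := ht r hr
    have h2 : ‖t • B' r‖ ≤ |t| * K₁ := by
      rw [norm_smul, Real.norm_eq_abs]
      exact mul_le_mul_of_nonneg_left (hK₁ r hr) (abs_nonneg _)
    have h3 : ‖B t r - B 0 r‖ ≤ ‖B t r - B 0 r - t • B' r‖ + ‖t • B' r‖ := by
      simpa using norm_add_le (B t r - B 0 r - t • B' r) (t • B' r)
    nlinarith [min_le_left 1 (c / (2 * (Y + 1) * (G + 1))), abs_nonneg t]
  have hBt : ∀ r ∈ Icc (0 : ℝ) 1, ‖B t r‖ ≤ K := fun r hr => by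
    have h3 : ‖B t r‖ ≤ ‖B t r - B 0 r‖ + ‖B 0 r‖ := by
      simpa using norm_add_le (B t r - B 0 r) (B 0 r)
    nlinarith [hd r hr, hK₀ r hr, abs_nonneg t, ht1.1]
  have hmain : ∀ r ∈ Icc (0 : ℝ) 1, ‖y t r - y 0 r - t • b r‖ ≤
      gronwallBound 0 K (ε * |t| * Y + |t| * (|t| * (K * C))) (r - 0) := by
    have hder : ∀ r ∈ Icc (0 : ℝ) 1, HasDerivWithinAt (fun r => y t r - y 0 r - t • b r)
        (B t r (y t r) - B 0 r (y 0 r) - t • (B 0 r (b r) + B' r (y 0 r))) (Icc 0 1) r :=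
      fun r hr => ((hy t r hr).sub (hy 0 r hr)).sub ((hb r hr).const_smul t)
    refine norm_le_gronwallBound_of_norm_deriv_right_le
      (fun r hr => (hder r hr).continuousWithinAt)
      (fun r hr => hasDerivWithinAt_Ici_of_Icc hr (hder r (Ico_subset_Icc_self hr)))
      (by simp [hy0 t, hb0]) fun r hr => ?_
    replace hr := Ico_subset_Icc_self hr
    have heq : B t r (y t r) - B 0 r (y 0 r) - t • (B 0 r (b r) + B' r (y 0 r)) =
        B t r (y t r - y 0 r - t • b r) + ((B t r - B 0 r - t • B' r) (y 0 r)
          + t • (B t r - B 0 r) (b r)) := by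
      simp only [map_sub, map_smul, _root_.sub_apply, _root_.smul_apply]
      module
    rw [heq]
    refine (norm_add_le _ _).trans (add_le_add ?_ ((norm_add_le _ _).trans (add_le_add ?_ ?_)))
    · exact ((B t r).le_opNorm _).trans (mul_le_mul_of_nonneg_right (hBt r hr) (norm_nonneg _))
    · exact (ContinuousLinearMap.le_opNorm _ _).trans
        (mul_le_mul (ht r hr) (hY r hr) (norm_nonneg _) (by positivity))
    · rw [norm_smul, Real.norm_eq_abs]
      refine mul_le_mul_of_nonneg_left ?_ (abs_nonneg _)
      refine (ContinuousLinearMap.le_opNorm _ _).trans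
        ((mul_le_mul (hd r hr) (hC r hr) (norm_nonneg _) (by positivity)).trans ?_)
      rw [mul_assoc]
      refine mul_le_mul_of_nonneg_left (mul_le_mul_of_nonneg_right ?_ hC0) (abs_nonneg _)
      linarith
  have h := hmain s hs
  simp only [sub_zero, Real.norm_eq_abs]
  rw [gronwallBound_of_K_ne_0 hKpos.ne', sub_zero] at h
  refine h.trans ?_
  have hexp : Real.exp (K * s) - 1 ≤ K * G := by
    rw [hG, mul_div_cancel₀ _ hKpos.ne']
    have : Real.exp (K * s) ≤ Real.exp K := Real.exp_le_exp.2 (by nlinarith [hs.2])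
    linarith
  set e : ℝ := ε * |t| * Y + |t| * (|t| * (K * C)) with he
  have he0 : 0 ≤ e := by positivity
  have h1 : 0 * Real.exp (K * s) + e / K * (Real.exp (K * s) - 1) ≤ e * G := by
    rw [zero_mul, zero_add]
    calc e / K * (Real.exp (K * s) - 1) ≤ e / K * (K * G) :=
          mul_le_mul_of_nonneg_left hexp (by positivity)
      _ = e * G := by field_simp
  refine h1.trans ?_
  have h2 : ε * Y * G ≤ c / 2 := by
    have : ε ≤ c / (2 * (Y + 1) * (G + 1)) := min_le_right _ _
    calc ε * Y * G ≤ c / (2 * (Y + 1) * (G + 1)) * (Y + 1) * (G + 1) := by gcongr <;> linarith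
      _ = c / 2 := by field_simp
  have h3 : |t| * (K * C) * G ≤ c / 2 := by
    calc |t| * (K * C) * G ≤ c / (2 * (K * C + 1) * (G + 1)) * (K * C + 1) * (G + 1) := by
          gcongr <;> linarith [ht1.2]
      _ = c / 2 := by field_simp
  calc e * G = |t| * (ε * Y * G + |t| * (K * C) * G) := by rw [he]; ring
    _ ≤ |t| * (c / 2 + c / 2) := by gcongr
    _ = c * |t| := by ring

/-- The first order Taylor expansion in `t` of a smooth function on `ℝ × [0, 1]`, uniformly in the
second variable. -/
lemma uniform_expansion_of_contDiffOn {f : ℝ × ℝ → V}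
    (hf : ContDiffOn ℝ ∞ f (univ ×ˢ Icc 0 1)) {ε : ℝ} (hε : 0 < ε) :
    ∀ᶠ t in 𝓝 (0 : ℝ), ∀ s ∈ Icc (0 : ℝ) 1,
      ‖f (t, s) - f (0, s) - t • fderivWithin ℝ f (univ ×ˢ Icc 0 1) (0, s) (1, 0)‖ ≤ ε * |t| := by
  have hu : UniqueDiffOn ℝ ((univ : Set ℝ) ×ˢ Icc (0 : ℝ) 1) :=
    uniqueDiffOn_univ.prod (uniqueDiffOn_Icc one_pos)
  set f' : ℝ × ℝ → V := fun p => fderivWithin ℝ f (univ ×ˢ Icc 0 1) p (1, 0) with hf'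
  have hcont : ContinuousOn f' (univ ×ˢ Icc 0 1) :=
    (hf.continuousOn_fderivWithin hu (by simp)).clm_apply continuousOn_const
  have hder : ∀ t, ∀ s ∈ Icc (0 : ℝ) 1, HasDerivAt (fun t => f (t, s)) (f' (t, s)) t := by
    intro t s hs
    have h1 : HasFDerivWithinAt f (fderivWithin ℝ f (univ ×ˢ Icc 0 1) (t, s)) (univ ×ˢ Icc 0 1)
        (t, s) := ((hf.differentiableOn (by simp)) _ ⟨trivial, hs⟩).hasFDerivWithinAt
    have h2 : HasDerivWithinAt (fun t : ℝ => (t, s)) ((1 : ℝ), (0 : ℝ)) univ t :=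
      ((hasDerivAt_id t).prodMk (hasDerivAt_const t s)).hasDerivWithinAt
    have := HasFDerivWithinAt.comp_hasDerivWithinAt (s := univ) (t := univ ×ˢ Icc (0 : ℝ) 1) t h1 h2
      (fun r _ => Set.mk_mem_prod trivial hs)
    exact hasDerivWithinAt_univ.1 this
  have hK : IsCompact (Icc (-1 : ℝ) 1 ×ˢ Icc (0 : ℝ) 1) := isCompact_Icc.prod isCompact_Icc
  have huc := hK.uniformContinuousOn_of_continuous
    (hcont.mono (prod_mono_left (subset_univ _)))
  obtain ⟨δ, hδ, hδ'⟩ := Metric.uniformContinuousOn_iff_le.1 huc ε hε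
  filter_upwards [Metric.closedBall_mem_nhds (0 : ℝ) (lt_min one_pos hδ)] with t ht s hs
  rw [mem_closedBall_zero_iff, Real.norm_eq_abs, le_min_iff] at ht
  have hd : ∀ r ∈ Metric.closedBall (0 : ℝ) |t|, HasDerivWithinAt
      (fun r => f (r, s) - r • f' (0, s)) (f' (r, s) - (1 : ℝ) • f' (0, s))
      (Metric.closedBall 0 |t|) r := fun r _ =>
    ((hder r s hs).sub ((hasDerivAt_id r).smul_const _)).hasDerivWithinAt
  have hbound : ∀ r ∈ Metric.closedBall (0 : ℝ) |t|, ‖f' (r, s) - (1 : ℝ) • f' (0, s)‖ ≤ ε := by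
    intro r hr
    rw [mem_closedBall_zero_iff, Real.norm_eq_abs] at hr
    rw [one_smul, ← dist_eq_norm]
    refine hδ' _ ⟨abs_le.1 (hr.trans ht.1), hs⟩ _ ⟨by simp, hs⟩ ?_
    simp [Prod.dist_eq, hr.trans ht.2]
  have := (convex_closedBall (0 : ℝ) |t|).norm_image_sub_le_of_norm_hasDerivWithin_le hd hbound
    (x := 0) (y := t) (by simp) (by simp)
  simpa [sub_right_comm] using this

lemma eq_of_hasDerivWithinAt_zero {f : ℝ → ℝ}
    (hf : ∀ s ∈ Icc (0 : ℝ) 1, HasDerivWithinAt f 0 (Icc 0 1) s) {s : ℝ} (hs : s ∈ Icc (0 : ℝ) 1) :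
    f s = f 0 := by
  refine constant_of_derivWithin_zero (fun s hs => (hf s hs).differentiableWithinAt)
    (fun s hs => ?_) s hs
  exact (hf s (Ico_subset_Icc_self hs)).derivWithin
    (uniqueDiffOn_Icc one_pos s (Ico_subset_Icc_self hs))

end LinearODE

/-! ### One-forms and spanning families of vector fields -/

section Spanning

variable {E : Type*} [NormedAddCommGroup E] [NormedSpace ℝ E] [FiniteDimensional ℝ E]
  {M : Type*} [TopologicalSpace M] [ChartedSpace E M] [IsManifold 𝓘(ℝ, E) ∞ M]

/-- A one-form on `M` is smooth if it is smooth as a function on the tangent bundle. -/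
def IsSmoothForm (θ : (x : M) → TangentSpace 𝓘(ℝ, E) x →L[ℝ] ℝ) : Prop :=
  ContMDiff 𝓘(ℝ, E).tangent 𝓘(ℝ, ℝ) ∞ (fun p : TangentBundle 𝓘(ℝ, E) M => θ p.1 p.2)

/-- Finitely many smooth vector fields `X i` which span every tangent space, with smooth one-forms
`ξ i` such that `a = ∑ i, ξ i a • X i` for every tangent vector `a`. The `X i` need not be linearly
independent, so that they exist on any compact manifold. -/
structure SpanningFields (E : Type*) [NormedAddCommGroup E] [NormedSpace ℝ E]
    (M : Type*) [TopologicalSpace M] [ChartedSpace E M] [IsManifold 𝓘(ℝ, E) ∞ M]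
    (ι : Type*) [Fintype ι] where
  X : ι → VField E M
  ξ : ι → (x : M) → TangentSpace 𝓘(ℝ, E) x →L[ℝ] ℝ
  smooth_X : ∀ i, IsSmoothField (X i)
  smooth_ξ : ∀ i, IsSmoothForm (ξ i)
  sum_eq : ∀ (x : M) (a : TangentSpace 𝓘(ℝ, E) x), ∑ i, ξ i x a • X i x = a

lemma IsSmoothForm.comp {N : Type*} {E' : Type*} [NormedAddCommGroup E'] [NormedSpace ℝ E']
    [TopologicalSpace N] [ChartedSpace E' N]
    {θ : (x : M) → TangentSpace 𝓘(ℝ, E) x →L[ℝ] ℝ} (hθ : IsSmoothForm θ)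
    {f : N → TangentBundle 𝓘(ℝ, E) M} {s : Set N} {y : N}
    (hf : ContMDiffWithinAt 𝓘(ℝ, E') 𝓘(ℝ, E).tangent ∞ f s y) :
    ContMDiffWithinAt 𝓘(ℝ, E') 𝓘(ℝ, ℝ) ∞ (fun y => θ (f y).1 (f y).2) s y :=
  ContMDiffAt.comp_contMDiffWithinAt y (hθ (f y)) hf

lemma IsSmoothForm.apply_field {θ : (x : M) → TangentSpace 𝓘(ℝ, E) x →L[ℝ] ℝ}
    (hθ : IsSmoothForm θ) {X : VField E M} {x : M}
    (hX : ContMDiffAt 𝓘(ℝ, E) 𝓘(ℝ, E).tangent ∞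
      (fun x => (⟨x, X x⟩ : TangentBundle 𝓘(ℝ, E) M)) x) :
    ContMDiffAt 𝓘(ℝ, E) 𝓘(ℝ, ℝ) ∞ (fun y => θ y (X y)) x := by
  rw [← contMDiffWithinAt_univ] at hX ⊢
  exact hθ.comp hX

lemma IsSmoothForm.mdifferentiableAt_apply_field
    {θ : (x : M) → TangentSpace 𝓘(ℝ, E) x →L[ℝ] ℝ}
    (hθ : IsSmoothForm θ) {X : VField E M} {x : M} (hX : MDiffAt (T% X) x) :
    MDifferentiableAt 𝓘(ℝ, E) 𝓘(ℝ, ℝ) (fun y => θ y (X y)) x :=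
  MDifferentiableAt.comp x (f := T% X)
    (g := fun p : TangentBundle 𝓘(ℝ, E) M => θ p.1 p.2)
    ((hθ _).mdifferentiableAt (by simp)) hX

lemma IsSmoothField.mdifferentiableAt {X : VField E M} (hX : IsSmoothField X) (x : M) :
    MDiffAt (T% X) x :=
  (hX x).mdifferentiableAt (by simp)

/-- The fields and forms are obtained from the local frames of finitely many trivializations of the
tangent bundle, multiplied by bump functions. -/
theorem exists_spanningFields [T2Space M] [CompactSpace M] :
    ∃ t : Finset M, Nonempty (SpanningFields E M (t × Fin (Module.finrank ℝ E))) := by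
  classical
  let ρ : ∀ z : M, SmoothBumpFunction 𝓘(ℝ, E) z := fun z => Classical.arbitrary _
  obtain ⟨t, -, ht⟩ := isCompact_univ.elim_nhds_subcover (fun z : M => Function.support (ρ z))
    (fun z _ => (ρ z).support_mem_nhds)
  let e := fun z : M => trivializationAt E (TangentSpace 𝓘(ℝ, E) : M → Type _) z
  let b := Module.finBasis ℝ E
  let σ : M → ℝ := fun x => ∑ z : t, ρ z x * ρ z x
  have hσs : ContMDiff 𝓘(ℝ, E) 𝓘(ℝ, ℝ) ∞ σ := by
    exact ContMDiff.sum (t := Finset.univ) (f := fun (z : t) x => ρ z x * ρ z x)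
      fun z _ => (ρ z).contMDiff.mul (ρ z).contMDiff
  have hσ : ∀ x, σ x ≠ 0 := fun x => by
    obtain ⟨z, hz, hzx⟩ : ∃ z ∈ t, x ∈ Function.support (ρ z) := by
      simpa using ht (mem_univ x)
    have h1 : 0 < ρ z x * ρ z x :=
      mul_self_pos.2 hzx
    exact (Finset.sum_pos' (f := fun z : t => ρ z x * ρ z x) (fun z _ => mul_self_nonneg _)
      ⟨⟨z, hz⟩, Finset.mem_univ _, h1⟩).ne'
  have hts : ∀ z, tsupport (ρ z) ⊆ (e z).baseSet := fun z => by
    simpa [e] using (ρ z).tsupport_subset_chartAt_source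
  refine ⟨t, ⟨{
    X := fun i x => ρ i.1 x • (e i.1).localFrame b i.2 x
    ξ := fun i x => ((σ x)⁻¹ * ρ i.1 x) •
      ((b.coord i.2).toContinuousLinearMap ∘L (e i.1).continuousLinearMapAt ℝ x)
    smooth_X := fun i => ?_
    smooth_ξ := fun i => ?_
    sum_eq := fun x a => ?_ }⟩⟩
  · exact ContMDiffOn.smul_section_of_tsupport (ρ i.1).contMDiff.contMDiffOn
      (e i.1).open_baseSet (hts _) ((e i.1).contMDiffOn_localFrame_baseSet ∞ b i.2)
  · have hσ' : ContMDiff 𝓘(ℝ, E).tangent 𝓘(ℝ, ℝ) ∞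
        (fun p : TangentBundle 𝓘(ℝ, E) M => (σ p.1)⁻¹ * ρ i.1 p.1) :=
      ((hσs.inv₀ hσ).mul (ρ i.1).contMDiff).comp (contMDiff_proj _)
    intro p
    by_cases hp : p.1 ∈ tsupport (ρ i.1)
    · have hp' : p.1 ∈ (e i.1).baseSet := hts _ hp
      have h1 : ContMDiffAt 𝓘(ℝ, E).tangent 𝓘(ℝ, E) ∞
          (fun q : TangentBundle 𝓘(ℝ, E) M => (e i.1 q).2) p :=
        ContMDiffAt.snd (((e i.1).contMDiffOn (n := ∞) (IB := 𝓘(ℝ, E))).contMDiffAt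
          ((e i.1).open_source.mem_nhds ((e i.1).mem_source.2 hp')))
      have h2 : ContMDiffAt 𝓘(ℝ, E).tangent 𝓘(ℝ, ℝ) ∞
          (fun q : TangentBundle 𝓘(ℝ, E) M =>
            (b.coord i.2).toContinuousLinearMap (e i.1 q).2) p :=
        ContMDiffAt.comp p ((b.coord i.2).toContinuousLinearMap.contMDiff _) h1
      refine ((hσ' p).mul h2).congr_of_eventuallyEq ?_
      have hn : ∀ᶠ q : TangentBundle 𝓘(ℝ, E) M in 𝓝 p, q.1 ∈ (e i.1).baseSet :=
        (FiberBundle.continuous_proj E _).continuousAt.eventually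
          ((e i.1).open_baseSet.mem_nhds hp')
      filter_upwards [hn] with q hq
      simp [(e i.1).coe_linearMapAt_of_mem hq]
    · have hn : ∀ᶠ q : TangentBundle 𝓘(ℝ, E) M in 𝓝 p, q.1 ∈ (tsupport (ρ i.1))ᶜ :=
        (FiberBundle.continuous_proj E _).continuousAt.eventually
          ((isClosed_tsupport _).isOpen_compl.mem_nhds hp)
      refine (contMDiffAt_const (c := (0 : ℝ))).congr_of_eventuallyEq ?_
      filter_upwards [hn] with q hq
      simp [image_eq_zero_of_notMem_tsupport hq]
  · have key : ∀ z : t, ∑ k, (((σ x)⁻¹ * ρ z x) • ((b.coord k).toContinuousLinearMap ∘L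
        (e z).continuousLinearMapAt ℝ x)) a • ρ z x • (e z).localFrame b k x =
        ((σ x)⁻¹ * (ρ z x * ρ z x)) • a := by
      intro z
      by_cases hx : x ∈ (e z).baseSet
      · have h2 : ∑ k, b.repr (e z ⟨x, a⟩).2 k • (e z).localFrame b k x = a := by
          conv_rhs => rw [← ((e z).basisAt b hx).sum_repr a]
          refine Finset.sum_congr rfl fun k _ => ?_
          simp [Bundle.Trivialization.basisAt, hx]
        conv_rhs => rw [← h2, Finset.smul_sum]
        refine Finset.sum_congr rfl fun k _ => ?_
        simp [(e z).coe_linearMapAt_of_mem hx, smul_smul]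
        ring_nf
      · have : ρ z x = 0 := image_eq_zero_of_notMem_tsupport fun h => hx (hts _ h)
        simp [this]
    rw [Fintype.sum_prod_type]
    simp only [key]
    rw [← Finset.sum_smul, ← Finset.mul_sum]
    change ((σ x)⁻¹ * σ x) • a = a
    rw [inv_mul_cancel₀ (hσ x), one_smul]

end Spanning

/-! ### Smoothness of the horizontal and vertical projections -/

section Projection

variable {E : Type*} [NormedAddCommGroup E] [NormedSpace ℝ E] [FiniteDimensional ℝ E] {n : ℕ}
  {M : Type*} [TopologicalSpace M] [ChartedSpace E M] [IsManifold 𝓘(ℝ, E) ∞ M]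

/-- A family of linear maps on a finite-dimensional space is smooth if all its evaluations are. -/
lemma contMDiffAt_clm_of_apply {G : Type*} [NormedAddCommGroup G] [NormedSpace ℝ G]
    {G' : Type*} [NormedAddCommGroup G'] [NormedSpace ℝ G'] [FiniteDimensional ℝ G]
    {f : M → G →L[ℝ] G'} {x : M}
    (h : ∀ v, ContMDiffAt 𝓘(ℝ, E) 𝓘(ℝ, G') ∞ (fun y => f y v) x) :
    ContMDiffAt 𝓘(ℝ, E) 𝓘(ℝ, G →L[ℝ] G') ∞ f x := by
  let b := Module.finBasis ℝ G
  have heq : f = fun y => ∑ i, ContinuousLinearMap.smulRightL ℝ G G'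
      (b.coord i).toContinuousLinearMap (f y (b i)) := by
    funext y
    ext v
    conv_lhs => rw [← b.sum_repr v, map_sum]
    simp
  rw [heq]
  refine ContMDiffAt.sum fun i _ => ?_
  exact ContMDiffAt.comp x (g := ContinuousLinearMap.smulRightL ℝ G G'
    (b.coord i).toContinuousLinearMap) (ContinuousLinearMap.contMDiff _).contMDiffAt (h (b i))

lemma finrank_dual_clm (V : Type*) [NormedAddCommGroup V] [NormedSpace ℝ V]
    [FiniteDimensional ℝ V] : Module.finrank ℝ (V →L[ℝ] ℝ) = Module.finrank ℝ V :=
  (LinearMap.toContinuousLinearMap (𝕜 := ℝ) (E := V) (F' := ℝ)).finrank_eq.symm.trans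
    Subspace.dual_finrank_eq

lemma Foliation.exists_mem_U (F : Foliation E n M) (x : M) : ∃ α, x ∈ F.U α := by
  have := F.iUnion_U ▸ mem_univ x
  simpa using this

lemma Foliation.mdifferentiableAt_p (F : Foliation E n M) {α : F.ι} {x : M} (hx : x ∈ F.U α) :
    MDifferentiableAt 𝓘(ℝ, E) (𝓡 n) (F.p α) x :=
  ((F.contMDiffOn_p α).contMDiffAt ((F.isOpen_U α).mem_nhds hx)).mdifferentiableAt (by simp)

/-- By the compatibility of the disintegrating maps, each of them determines the vertical space. -/
lemma Foliation.vertical_eq_ker (F : Foliation E n M) {α : F.ι} {x : M} (hx : x ∈ F.U α) :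
    F.vertical x = LinearMap.ker (mfderiv 𝓘(ℝ, E) (𝓡 n) (F.p α) x).toLinearMap := by
  refine le_antisymm (iInf₂_le α hx) (le_iInf₂ fun β hβ a ha => ?_)
  obtain ⟨Ψ, hΨ, hΨ'⟩ := F.transition β α ⟨x, hβ, hx⟩
  have hd : MDifferentiableAt (𝓡 n) (𝓡 n) Ψ (F.p α x) :=
    (hΨ ⟨F.p α x, mem_image_of_mem _ ⟨hβ, hx⟩⟩).mdifferentiableAt (by simp)
  have heq : F.p β =ᶠ[𝓝 x] Ψ ∘ F.p α := by
    filter_upwards [((F.isOpen_U β).inter (F.isOpen_U α)).mem_nhds ⟨hβ, hx⟩] with y hy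
    exact hΨ' y hy
  have h1 := mfderiv_comp x hd (F.mdifferentiableAt_p hx)
  have h2 := heq.mfderiv_eq (I := 𝓘(ℝ, E)) (I' := 𝓡 n)
  simp only [LinearMap.mem_ker, ContinuousLinearMap.coe_coe] at ha ⊢
  rw [h2, h1]
  change mfderiv (𝓡 n) (𝓡 n) Ψ (F.p α x) (mfderiv 𝓘(ℝ, E) (𝓡 n) (F.p α) x a) = 0
  rw [ha, map_zero]

/-- The smooth local section given by a constant vector in a trivialization of `TM`. -/
lemma contMDiffAt_symmL (x : M) (v : E) :
    ContMDiffAt 𝓘(ℝ, E) 𝓘(ℝ, E).tangent ∞ (fun y => (⟨y,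
      (trivializationAt E (TangentSpace 𝓘(ℝ, E) : M → Type _) x).symmL ℝ y v⟩ :
        TangentBundle 𝓘(ℝ, E) M)) x := by
  have h := FiberBundle.contMDiffAt_extend (k := ∞) 𝓘(ℝ, E) E
    ((trivializationAt E (TangentSpace 𝓘(ℝ, E) : M → Type _) x).symmL ℝ x v)
  have hx : x ∈ (trivializationAt E (TangentSpace 𝓘(ℝ, E) : M → Type _) x).baseSet :=
    FiberBundle.mem_baseSet_trivializationAt' x
  refine h.congr_of_eventuallyEq ?_
  filter_upwards [(Trivialization.open_baseSet _).mem_nhds hx] with y hy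
  rw [Trivialization.symmL_apply _ hy]
  let e := trivializationAt E (TangentSpace 𝓘(ℝ, E) : M → Type _) x
  have h1 : e ⟨x, e.symmL ℝ x v⟩ = (x, v) := by
    rw [e.symmL_apply hx]
    exact e.apply_mk_symm hx v
  exact congrArg (fun w => (⟨y, e.symm y w⟩ : TangentBundle 𝓘(ℝ, E) M))
    (congrArg Prod.snd h1).symm

variable [RiemannianBundle (fun x : M => TangentSpace 𝓘(ℝ, E) x)]
  [IsContMDiffRiemannianBundle 𝓘(ℝ, E) ∞ E (fun x : M => TangentSpace 𝓘(ℝ, E) x)]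

/-- In a local trivialization, let `G` be the metric and `A` the differential of a disintegrating
map. The orthogonal projection of `w` to `ker A` is the first component of the solution `(p, μ)` of
the linear system `G p + μ ∘ A = G w`, `A p = 0`, whose coefficients are smooth and whose matrix is
invertible. -/
theorem Foliation.isSmoothField_ver (F : Foliation E n M) {X : VField E M}
    (hX : IsSmoothField X) : IsSmoothField (F.ver X) := by
  intro x₀
  obtain ⟨α, hα⟩ := F.exists_mem_U x₀
  let e := trivializationAt E (TangentSpace 𝓘(ℝ, E) : M → Type _) x₀
  have hx₀ : x₀ ∈ e.baseSet := FiberBundle.mem_baseSet_trivializationAt' x₀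
  obtain ⟨g, -, hg⟩ := IsContMDiffRiemannianBundle.exists_contMDiff (IB := 𝓘(ℝ, E)) (n := ∞)
    (F := E) (E := fun x : M => TangentSpace 𝓘(ℝ, E) x)
  let A : M → E →L[ℝ] EuclideanSpace ℝ (Fin n) := fun y =>
    (mfderiv 𝓘(ℝ, E) (𝓡 n) (F.p α) y : TangentSpace 𝓘(ℝ, E) y →L[ℝ] EuclideanSpace ℝ (Fin n)) ∘L
      e.symmL ℝ y
  let G : M → E →L[ℝ] E →L[ℝ] ℝ := fun y => (g y).bilinearComp (e.symmL ℝ y) (e.symmL ℝ y)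
  have hG : ∀ y v w, G y v w = inner ℝ (e.symmL ℝ y v) (e.symmL ℝ y w) := fun y v w => by
    rw [hg]; rfl
  have hGs : ContMDiffAt 𝓘(ℝ, E) 𝓘(ℝ, E →L[ℝ] E →L[ℝ] ℝ) ∞ G x₀ := by
    refine contMDiffAt_clm_of_apply fun v => contMDiffAt_clm_of_apply fun w => ?_
    simp only [hG]
    exact ContMDiffAt.inner_bundle (E := fun x : M => TangentSpace 𝓘(ℝ, E) x)
      (contMDiffAt_symmL x₀ v) (contMDiffAt_symmL x₀ w)
  have hAs : ContMDiffAt 𝓘(ℝ, E) 𝓘(ℝ, E →L[ℝ] EuclideanSpace ℝ (Fin n)) ∞ A x₀ := by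
    refine contMDiffAt_clm_of_apply fun v => ?_
    have h1 := (F.contMDiffOn_p α).contMDiffOn_tangentMapWithin (m := ∞) (by simp)
      (F.isOpen_U α).uniqueMDiffOn
    have h2 : ContMDiffAt 𝓘(ℝ, E) (𝓡 n).tangent ∞ (fun y => tangentMapWithin 𝓘(ℝ, E) (𝓡 n)
        (F.p α) (F.U α) ⟨y, e.symmL ℝ y v⟩) x₀ :=
      ContMDiffAt.comp x₀ (h1.contMDiffAt
        (((F.isOpen_U α).preimage (FiberBundle.continuous_proj E _)).mem_nhds hα))
        (contMDiffAt_symmL x₀ v)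
    have h3 : ContMDiffAt 𝓘(ℝ, E) 𝓘(ℝ, EuclideanSpace ℝ (Fin n)) ∞ (fun y =>
        (tangentMapWithin 𝓘(ℝ, E) (𝓡 n) (F.p α) (F.U α) ⟨y, e.symmL ℝ y v⟩).2) x₀ :=
      ContMDiffAt.comp x₀ (contMDiff_snd_tangentBundle_modelSpace _ 𝓘(ℝ, EuclideanSpace ℝ (Fin n))
        _) h2
    refine h3.congr_of_eventuallyEq ?_
    filter_upwards [(F.isOpen_U α).mem_nhds hα] with y hy
    change _ = mfderivWithin 𝓘(ℝ, E) (𝓡 n) (F.p α) (F.U α) y _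
    rw [mfderivWithin_of_isOpen (F.isOpen_U α) hy]
    rfl
  let L : M → (E × (EuclideanSpace ℝ (Fin n) →L[ℝ] ℝ)) →L[ℝ]
      ((E →L[ℝ] ℝ) × EuclideanSpace ℝ (Fin n)) := fun y =>
    ((G y) ∘L (ContinuousLinearMap.fst ℝ _ _) +
      ((ContinuousLinearMap.compL ℝ E (EuclideanSpace ℝ (Fin n)) ℝ).flip (A y)) ∘L
        (ContinuousLinearMap.snd ℝ _ _)).prod ((A y) ∘L (ContinuousLinearMap.fst ℝ _ _))
  have hL : ∀ y q, L y q = (G y q.1 + q.2 ∘L A y, A y q.1) := fun y q => rfl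
  have hLs : ContMDiffAt 𝓘(ℝ, E) 𝓘(ℝ, (E × (EuclideanSpace ℝ (Fin n) →L[ℝ] ℝ)) →L[ℝ]
      ((E →L[ℝ] ℝ) × EuclideanSpace ℝ (Fin n))) ∞ L x₀ := by
    refine contMDiffAt_clm_of_apply fun q => ?_
    simp only [hL]
    refine ContMDiffAt.prodMk_space ?_ ?_
    · refine (hGs.clm_apply contMDiffAt_const).add ?_
      exact ContMDiffAt.clm_comp contMDiffAt_const hAs
    · exact hAs.clm_apply contMDiffAt_const
  have hbij : ∀ y ∈ e.baseSet ∩ F.U α, (L y).IsInvertible := by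
    rintro y ⟨hy, hyα⟩
    have hsurj : Function.Surjective (A y) := by
      intro z
      obtain ⟨a, ha⟩ := F.surjective_mfderiv α y hyα z
      refine ⟨e.continuousLinearMapAt ℝ y a, ?_⟩
      change mfderiv 𝓘(ℝ, E) (𝓡 n) (F.p α) y (e.symmL ℝ y (e.continuousLinearMapAt ℝ y a)) = z
      rw [e.symmL_continuousLinearMapAt hy]
      exact ha
    have hinj : Function.Injective (L y) := by
      rw [injective_iff_map_eq_zero]
      rintro ⟨q, μ⟩ h
      rw [hL, Prod.mk_eq_zero] at h
      obtain ⟨h1, h2⟩ := h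
      simp only at h1 h2
      have h3 : G y q q = 0 := by
        have := congrArg (fun l : E →L[ℝ] ℝ => l q) h1
        simpa [h2] using this
      rw [hG, inner_self_eq_zero] at h3
      have hq : q = 0 := by
        have := congrArg (e.continuousLinearMapAt ℝ y) h3
        rwa [e.continuousLinearMapAt_symmL hy, map_zero] at this
      refine Prod.mk_eq_zero.2 ⟨hq, ?_⟩
      ext z
      obtain ⟨w, rfl⟩ := hsurj z
      have := congrArg (fun l : E →L[ℝ] ℝ => l w) h1
      simpa [hq] using this
    have hfin : Module.finrank ℝ (E × (EuclideanSpace ℝ (Fin n) →L[ℝ] ℝ)) =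
        Module.finrank ℝ ((E →L[ℝ] ℝ) × EuclideanSpace ℝ (Fin n)) := by
      rw [Module.finrank_prod, Module.finrank_prod, finrank_dual_clm, finrank_dual_clm]
    exact ⟨(LinearEquiv.ofInjectiveOfFinrankEq (L y).toLinearMap hinj
      hfin).toContinuousLinearEquiv, ContinuousLinearMap.ext fun _ => rfl⟩
  have hinv : ContMDiffAt 𝓘(ℝ, E) 𝓘(ℝ, ((E →L[ℝ] ℝ) × EuclideanSpace ℝ (Fin n)) →L[ℝ]
      (E × (EuclideanSpace ℝ (Fin n) →L[ℝ] ℝ))) ∞ (fun y => (L y).inverse) x₀ := by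
    obtain ⟨L₀, hL₀⟩ := hbij x₀ ⟨hx₀, hα⟩
    have := contDiffAt_map_inverse (n := ∞) L₀
    rw [hL₀] at this
    exact ContMDiffAt.comp x₀ this.contMDiffAt hLs
  have hw : ContMDiffAt 𝓘(ℝ, E) 𝓘(ℝ, E) ∞ (fun y => (e ⟨y, X y⟩).2) x₀ :=
    (contMDiffAt_section (IB := 𝓘(ℝ, E)) (n := ∞) (F := E) (E := TangentSpace 𝓘(ℝ, E)) x₀).1 (hX x₀)
  refine (contMDiffAt_section (IB := 𝓘(ℝ, E)) (n := ∞) (F := E)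
    (E := TangentSpace 𝓘(ℝ, E)) x₀).2 ?_
  have hsol : ContMDiffAt 𝓘(ℝ, E) 𝓘(ℝ, E) ∞
      (fun y => ((L y).inverse (G y (e ⟨y, X y⟩).2, 0)).1) x₀ :=
    ContMDiffAt.comp x₀ contDiff_fst.contMDiff.contMDiffAt
      (hinv.clm_apply ((hGs.clm_apply hw).prodMk_space contMDiffAt_const))
  refine hsol.congr_of_eventuallyEq ?_
  filter_upwards [(e.open_baseSet.inter (F.isOpen_U α)).mem_nhds ⟨hx₀, hα⟩] with y hy
  set q := (L y).inverse (G y (e ⟨y, X y⟩).2, 0) with hq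
  have hLq : L y q = (G y (e ⟨y, X y⟩).2, 0) := by
    obtain ⟨L₁, hL₁⟩ := hbij y hy
    rw [hq, ← hL₁]
    simp
  rw [hL, Prod.mk.injEq] at hLq
  have hXe : e.symmL ℝ y (e ⟨y, X y⟩).2 = X y := by
    have := e.symmL_continuousLinearMapAt (R := ℝ) hy.1 (X y)
    rwa [Trivialization.continuousLinearMapAt_apply, e.coe_linearMapAt_of_mem hy.1] at this
  have hver : F.ver X y = e.symmL ℝ y q.1 := by
    refine Submodule.eq_starProjection_of_mem_of_inner_eq_zero ?_ ?_
    · rw [F.vertical_eq_ker hy.2]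
      exact hLq.2
    · intro w hw
      have hAw : A y (e.continuousLinearMapAt ℝ y w) = 0 := by
        rw [F.vertical_eq_ker hy.2] at hw
        change mfderiv 𝓘(ℝ, E) (𝓡 n) (F.p α) y (e.symmL ℝ y (e.continuousLinearMapAt ℝ y w)) = 0
        rw [e.symmL_continuousLinearMapAt hy.1]
        exact hw
      have h1 := congrArg (fun l : E →L[ℝ] ℝ => l (e.continuousLinearMapAt ℝ y w)) hLq.1
      simp only [_root_.add_apply, ContinuousLinearMap.comp_apply, hAw, map_zero, add_zero] at h1
      rw [hG, hG, e.symmL_continuousLinearMapAt hy.1, hXe] at h1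
      rw [inner_sub_left, h1, sub_self]
  change (e ⟨y, F.ver X y⟩).2 = q.1
  rw [hver]
  have := e.continuousLinearMapAt_symmL (R := ℝ) hy.1 q.1
  rwa [Trivialization.continuousLinearMapAt_apply, e.coe_linearMapAt_of_mem hy.1] at this

end Projection

/-! ### Covariant derivatives of combinations of fields, along curves -/

section Combinations

variable {E : Type*} [NormedAddCommGroup E] [NormedSpace ℝ E] [FiniteDimensional ℝ E] {n : ℕ}
  {M : Type*} [TopologicalSpace M] [ChartedSpace E M] [IsManifold 𝓘(ℝ, E) ∞ M]
  {ι : Type*} [Fintype ι]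

lemma cov_sum (D : Connection E M) {f : ι → M → ℝ} {X : ι → VField E M} {x : M}
    (hf : ∀ i, MDifferentiableAt 𝓘(ℝ, E) 𝓘(ℝ, ℝ) (f i) x)
    (hX : ∀ i, MDiffAt (T% (X i)) x) (a : TangentSpace 𝓘(ℝ, E) x) :
    D (fun y => ∑ i, f i y • X i y) x a =
      ∑ i, (f i x • D (X i) x a + mvfderiv 𝓘(ℝ, E) (f i) x a • X i x) := by
  classical
  have key : ∀ s : Finset ι, D (fun y => ∑ i ∈ s, f i y • X i y) x a =
      ∑ i ∈ s, (f i x • D (X i) x a + mvfderiv 𝓘(ℝ, E) (f i) x a • X i x) := by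
    intro s
    induction s using Finset.induction_on with
    | empty =>
      have : (fun y : M => ∑ i ∈ (∅ : Finset ι), f i y • X i y) = 0 := by
        funext y; simp
      rw [this, D.zero]
      simp
    | insert j s hj ih =>
      have h1 : (fun y => ∑ i ∈ insert j s, f i y • X i y) =
          (f j • X j) + (fun y => ∑ i ∈ s, f i y • X i y) := by
        funext y
        simp [Finset.sum_insert hj]
      have h2 : MDiffAt (T% (fun y => ∑ i ∈ s, f i y • X i y)) x :=
        MDifferentiableAt.sum_section fun i _ => (hf i).smul_section (hX i)
      rw [h1, D.isCovariantDerivativeOnUniv.add ((hf j).smul_section (hX j)) h2,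
        D.isCovariantDerivativeOnUniv.leibniz (hX j) (hf j), Finset.sum_insert hj, ← ih]
      simp
  exact key Finset.univ

lemma cov_congr (D : Connection E M) {X Y : VField E M} {x : M} (hX : MDiffAt (T% X) x)
    (hXY : ∀ᶠ y in 𝓝 x, X y = Y y) : D X x = D Y x := by
  refine D.isCovariantDerivativeOnUniv.congr_of_eventuallyEq hX ?_ Filter.univ_mem hXY
  refine hX.congr_of_eventuallyEq ?_
  filter_upwards [hXY] with y hy
  rw [hy]

/-- The derivative of a function along a curve. -/
lemma hasDerivWithinAt_comp_curve {G : Type*} [NormedAddCommGroup G] [NormedSpace ℝ G]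
    {f : M → G} {κ : ℝ → M} {I : Set ℝ} {s : ℝ}
    (hf : MDifferentiableAt 𝓘(ℝ, E) 𝓘(ℝ, G) f (κ s))
    (hκ : MDifferentiableWithinAt 𝓘(ℝ, ℝ) 𝓘(ℝ, E) κ I s) :
    HasDerivWithinAt (fun r => f (κ r))
      (mvfderiv 𝓘(ℝ, E) f (κ s) (mfderivWithin 𝓘(ℝ, ℝ) 𝓘(ℝ, E) κ I s (1 : ℝ))) I s := by
  have h := hf.hasMFDerivAt.comp_hasMFDerivWithinAt s hκ.hasMFDerivWithinAt
  have h' : HasFDerivWithinAt (fun r => f (κ r)) ((mvfderiv 𝓘(ℝ, E) f (κ s)) ∘L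
      (mfderivWithin 𝓘(ℝ, ℝ) 𝓘(ℝ, E) κ I s) : ℝ →L[ℝ] G) I s := h.hasFDerivWithinAt
  exact h'.hasDerivWithinAt

/-- In the trivialization of `TM` centred at `x`, a connection is the derivative plus a term of
order zero. -/
lemma cov_symmL (D : Connection E M) {x : M} {φ : M → E}
    (hφ : MDifferentiableAt 𝓘(ℝ, E) 𝓘(ℝ, E) φ x) (a : TangentSpace 𝓘(ℝ, E) x) :
    D (fun y => (trivializationAt E (TangentSpace 𝓘(ℝ, E) : M → Type _) x).symmL ℝ y (φ y)) x a =
      (trivializationAt E (TangentSpace 𝓘(ℝ, E) : M → Type _) x).symmL ℝ x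
        (mvfderiv 𝓘(ℝ, E) φ x a) +
      D (fun y =>
        (trivializationAt E (TangentSpace 𝓘(ℝ, E) : M → Type _) x).symmL ℝ y (φ x)) x a := by
  let e := trivializationAt E (TangentSpace 𝓘(ℝ, E) : M → Type _) x
  let b := Module.finBasis ℝ E
  have hb : ∀ i, MDiffAt (T% (fun y => e.symmL ℝ y (b i))) x := fun i =>
    (contMDiffAt_symmL x (b i)).mdifferentiableAt (by simp)
  have hexp : ∀ ψ : M → E, MDifferentiableAt 𝓘(ℝ, E) 𝓘(ℝ, E) ψ x →
      D (fun y => e.symmL ℝ y (ψ y)) x a =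
        ∑ i, (b.coord i (ψ x) • D (fun y => e.symmL ℝ y (b i)) x a +
          b.coord i (mvfderiv 𝓘(ℝ, E) ψ x a) • e.symmL ℝ x (b i)) := by
    intro ψ hψ
    have h1 : (fun y => e.symmL ℝ y (ψ y)) =
        fun y => ∑ i, b.coord i (ψ y) • e.symmL ℝ y (b i) := by
      funext y
      conv_lhs => rw [← b.sum_repr (ψ y), map_sum]
      simp
    have h2 : ∀ i, HasMFDerivAt 𝓘(ℝ, E) 𝓘(ℝ, ℝ) (fun y => b.coord i (ψ y)) x
        ((b.coord i).toContinuousLinearMap ∘L (mfderiv 𝓘(ℝ, E) 𝓘(ℝ, E) ψ x)) := fun i =>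
      HasMFDerivAt.comp x ((b.coord i).toContinuousLinearMap.hasMFDerivAt) hψ.hasMFDerivAt
    rw [h1, cov_sum D (fun i => (h2 i).mdifferentiableAt) hb]
    refine Finset.sum_congr rfl fun i _ => ?_
    congr 2
    change mfderiv 𝓘(ℝ, E) 𝓘(ℝ, ℝ) (fun y => b.coord i (ψ y)) x a = _
    rw [(h2 i).mfderiv]
    rfl
  change D (fun y => e.symmL ℝ y (φ y)) x a = e.symmL ℝ x (mvfderiv 𝓘(ℝ, E) φ x a) +
    D (fun y => e.symmL ℝ y (φ x)) x a
  rw [hexp φ hφ, hexp (fun _ => φ x) mdifferentiableAt_const, ← Finset.sum_add_distrib.symm]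
  simp only [mvfderiv_const, Finset.sum_add_distrib]
  simp only [_root_.zero_apply, map_zero, zero_smul, Finset.sum_const_zero, add_zero]
  rw [add_comm]
  congr 1
  conv_rhs => rw [← b.sum_repr (mvfderiv 𝓘(ℝ, E) φ x a), map_sum]
  simp

/-- The covariant derivative along a curve of a combination `∑ cᵢ Xᵢ` of smooth vector fields. -/
lemma covDerivAlong_sum (D : Connection E M) {X : ι → VField E M} (hX : ∀ i, IsSmoothField (X i))
    {β : ℝ → M} {w : (r : ℝ) → TangentSpace 𝓘(ℝ, E) (β r)} {c : ι → ℝ → ℝ} {c' : ι → ℝ} {s : ℝ}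
    (hs : s ∈ Icc (0 : ℝ) 1)
    (hβ : MDifferentiableWithinAt 𝓘(ℝ, ℝ) 𝓘(ℝ, E) β (Icc 0 1) s)
    (hw : ∀ r ∈ Icc (0 : ℝ) 1, w r = ∑ i, c i r • X i (β r))
    (hc : ∀ i, HasDerivWithinAt (c i) (c' i) (Icc 0 1) s) :
    covDerivAlong D (fun r => (⟨β r, w r⟩ : TangentBundle 𝓘(ℝ, E) M)) s =
      ∑ i, (c' i • X i (β s) + c i s • D (X i) (β s) (velocity (E := E) β s)) := by
  set x := β s with hx
  let e := trivializationAt E (TangentSpace 𝓘(ℝ, E) : M → Type _) x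
  have hxe : x ∈ e.baseSet := FiberBundle.mem_baseSet_trivializationAt' x
  let φ : ι → M → E := fun i y => (e ⟨y, X i y⟩).2
  have hφ : ∀ i, MDifferentiableAt 𝓘(ℝ, E) 𝓘(ℝ, E) (φ i) x := fun i =>
    ((contMDiffAt_section (IB := 𝓘(ℝ, E)) (n := ∞) (F := E) (E := TangentSpace 𝓘(ℝ, E)) x).1
      (hX i x)).mdifferentiableAt (by simp)
  have hX' : ∀ i, ∀ y ∈ e.baseSet, e.symmL ℝ y (φ i y) = X i y := fun i y hy => by
    have := e.symmL_continuousLinearMapAt (R := ℝ) hy (X i y)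
    rwa [Trivialization.continuousLinearMapAt_apply, e.coe_linearMapAt_of_mem hy] at this
  have hcoord : ∀ r ∈ Icc (0 : ℝ) 1, β r ∈ e.baseSet →
      (e ⟨β r, w r⟩).2 = ∑ i, c i r • φ i (β r) := by
    intro r hr hre
    rw [hw r hr]
    have h1 : ∀ a, (e ⟨β r, a⟩).2 = e.continuousLinearMapAt ℝ (β r) a := fun a => by
      rw [Trivialization.continuousLinearMapAt_apply, e.coe_linearMapAt_of_mem hre]
    rw [h1, map_sum]
    refine Finset.sum_congr rfl fun i _ => ?_
    rw [map_smul, ← h1]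
  have hder : HasDerivWithinAt (fun r => (e ⟨β r, w r⟩).2)
      (∑ i, (c i s • mvfderiv 𝓘(ℝ, E) (φ i) x (velocity (E := E) β s) + c' i • φ i x))
      (Icc 0 1) s := by
    have h1 : HasDerivWithinAt (fun r => ∑ i, c i r • φ i (β r))
        (∑ i, (c i s • mvfderiv 𝓘(ℝ, E) (φ i) x (velocity (E := E) β s) + c' i • φ i x))
        (Icc 0 1) s := by
      refine HasDerivWithinAt.fun_sum fun i _ => ?_
      exact (hc i).smul (hasDerivWithinAt_comp_curve (hφ i) hβ)
    have hn : ∀ᶠ r in 𝓝[Icc 0 1] s, β r ∈ e.baseSet :=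
      hβ.continuousWithinAt.eventually (e.open_baseSet.mem_nhds hxe)
    refine h1.congr_of_eventuallyEq ?_ (hcoord s hs hxe)
    filter_upwards [hn, self_mem_nhdsWithin] with r hr hrs
    exact hcoord r hrs hr
  change e.symm x (derivWithin (fun r => (e ⟨β r, w r⟩).2) (Icc 0 1) s) +
    D (fun y => e.symm y (e ⟨β s, w s⟩).2) x (velocity (E := E) β s) = _
  rw [hder.derivWithin (uniqueDiffOn_Icc one_pos s hs), hcoord s hs hxe,
    ← e.symmL_apply (R := ℝ) hxe]
  have hD : D (fun y => e.symm y (∑ i, c i s • φ i (β s))) x (velocity (E := E) β s) =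
      ∑ i, c i s • D (fun y => e.symmL ℝ y (φ i x)) x (velocity (E := E) β s) := by
    have h0 : ∀ i, MDiffAt (T% (fun y => e.symmL ℝ y (φ i x))) x := fun i =>
      (contMDiffAt_symmL x (φ i x)).mdifferentiableAt (by simp)
    have h1 := cov_sum D (f := fun i _ => c i s) (fun i => mdifferentiableAt_const) h0
      (velocity (E := E) β s)
    have hmd : MDiffAt (T% (fun y => ∑ i, c i s • e.symmL ℝ y (φ i x))) x :=
      MDifferentiableAt.sum_section fun i _ => mdifferentiableAt_const.smul_section (h0 i)
    have hev : ∀ᶠ y in 𝓝 x, ∑ i, c i s • e.symmL ℝ y (φ i x) =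
        e.symm y (∑ i, c i s • φ i (β s)) := by
      filter_upwards [e.open_baseSet.mem_nhds hxe] with y hy
      rw [← e.symmL_apply (R := ℝ) hy, map_sum]
      simp [hx]
    rw [← cov_congr D hmd hev, h1]
    refine Finset.sum_congr rfl fun i _ => ?_
    rw [mvfderiv_const]
    simp
  rw [hD, map_sum, ← Finset.sum_add_distrib]
  refine Finset.sum_congr rfl fun i _ => ?_
  have h3 : D (X i) x (velocity (E := E) β s) =
      e.symmL ℝ x (mvfderiv 𝓘(ℝ, E) (φ i) x (velocity (E := E) β s)) +
        D (fun y => e.symmL ℝ y (φ i x)) x (velocity (E := E) β s) := by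
    rw [← cov_symmL D (hφ i)]
    refine congrArg (fun l => l (velocity (E := E) β s))
      (cov_congr D ((hX i).mdifferentiableAt x) ?_)
    filter_upwards [e.open_baseSet.mem_nhds hxe] with y hy
    exact (hX' i y hy).symm
  rw [h3, map_add, map_smul, map_smul, hX' i x hxe]
  module

variable [RiemannianBundle (fun x : M => TangentSpace 𝓘(ℝ, E) x)]
  [IsContMDiffRiemannianBundle 𝓘(ℝ, E) ∞ E (fun x : M => TangentSpace 𝓘(ℝ, E) x)]

/-- Compatibility of `D` with the metric, for combinations of smooth fields along a curve. -/
lemma hasDerivWithinAt_inner_sum {D : Connection E M}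
    (hD : CovariantDerivative.IsMetricCompatible (V := (TangentSpace 𝓘(ℝ, E) : M → Type _)) D)
    {ι' : Type*} [Fintype ι'] {X : ι → VField E M} {Z : ι' → VField E M}
    (hX : ∀ i, IsSmoothField (X i)) (hZ : ∀ i, IsSmoothField (Z i))
    {β : ℝ → M} {c : ι → ℝ → ℝ} {c' : ι → ℝ} {d : ι' → ℝ → ℝ} {d' : ι' → ℝ} {I : Set ℝ} {s : ℝ}
    (hβ : MDifferentiableWithinAt 𝓘(ℝ, ℝ) 𝓘(ℝ, E) β I s)
    (hc : ∀ i, HasDerivWithinAt (c i) (c' i) I s) (hd : ∀ i, HasDerivWithinAt (d i) (d' i) I s) :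
    HasDerivWithinAt (fun r => inner ℝ (∑ i, c i r • X i (β r)) (∑ j, d j r • Z j (β r)))
      (inner ℝ (∑ i, (c' i • X i (β s) +
          c i s • D (X i) (β s) (mfderivWithin 𝓘(ℝ, ℝ) 𝓘(ℝ, E) β I s (1 : ℝ))))
          (∑ j, d j s • Z j (β s)) +
        inner ℝ (∑ i, c i s • X i (β s)) (∑ j, (d' j • Z j (β s) +
          d j s • D (Z j) (β s) (mfderivWithin 𝓘(ℝ, ℝ) 𝓘(ℝ, E) β I s (1 : ℝ))))) I s := by
  have hg : ∀ i j, HasDerivWithinAt (fun r => inner ℝ (X i (β r)) (Z j (β r)))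
      (inner ℝ (D (X i) (β s) (mfderivWithin 𝓘(ℝ, ℝ) 𝓘(ℝ, E) β I s (1 : ℝ))) (Z j (β s)) +
        inner ℝ (X i (β s)) (D (Z j) (β s) (mfderivWithin 𝓘(ℝ, ℝ) 𝓘(ℝ, E) β I s (1 : ℝ)))) I s := by
    intro i j
    have h1 : MDifferentiableAt 𝓘(ℝ, E) 𝓘(ℝ, ℝ) (fun y => inner ℝ (X i y) (Z j y)) (β s) :=
      MDifferentiableAt.inner_bundle (E := fun x : M => TangentSpace 𝓘(ℝ, E) x)
        ((hX i).mdifferentiableAt _) ((hZ j).mdifferentiableAt _)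
    have h2 := hasDerivWithinAt_comp_curve h1 hβ
    have h3 := hD.mvfderiv_inner_eq
      (ext (mfderivWithin 𝓘(ℝ, ℝ) 𝓘(ℝ, E) β I s (1 : ℝ) : TangentSpace 𝓘(ℝ, E) (β s)))
      ((hX i).mdifferentiableAt (β s)) ((hZ j).mdifferentiableAt (β s))
    simp only [FiberBundle.extend_apply_self] at h3
    rwa [h3] at h2
  have h := HasDerivWithinAt.fun_sum (u := Finset.univ) (fun i _ =>
    HasDerivWithinAt.fun_sum (u := Finset.univ) (fun j _ => ((hc i).mul (hd j)).mul (hg i j)))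
  have hexp : ∀ r, inner ℝ (∑ i, c i r • X i (β r)) (∑ j, d j r • Z j (β r)) =
      ∑ i, ∑ j, (c i * d j) r * inner ℝ (X i (β r)) (Z j (β r)) := fun r => by
    rw [sum_inner]
    refine Finset.sum_congr rfl fun i _ => ?_
    rw [inner_sum]
    refine Finset.sum_congr rfl fun j _ => ?_
    rw [real_inner_smul_left, real_inner_smul_right, Pi.mul_apply]
    ring
  refine (h.congr_deriv ?_).congr (fun r _ => hexp r) (hexp s)
  rw [sum_inner, sum_inner, ← Finset.sum_add_distrib]
  refine Finset.sum_congr rfl fun i _ => ?_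
  rw [inner_sum, inner_sum, ← Finset.sum_add_distrib]
  refine Finset.sum_congr rfl fun j _ => ?_
  simp only [inner_add_left, inner_add_right, real_inner_smul_left, real_inner_smul_right,
    Pi.mul_apply]
  ring

end Combinations

/-! ### The exterior derivative of a one-form, and second derivatives of functions -/

section ExtDeriv

variable {E : Type*} [NormedAddCommGroup E] [NormedSpace ℝ E] [FiniteDimensional ℝ E]
  {M : Type*} [TopologicalSpace M] [ChartedSpace E M] [IsManifold 𝓘(ℝ, E) ∞ M]

/-- The coordinates, in the trivialization of `TM` centred at `x`, of tangent vectors at `y`. -/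
noncomputable def coord (x y : M) : TangentSpace 𝓘(ℝ, E) y →L[ℝ] E :=
  (trivializationAt E (TangentSpace 𝓘(ℝ, E) : M → Type _) x).continuousLinearMapAt ℝ y

lemma coord_eq {x y : M} (hy : y ∈ (chartAt E x).source) (a : TangentSpace 𝓘(ℝ, E) y) :
    coord x y a = mfderiv 𝓘(ℝ, E) 𝓘(ℝ, E) (extChartAt 𝓘(ℝ, E) x) y a :=
  congrArg (fun l : TangentSpace 𝓘(ℝ, E) y →L[ℝ] E => l a)
    (TangentBundle.continuousLinearMapAt_trivializationAt hy)

lemma contMDiffAt_ext {x : M} (a : TangentSpace 𝓘(ℝ, E) x) :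
    ContMDiffAt 𝓘(ℝ, E) 𝓘(ℝ, E).tangent ∞
      (fun y => (⟨y, ext a y⟩ : TangentBundle 𝓘(ℝ, E) M)) x :=
  FiberBundle.contMDiffAt_extend (k := ∞) 𝓘(ℝ, E) E a

lemma mdifferentiableAt_ext {x : M} (a : TangentSpace 𝓘(ℝ, E) x) : MDiffAt (T% (ext a)) x :=
  (contMDiffAt_ext a).mdifferentiableAt (by simp)

/-- The extension of a tangent vector has constant coordinates in the chart. -/
lemma ext_eq_symmL {x y : M} (a : TangentSpace 𝓘(ℝ, E) x)
    (hy : y ∈ (chartAt E x).source) :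
    ext a y = (trivializationAt E (TangentSpace 𝓘(ℝ, E) : M → Type _) x).symmL ℝ y
      (coord x x a) := by
  let e := trivializationAt E (TangentSpace 𝓘(ℝ, E) : M → Type _) x
  have hx : x ∈ e.baseSet := FiberBundle.mem_baseSet_trivializationAt' x
  have hy' : y ∈ e.baseSet := by simpa [e] using hy
  change ext a y = e.symmL ℝ y (e.continuousLinearMapAt ℝ x a)
  rw [Trivialization.continuousLinearMapAt_apply, e.coe_linearMapAt_of_mem hx, e.symmL_apply hy']
  rfl

lemma mlieBracket_ext {x : M} (a b : TangentSpace 𝓘(ℝ, E) x) :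
    VectorField.mlieBracket 𝓘(ℝ, E) (ext a) (ext b) x = 0 := by
  have key : ∀ a : TangentSpace 𝓘(ℝ, E) x, ∀ᶠ z in 𝓝 (extChartAt 𝓘(ℝ, E) x x),
      VectorField.mpullbackWithin 𝓘(ℝ, E) 𝓘(ℝ, E) (extChartAt 𝓘(ℝ, E) x).symm (ext a)
        (range 𝓘(ℝ, E)) z = coord x x a := by
    intro a
    filter_upwards [extChartAt_target_mem_nhds (I := 𝓘(ℝ, E)) x] with z hz
    have hs : (extChartAt 𝓘(ℝ, E) x).symm z ∈ (chartAt E x).source := by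
      simpa using (extChartAt 𝓘(ℝ, E) x).map_target hz
    rw [VectorField.mpullbackWithin_apply, ext_eq_symmL a hs,
      TangentBundle.symmL_trivializationAt hs, (extChartAt 𝓘(ℝ, E) x).right_inv hz]
    exact (isInvertible_mfderivWithin_extChartAt_symm hz).inverse_apply_self _
  have h0 : ∀ a : TangentSpace 𝓘(ℝ, E) x, fderiv ℝ
      (VectorField.mpullbackWithin 𝓘(ℝ, E) 𝓘(ℝ, E) (extChartAt 𝓘(ℝ, E) x).symm (ext a)
        (range 𝓘(ℝ, E)) : E → E) (extChartAt 𝓘(ℝ, E) x x) = 0 := fun a => by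
    have : (VectorField.mpullbackWithin 𝓘(ℝ, E) 𝓘(ℝ, E) (extChartAt 𝓘(ℝ, E) x).symm (ext a)
        (range 𝓘(ℝ, E)) : E → E) =ᶠ[𝓝 (extChartAt 𝓘(ℝ, E) x x)]
        fun _ => coord x x a := key a
    rw [this.fderiv_eq, fderiv_fun_const]
    rfl
  rw [← VectorField.mlieBracketWithin_univ, VectorField.mlieBracketWithin_apply]
  simp only [preimage_univ, univ_inter]
  rw [modelWithCornersSelf_coe, range_id] at h0 ⊢
  have hbr : ∀ {V W : E → E} {z : E}, fderiv ℝ V z = 0 → fderiv ℝ W z = 0 →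
      VectorField.lieBracketWithin ℝ V W univ z = 0 := fun hV hW => by
    rw [VectorField.lieBracketWithin_univ, VectorField.lieBracket_eq]
    simp [hV, hW]
  exact (congrArg _ (hbr (h0 a) (h0 b))).trans (map_zero _)

/-- The coefficients in the trivialization centred at `x₀` of a one-form. -/
noncomputable def formCoeff (θ : (x : M) → TangentSpace 𝓘(ℝ, E) x →L[ℝ] ℝ) (x₀ y : M) : E →L[ℝ] ℝ :=
  θ y ∘L (trivializationAt E (TangentSpace 𝓘(ℝ, E) : M → Type _) x₀).symmL ℝ y

lemma IsSmoothForm.contMDiffAt_formCoeff {θ : (x : M) → TangentSpace 𝓘(ℝ, E) x →L[ℝ] ℝ}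
    (hθ : IsSmoothForm θ) (x : M) :
    ContMDiffAt 𝓘(ℝ, E) 𝓘(ℝ, E →L[ℝ] ℝ) ∞ (formCoeff θ x) x :=
  contMDiffAt_clm_of_apply fun v => hθ.apply_field (contMDiffAt_symmL x v)

/-- The exterior derivative `dθ(a, b)`. The bracket term `θ([ext a, ext b])` is absent, since these
extensions of `a` and `b` commute at `x`. -/
noncomputable def extDeriv (θ : (x : M) → TangentSpace 𝓘(ℝ, E) x →L[ℝ] ℝ) (x : M)
    (a b : TangentSpace 𝓘(ℝ, E) x) : ℝ :=
  mvfderiv 𝓘(ℝ, E) (fun y => θ y (ext b y)) x a - mvfderiv 𝓘(ℝ, E) (fun y => θ y (ext a y)) x b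

lemma mvfderiv_apply_const {G : Type*} [NormedAddCommGroup G] [NormedSpace ℝ G]
    {f : M → G →L[ℝ] ℝ} {x : M} (hf : MDifferentiableAt 𝓘(ℝ, E) 𝓘(ℝ, G →L[ℝ] ℝ) f x)
    (w : G) (a : TangentSpace 𝓘(ℝ, E) x) :
    mvfderiv 𝓘(ℝ, E) (fun y => f y w) x a = mvfderiv 𝓘(ℝ, E) f x a w := by
  have h := HasMFDerivAt.comp x
    ((ContinuousLinearMap.apply ℝ ℝ w : (G →L[ℝ] ℝ) →L[ℝ] ℝ).hasMFDerivAt) hf.hasMFDerivAt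
  change mfderiv 𝓘(ℝ, E) 𝓘(ℝ, ℝ) ((ContinuousLinearMap.apply ℝ ℝ w : (G →L[ℝ] ℝ) →L[ℝ] ℝ) ∘ f) x a
    = _
  rw [h.mfderiv]
  rfl

lemma mvfderiv_congr {G : Type*} [NormedAddCommGroup G] [NormedSpace ℝ G]
    {f g : M → G} {x : M} (h : f =ᶠ[𝓝 x] g) :
    mvfderiv 𝓘(ℝ, E) f x = mvfderiv 𝓘(ℝ, E) g x := by
  ext a
  change mfderiv 𝓘(ℝ, E) 𝓘(ℝ, G) f x a = mfderiv 𝓘(ℝ, E) 𝓘(ℝ, G) g x a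
  rw [h.mfderiv_eq]
  rfl

lemma IsSmoothForm.mvfderiv_apply_ext {θ : (x : M) → TangentSpace 𝓘(ℝ, E) x →L[ℝ] ℝ}
    (hθ : IsSmoothForm θ) {x : M} (a b : TangentSpace 𝓘(ℝ, E) x) :
    mvfderiv 𝓘(ℝ, E) (fun y => θ y (ext b y)) x a = mvfderiv 𝓘(ℝ, E) (formCoeff θ x) x a
      (coord x x b) := by
  rw [← mvfderiv_apply_const ((hθ.contMDiffAt_formCoeff x).mdifferentiableAt (by simp))]
  refine congrArg (fun l : TangentSpace 𝓘(ℝ, E) x →L[ℝ] ℝ => l a) (mvfderiv_congr ?_)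
  filter_upwards [(chartAt E x).open_source.mem_nhds (mem_chart_source E x)] with y hy
  rw [ext_eq_symmL b hy]
  rfl

/-- For a two-parameter family `Γ` of points, `∂_v (θ(∂_w Γ)) - ∂_w (θ(∂_v Γ)) = dθ(∂_v Γ, ∂_w Γ)`:
in the chart, the second derivatives of `Γ` cancel. -/
theorem IsSmoothForm.fderiv_pullback_sub {θ : (x : M) → TangentSpace 𝓘(ℝ, E) x →L[ℝ] ℝ}
    (hθ : IsSmoothForm θ) {G : Type*} [NormedAddCommGroup G] [NormedSpace ℝ G]
    {Γ : G → M} {p : G} (hΓ : ContMDiffAt 𝓘(ℝ, G) 𝓘(ℝ, E) ∞ Γ p)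
    (v w : G) :
    fderiv ℝ (fun q => θ (Γ q) (mfderiv 𝓘(ℝ, G) 𝓘(ℝ, E) Γ q w)) p v -
      fderiv ℝ (fun q => θ (Γ q) (mfderiv 𝓘(ℝ, G) 𝓘(ℝ, E) Γ q v)) p w =
    extDeriv θ (Γ p) (mfderiv 𝓘(ℝ, G) 𝓘(ℝ, E) Γ p v) (mfderiv 𝓘(ℝ, G) 𝓘(ℝ, E) Γ p w) := by
  set x := Γ p with hx
  set φ := extChartAt 𝓘(ℝ, E) x with hφ
  let e := trivializationAt E (TangentSpace 𝓘(ℝ, E) : M → Type _) x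
  let κ : G → E := fun q => φ (Γ q)
  let g : G → E →L[ℝ] ℝ := fun q => formCoeff θ x (Γ q)
  have hev : ∀ᶠ q in 𝓝 p, ContMDiffAt 𝓘(ℝ, G) 𝓘(ℝ, E) 1 Γ q ∧ Γ q ∈ (chartAt E x).source := by
    refine ((contMDiffAt_iff_contMDiffAt_nhds (by simp)).1 (hΓ.of_le (m := 1) (by simp))).and ?_
    exact hΓ.continuousAt.eventually
      ((chartAt E x).open_source.mem_nhds (mem_chart_source E x))
  have hκ : ContDiffAt ℝ ∞ κ p := by
    have h1 : ContMDiffAt 𝓘(ℝ, E) 𝓘(ℝ, E) ∞ φ (Γ p) := contMDiffAt_extChartAt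
    exact (h1.comp p hΓ).contDiffAt
  have hg : ContDiffAt ℝ ∞ g p :=
    ((hθ.contMDiffAt_formCoeff x).comp p hΓ).contDiffAt
  -- in the chart, the pull-back of `θ` is `g(q) ∘ κ'(q)`
  have hkap : ∀ q, ContMDiffAt 𝓘(ℝ, G) 𝓘(ℝ, E) 1 Γ q → Γ q ∈ (chartAt E x).source → ∀ v : G,
      fderiv ℝ κ q v = coord x (Γ q) (mfderiv 𝓘(ℝ, G) 𝓘(ℝ, E) Γ q v) := by
    intro q hq hqs v
    have h1 : MDifferentiableAt 𝓘(ℝ, E) 𝓘(ℝ, E) φ (Γ q) := mdifferentiableAt_extChartAt hqs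
    have h2 := mfderiv_comp q h1 (hq.mdifferentiableAt (by simp))
    have h3 : mfderiv 𝓘(ℝ, G) 𝓘(ℝ, E) κ q = fderiv ℝ κ q := mfderiv_eq_fderiv
    rw [← h3, coord_eq hqs]
    exact congrArg (fun l : G →L[ℝ] E => l v) h2
  have hpull : ∀ v : G, (fun q => θ (Γ q) (mfderiv 𝓘(ℝ, G) 𝓘(ℝ, E) Γ q v)) =ᶠ[𝓝 p]
      fun q => g q (fderiv ℝ κ q v) := by
    intro v
    filter_upwards [hev] with q hq
    have hb : Γ q ∈ e.baseSet := by simpa [e] using hq.2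
    rw [hkap q hq.1 hq.2]
    change _ = θ (Γ q) (e.symmL ℝ (Γ q) (e.continuousLinearMapAt ℝ (Γ q) _))
    rw [e.symmL_continuousLinearMapAt hb]
  have hfk : DifferentiableAt ℝ (fderiv ℝ κ) p :=
    (hκ.fderiv_right (m := 1) (by norm_cast)).differentiableAt (by simp)
  have hder : ∀ v w : G, fderiv ℝ (fun q => g q (fderiv ℝ κ q v)) p w =
      fderiv ℝ g p w (fderiv ℝ κ p v) + g p (fderiv ℝ (fderiv ℝ κ) p w v) := by
    intro v w
    have h1 : HasFDerivAt (fun q => fderiv ℝ κ q v) ((fderiv ℝ (fderiv ℝ κ) p).flip v) p := by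
      simpa using hfk.hasFDerivAt.clm_apply (hasFDerivAt_const v p)
    have h2 := (hg.differentiableAt (by simp)).hasFDerivAt.clm_apply h1
    rw [h2.fderiv]
    simp [add_comm]
  have hgd : ∀ v : G, fderiv ℝ g p v =
      mvfderiv 𝓘(ℝ, E) (formCoeff θ x) x (mfderiv 𝓘(ℝ, G) 𝓘(ℝ, E) Γ p v) := by
    intro v
    have h2 := mfderiv_comp p ((hθ.contMDiffAt_formCoeff x).mdifferentiableAt (by simp))
      (hΓ.mdifferentiableAt (by simp))
    have h3 : mfderiv 𝓘(ℝ, G) 𝓘(ℝ, E →L[ℝ] ℝ) g p = fderiv ℝ g p := mfderiv_eq_fderiv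
    rw [← h3]
    exact congrArg (fun l : G →L[ℝ] (E →L[ℝ] ℝ) => l v) h2
  have hsymm := (hκ.isSymmSndFDerivAt (by simp; norm_cast)).eq v w
  rw [(hpull w).fderiv_eq, (hpull v).fderiv_eq, hder, hder, extDeriv, hθ.mvfderiv_apply_ext,
    hθ.mvfderiv_apply_ext, hgd, hgd, hkap p hev.self_of_nhds.1 hev.self_of_nhds.2,
    hkap p hev.self_of_nhds.1 hev.self_of_nhds.2, hsymm]
  ring

lemma contDiffAt_comp_extChartAt_symm {f : M → ℝ} {x : M}
    (hf : ContMDiffAt 𝓘(ℝ, E) 𝓘(ℝ, ℝ) ∞ f x) :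
    ContDiffAt ℝ ∞ (fun z => f ((extChartAt 𝓘(ℝ, E) x).symm z)) (extChartAt 𝓘(ℝ, E) x x) := by
  have h1 : ContMDiffAt 𝓘(ℝ, E) 𝓘(ℝ, E) ∞ (extChartAt 𝓘(ℝ, E) x).symm
      (extChartAt 𝓘(ℝ, E) x x) :=
    (contMDiffOn_extChartAt_symm x).contMDiffAt (extChartAt_target_mem_nhds x)
  exact (ContMDiffAt.comp _ (by rwa [extChartAt_to_inv x]) h1).contDiffAt

lemma mvfderiv_ext_eventuallyEq {f : M → ℝ} {x : M}
    (hf : ContMDiffAt 𝓘(ℝ, E) 𝓘(ℝ, ℝ) ∞ f x) (b : TangentSpace 𝓘(ℝ, E) x) :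
    (fun y => mvfderiv 𝓘(ℝ, E) f y (ext b y)) =ᶠ[𝓝 x]
      fun y => fderiv ℝ (fun z => f ((extChartAt 𝓘(ℝ, E) x).symm z)) (extChartAt 𝓘(ℝ, E) x y)
        (coord x x b) := by
  set φ := extChartAt 𝓘(ℝ, E) x with hφ
  filter_upwards [(chartAt E x).open_source.mem_nhds (mem_chart_source E x),
    (contMDiffAt_iff_contMDiffAt_nhds (by simp)).1 (hf.of_le (m := 1) (by simp))] with y hy hfy
  have hy' : y ∈ φ.source := by simpa [hφ] using hy
  have hyy : φ.symm (φ y) = y := φ.left_inv hy'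
  have h1 : MDifferentiableAt 𝓘(ℝ, E) 𝓘(ℝ, E) φ.symm (φ y) :=
    ((contMDiffOn_extChartAt_symm x).contMDiffAt
      ((isOpen_extChartAt_target x).mem_nhds (φ.map_source hy'))).mdifferentiableAt (n := ∞)
        (by simp)
  have h2 := mfderiv_comp_of_eq (hfy.mdifferentiableAt (by simp)) h1 hyy
  have h3 : mfderiv 𝓘(ℝ, E) 𝓘(ℝ, ℝ) (fun z => f (φ.symm z)) (φ y) =
      fderiv ℝ (fun z => f (φ.symm z)) (φ y) := mfderiv_eq_fderiv
  have h5 : (mfderiv 𝓘(ℝ, E) 𝓘(ℝ, ℝ) f (φ.symm (φ y)) : E →L[ℝ] ℝ) =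
      mfderiv 𝓘(ℝ, E) 𝓘(ℝ, ℝ) f y := by rw [hyy]
  rw [ext_eq_symmL b hy, TangentBundle.symmL_trivializationAt hy, ← h3, modelWithCornersSelf_coe,
    range_id, mfderivWithin_univ]
  refine Eq.trans ?_ (congrArg (fun l : E →L[ℝ] ℝ => l (coord x x b)) h2).symm
  exact congrArg (fun l : E →L[ℝ] ℝ => l _) h5.symm

lemma mdifferentiableAt_fderiv_extChartAt {f : M → ℝ} {x : M}
    (hf : ContMDiffAt 𝓘(ℝ, E) 𝓘(ℝ, ℝ) ∞ f x) :
    MDifferentiableAt 𝓘(ℝ, E) 𝓘(ℝ, E →L[ℝ] ℝ)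
      (fderiv ℝ (fun z => f ((extChartAt 𝓘(ℝ, E) x).symm z))) (extChartAt 𝓘(ℝ, E) x x) :=
  (((contDiffAt_comp_extChartAt_symm hf).fderiv_right (m := 1)
    (by norm_cast)).differentiableAt (by simp)).mdifferentiableAt

lemma mdifferentiableAt_mvfderiv_ext {f : M → ℝ} {x : M}
    (hf : ContMDiffAt 𝓘(ℝ, E) 𝓘(ℝ, ℝ) ∞ f x) (b : TangentSpace 𝓘(ℝ, E) x) :
    MDifferentiableAt 𝓘(ℝ, E) 𝓘(ℝ, ℝ) (fun y => mvfderiv 𝓘(ℝ, E) f y (ext b y)) x := by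
  refine MDifferentiableAt.congr_of_eventuallyEq ?_ (mvfderiv_ext_eventuallyEq hf b)
  exact ((mdifferentiableAt_fderiv_extChartAt hf).comp x
    (mdifferentiableAt_extChartAt (mem_chart_source E x))).clm_apply mdifferentiableAt_const

/-- Second derivatives in the directions of two commuting vector fields are symmetric. -/
lemma mvfderiv_mvfderiv_ext_comm {f : M → ℝ} {x : M}
    (hf : ContMDiffAt 𝓘(ℝ, E) 𝓘(ℝ, ℝ) ∞ f x) (a b : TangentSpace 𝓘(ℝ, E) x) :
    mvfderiv 𝓘(ℝ, E) (fun y => mvfderiv 𝓘(ℝ, E) f y (ext b y)) x a =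
      mvfderiv 𝓘(ℝ, E) (fun y => mvfderiv 𝓘(ℝ, E) f y (ext a y)) x b := by
  set φ := extChartAt 𝓘(ℝ, E) x with hφ
  set κ : E → ℝ := fun z => f (φ.symm z) with hκ_def
  have hκ : ContDiffAt ℝ ∞ κ (φ x) := contDiffAt_comp_extChartAt_symm hf
  have hfin : ∀ a b : TangentSpace 𝓘(ℝ, E) x,
      mvfderiv 𝓘(ℝ, E) (fun y => mvfderiv 𝓘(ℝ, E) f y (ext b y)) x a =
      fderiv ℝ (fderiv ℝ κ) (φ x) (coord x x a) (coord x x b) := by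
    intro a b
    have h1 : MDifferentiableAt 𝓘(ℝ, E) 𝓘(ℝ, E) φ x :=
      mdifferentiableAt_extChartAt (mem_chart_source E x)
    have h4 : MDifferentiableAt 𝓘(ℝ, E) 𝓘(ℝ, E →L[ℝ] ℝ) (fderiv ℝ κ) (φ x) :=
      mdifferentiableAt_fderiv_extChartAt hf
    rw [mvfderiv_congr (mvfderiv_ext_eventuallyEq hf b),
      mvfderiv_apply_const (f := fun y => fderiv ℝ κ (φ y)) (h4.comp x h1)]
    have h2 := mfderiv_comp x h4 h1
    refine congrArg (fun l : E →L[ℝ] ℝ => l (coord x x b)) ?_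
    refine (congrArg (fun l : TangentSpace 𝓘(ℝ, E) x →L[ℝ] (E →L[ℝ] ℝ) => l a) h2).trans ?_
    rw [mfderiv_eq_fderiv, coord_eq (mem_chart_source E x)]
    rfl
  rw [hfin, hfin]
  exact (hκ.isSymmSndFDerivAt (by simp; norm_cast)).eq _ _

end ExtDeriv

/-! ### Curvature and torsion in terms of a spanning family -/

section Curvature

variable {E : Type*} [NormedAddCommGroup E] [NormedSpace ℝ E] [FiniteDimensional ℝ E]
  {M : Type*} [TopologicalSpace M] [ChartedSpace E M] [IsManifold 𝓘(ℝ, E) ∞ M]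
  {ι : Type*} [Fintype ι]

lemma mvfderiv_add_sum_mul {u : M → ℝ} {f h : ι → M → ℝ} {x : M}
    (hu : MDifferentiableAt 𝓘(ℝ, E) 𝓘(ℝ, ℝ) u x)
    (hf : ∀ i, MDifferentiableAt 𝓘(ℝ, E) 𝓘(ℝ, ℝ) (f i) x)
    (hh : ∀ i, MDifferentiableAt 𝓘(ℝ, E) 𝓘(ℝ, ℝ) (h i) x) (a : TangentSpace 𝓘(ℝ, E) x) :
    MDifferentiableAt 𝓘(ℝ, E) 𝓘(ℝ, ℝ) (fun y => u y + ∑ i, f i y * h i y) x ∧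
    mvfderiv 𝓘(ℝ, E) (fun y => u y + ∑ i, f i y * h i y) x a =
      mvfderiv 𝓘(ℝ, E) u x a +
        ∑ i, (mvfderiv 𝓘(ℝ, E) (f i) x a * h i x + f i x * mvfderiv 𝓘(ℝ, E) (h i) x a) := by
  have h0 : ∀ i, HasMFDerivAt 𝓘(ℝ, E) 𝓘(ℝ, ℝ) (f i * h i) x
      (f i x • mvfderiv 𝓘(ℝ, E) (h i) x + h i x • mvfderiv 𝓘(ℝ, E) (f i) x :
        TangentSpace 𝓘(ℝ, E) x →L[ℝ] ℝ) := fun i => (hf i).hasMFDerivAt.mul (hh i).hasMFDerivAt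
  have hsum : ∀ t : Finset ι, HasMFDerivAt 𝓘(ℝ, E) 𝓘(ℝ, ℝ) (∑ i ∈ t, f i * h i) x
      (∑ i ∈ t, (f i x • mvfderiv 𝓘(ℝ, E) (h i) x + h i x • mvfderiv 𝓘(ℝ, E) (f i) x) :
        TangentSpace 𝓘(ℝ, E) x →L[ℝ] ℝ) := by
    classical
    intro t
    induction t using Finset.induction_on with
    | empty =>
      simp only [Finset.sum_empty]
      exact hasMFDerivAt_const (0 : ℝ) x
    | insert j t hj ih =>
      rw [Finset.sum_insert hj, Finset.sum_insert hj]
      exact (h0 j).add ih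
  have h1 := hu.hasMFDerivAt.add (hsum Finset.univ)
  have h2 : (u + ∑ i, f i * h i) = fun y => u y + ∑ i, f i y * h i y := by
    funext y
    simp
  rw [h2] at h1
  refine ⟨h1.mdifferentiableAt, ?_⟩
  change mfderiv 𝓘(ℝ, E) 𝓘(ℝ, ℝ) (fun y => u y + ∑ i, f i y * h i y) x a = _
  rw [h1.mfderiv]
  change mvfderiv 𝓘(ℝ, E) u x a + (∑ i, (f i x • mvfderiv 𝓘(ℝ, E) (h i) x +
    h i x • mvfderiv 𝓘(ℝ, E) (f i) x) : TangentSpace 𝓘(ℝ, E) x →L[ℝ] ℝ) a = _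
  rw [_root_.sum_apply]
  congr 1
  refine Finset.sum_congr rfl fun i _ => ?_
  simp only [_root_.add_apply, _root_.smul_apply, smul_eq_mul]
  ring

/-- The field `D_a X`, as a smooth function of the tangent vector `a`. -/
lemma contMDiff_cov {D : Connection E M}
    (hD : CovariantDerivative.ContMDiffCovariantDerivative D ∞) {X : VField E M}
    (hX : IsSmoothField X) :
    ContMDiff 𝓘(ℝ, E).tangent 𝓘(ℝ, E).tangent ∞
      (fun p : TangentBundle 𝓘(ℝ, E) M => (⟨p.1, D X p.1 p.2⟩ : TangentBundle 𝓘(ℝ, E) M)) := by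
  have h1 := hD.contMDiff.contMDiff (σ := X) (by exact (hX.contMDiffOn : ContMDiffOn _ _ ∞ _ univ))
  rw [contMDiffOn_univ] at h1
  exact ContMDiff.clm_bundle_apply (b := fun p : TangentBundle 𝓘(ℝ, E) M => p.1)
    (ϕ := fun p => D X p.1) (v := fun p => p.2) (h1.comp (contMDiff_proj _)) contMDiff_id

namespace SpanningFields

variable (P : SpanningFields E M ι) (D : Connection E M)

/-- The connection forms `θᵏⱼ(a) = ξᵏ(D_a Xⱼ)`. -/
noncomputable def connForm (k j : ι) (x : M) : TangentSpace 𝓘(ℝ, E) x →L[ℝ] ℝ :=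
  P.ξ k x ∘L D (P.X j) x

/-- The components `dθᵏⱼ(a, b) + ∑ₗ (θᵏₗ(a) θˡⱼ(b) - θᵏₗ(b) θˡⱼ(a))` of the curvature. -/
noncomputable def curvForm (k j : ι) (x : M) (a b : TangentSpace 𝓘(ℝ, E) x) : ℝ :=
  extDeriv (P.connForm D k j) x a b +
    ∑ l, (P.connForm D k l x a * P.connForm D l j x b -
      P.connForm D k l x b * P.connForm D l j x a)

lemma cov_X (j : ι) (x : M) (a : TangentSpace 𝓘(ℝ, E) x) :
    D (P.X j) x a = ∑ k, P.connForm D k j x a • P.X k x :=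
  (P.sum_eq x _).symm

variable {D}

lemma isSmoothForm_connForm (hD : CovariantDerivative.ContMDiffCovariantDerivative D ∞) (k j : ι) :
    IsSmoothForm (P.connForm D k j) :=
  fun p => ContMDiffAt.comp p (P.smooth_ξ k _) (contMDiff_cov hD (P.smooth_X j) p)

/-- `(D_a D_b - D_b D_a) σ` for a combination `σ = ∑ fⱼ Xⱼ`, where `a` and `b` are extended to
commuting fields: the derivatives of the coefficients `fⱼ` cancel. -/
lemma cov_cov_sub (hD : CovariantDerivative.ContMDiffCovariantDerivative D ∞)
    {f : ι → M → ℝ} {x : M} (hf : ∀ j, ContMDiffAt 𝓘(ℝ, E) 𝓘(ℝ, ℝ) ∞ (f j) x)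
    (a b : TangentSpace 𝓘(ℝ, E) x) :
    D (fun y => D (fun z => ∑ j, f j z • P.X j z) y (ext b y)) x a -
      D (fun y => D (fun z => ∑ j, f j z • P.X j z) y (ext a y)) x b =
    ∑ k, (∑ j, f j x * P.curvForm D k j x a b) • P.X k x := by
  have hfd : ∀ j, MDifferentiableAt 𝓘(ℝ, E) 𝓘(ℝ, ℝ) (f j) x := fun j =>
    (hf j).mdifferentiableAt (by simp)
  -- the coefficients of `D_Z σ`, where `Z` extends `b`
  let g : TangentSpace 𝓘(ℝ, E) x → ι → M → ℝ := fun b k y =>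
    mvfderiv 𝓘(ℝ, E) (f k) y (ext b y) + ∑ j, f j y * P.connForm D k j y (ext b y)
  have hθ : ∀ (b : TangentSpace 𝓘(ℝ, E) x) k j,
      MDifferentiableAt 𝓘(ℝ, E) 𝓘(ℝ, ℝ) (fun y => P.connForm D k j y (ext b y)) x := fun b k j =>
    (P.isSmoothForm_connForm hD k j).mdifferentiableAt_apply_field (mdifferentiableAt_ext b)
  have hg := fun (a b : TangentSpace 𝓘(ℝ, E) x) (k : ι) =>
    mvfderiv_add_sum_mul (mdifferentiableAt_mvfderiv_ext (hf k) b) hfd (hθ b k) a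
  have hfirst : ∀ b : TangentSpace 𝓘(ℝ, E) x, ∀ᶠ y in 𝓝 x,
      ∑ k, g b k y • P.X k y = D (fun z => ∑ j, f j z • P.X j z) y (ext b y) := by
    intro b
    have hev : ∀ᶠ y in 𝓝 x, ∀ j, ContMDiffAt 𝓘(ℝ, E) 𝓘(ℝ, ℝ) 1 (f j) y :=
      Filter.eventually_all.2 fun j =>
        (contMDiffAt_iff_contMDiffAt_nhds (by simp)).1 ((hf j).of_le (m := 1) (by simp))
    filter_upwards [hev] with y hy
    rw [cov_sum D (fun j => (hy j).mdifferentiableAt (by simp))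
      (fun j => (P.smooth_X j).mdifferentiableAt y), Finset.sum_add_distrib]
    simp only [g, add_smul, Finset.sum_add_distrib, Finset.sum_smul, P.cov_X, Finset.smul_sum,
      smul_smul]
    rw [add_comm, Finset.sum_comm]
  have hsecond : ∀ a b : TangentSpace 𝓘(ℝ, E) x,
      D (fun y => D (fun z => ∑ j, f j z • P.X j z) y (ext b y)) x a =
      ∑ k, (mvfderiv 𝓘(ℝ, E) (g b k) x a + ∑ j, g b j x * P.connForm D k j x a) • P.X k x := by
    intro a b
    have hmd : MDiffAt (T% (fun y => ∑ k, g b k y • P.X k y)) x :=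
      MDifferentiableAt.sum_section fun k _ =>
        (hg a b k).1.smul_section ((P.smooth_X k).mdifferentiableAt x)
    rw [← cov_congr D hmd (hfirst b), cov_sum D (fun k => (hg a b k).1)
      (fun j => (P.smooth_X j).mdifferentiableAt x), Finset.sum_add_distrib]
    simp only [add_smul, Finset.sum_add_distrib, Finset.sum_smul, P.cov_X, Finset.smul_sum,
      smul_smul]
    rw [add_comm, Finset.sum_comm]
  rw [hsecond, hsecond, ← Finset.sum_sub_distrib]
  refine Finset.sum_congr rfl fun k _ => ?_
  rw [← sub_smul]
  congr 1
  have h1 : ∀ a b : TangentSpace 𝓘(ℝ, E) x, mvfderiv 𝓘(ℝ, E) (g b k) x a = _ :=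
    fun a b => (hg a b k).2
  rw [h1, h1, mvfderiv_mvfderiv_ext_comm (hf k) a b]
  simp only [g, curvForm, extDeriv, FiberBundle.extend_apply_self, add_mul, mul_add,
    Finset.sum_add_distrib, Finset.sum_mul, Finset.mul_sum, mul_sub, Finset.sum_sub_distrib]
  rw [Finset.sum_comm (f := fun i j => f j x * P.connForm D i j x b * P.connForm D k i x a),
    Finset.sum_comm (f := fun i j => f j x * P.connForm D i j x a * P.connForm D k i x b)]
  have e1 : ∀ a b : TangentSpace 𝓘(ℝ, E) x,
      ∑ j, ∑ i, f j x * P.connForm D i j x b * P.connForm D k i x a =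
      ∑ j, ∑ i, f j x * (P.connForm D k i x a * P.connForm D i j x b) := fun a b =>
    Finset.sum_congr rfl fun _ _ => Finset.sum_congr rfl fun _ _ => by ring
  have e2 : ∀ a b : TangentSpace 𝓘(ℝ, E) x,
      ∑ j, mvfderiv 𝓘(ℝ, E) (f j) x a * P.connForm D k j x b =
      ∑ j, P.connForm D k j x b * mvfderiv 𝓘(ℝ, E) (f j) x a := fun a b =>
    Finset.sum_congr rfl fun _ _ => by ring
  rw [e1, e1]
  ring

/-- The curvature acts on a combination of the `Xⱼ` by the curvature forms. The `Xⱼ` may be linearly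
dependent, so the coefficients are not determined by the vector; the curvature forms nevertheless
give its image for every choice of the coefficients. -/
theorem curvature_sum (hD : CovariantDerivative.ContMDiffCovariantDerivative D ∞) {x : M}
    (a b : TangentSpace 𝓘(ℝ, E) x) (c : ι → ℝ) :
    curvature D x a b (∑ j, c j • P.X j x) =
      ∑ k, (∑ j, c j * P.curvForm D k j x a b) • P.X k x := by
  -- both `ext w` and `∑ cⱼ Xⱼ` are combinations of the `Xⱼ` with coefficients `ξʲ(w)` at `x`
  set w := ∑ j, c j • P.X j x with hw
  have h1 := P.cov_cov_sub hD (f := fun j y => P.ξ j y (ext w y))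
    (fun j => (P.smooth_ξ j).apply_field (contMDiffAt_ext w)) a b
  have h2 := P.cov_cov_sub hD (f := fun j y => P.ξ j y (∑ i, c i • P.X i y))
    (fun j => (P.smooth_ξ j).apply_field
      (ContMDiffAt.sum_section fun i _ => contMDiffAt_const.smul_section (P.smooth_X i x))) a b
  have h3 := P.cov_cov_sub hD (f := fun j _ => c j) (fun j => contMDiffAt_const) (x := x) a b
  simp only [P.sum_eq, FiberBundle.extend_apply_self] at h1 h2
  rw [curvature, mlieBracket_ext, map_zero, sub_zero, h1, ← h3, h2]

end SpanningFields

variable [RiemannianBundle (fun x : M => TangentSpace 𝓘(ℝ, E) x)]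
  [IsContMDiffRiemannianBundle 𝓘(ℝ, E) ∞ E (fun x : M => TangentSpace 𝓘(ℝ, E) x)]

/-- The one-form `⟨X, ·⟩`. -/
noncomputable def innerForm (X : VField E M) (x : M) : TangentSpace 𝓘(ℝ, E) x →L[ℝ] ℝ :=
  innerSL ℝ (X x)

lemma isSmoothForm_innerForm {X : VField E M} (hX : IsSmoothField X) :
    IsSmoothForm (innerForm X) :=
  ContMDiff.inner_bundle (E := fun x : M => TangentSpace 𝓘(ℝ, E) x)
    (b := fun p : TangentBundle 𝓘(ℝ, E) M => p.1) (v := fun p => X p.1) (w := fun p => p.2)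
    (hX.comp (contMDiff_proj _)) contMDiff_id

/-- The exterior derivative of `⟪X, ·⟫` in terms of the torsion of a metric connection. -/
lemma extDeriv_innerForm {D : Connection E M}
    (hD : CovariantDerivative.IsMetricCompatible (V := (TangentSpace 𝓘(ℝ, E) : M → Type _)) D)
    {X : VField E M} (hX : IsSmoothField X) {x : M} (a b : TangentSpace 𝓘(ℝ, E) x) :
    extDeriv (innerForm X) x a b =
      inner ℝ (D X x a) b - inner ℝ (D X x b) a + inner ℝ (X x) (D.torsion x a b) := by
  have key : ∀ a b : TangentSpace 𝓘(ℝ, E) x,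
      mvfderiv 𝓘(ℝ, E) (fun y => innerForm X y (ext b y)) x a =
        inner ℝ (D X x a) b + inner ℝ (X x) (D (ext b) x a) := fun a b => by
    have h3 := hD.mvfderiv_inner_eq (ext a) (hX.mdifferentiableAt x) (mdifferentiableAt_ext b)
    simp only [FiberBundle.extend_apply_self] at h3
    exact h3
  rw [extDeriv, key, key, CovariantDerivative.torsion_apply_eq_extend, mlieBracket_ext]
  simp only [FiberBundle.extend_apply_self, sub_zero, inner_sub_right]
  ring

end Curvature

/-! ### Adapted connections and the torsion of the Bott connection -/

section Adapted

variable {E : Type*} [NormedAddCommGroup E] [NormedSpace ℝ E] [FiniteDimensional ℝ E] {n : ℕ}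
  {M : Type*} [TopologicalSpace M] [ChartedSpace E M] [IsManifold 𝓘(ℝ, E) ∞ M]
  {ι : Type*} [Fintype ι]
  [RiemannianBundle (fun x : M => TangentSpace 𝓘(ℝ, E) x)]

lemma ext_self {x : M} (a : TangentSpace 𝓘(ℝ, E) x) : ext a x = a :=
  FiberBundle.extend_apply_self E a

lemma leviCivita_zero_left (Z : VField E M) : leviCivita (0 : VField E M) Z = 0 := by
  have h0 : ∀ (W : VField E M) (x : M), koszul 0 Z W x = 0 := by
    intro W x
    have h1 : ∀ W : VField E M, (fun y => inner ℝ ((0 : VField E M) y) (W y)) = fun _ => (0 : ℝ) :=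
      fun W => funext fun y => inner_zero_left _
    rw [koszul, h1, h1, mvfderiv_const, VectorField.mlieBracket_zero_left,
      VectorField.mlieBracket_zero_left]
    simp
  funext x
  rw [leviCivita]
  simp [h0]

lemma koszul_sub_koszul (X Y Z : VField E M) (x : M) :
    koszul X Y Z x - koszul Y X Z x =
      inner ℝ (VectorField.mlieBracket 𝓘(ℝ, E) X Y x) (Z x) := by
  have h1 : (fun y => inner ℝ (X y) (Y y)) = fun y => inner ℝ (Y y) (X y) := by
    funext y
    exact real_inner_comm _ _
  rw [koszul, koszul, h1, VectorField.mlieBracket_swap_apply (V := Y) (W := X), inner_neg_left]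
  ring

/-- The Levi-Civita connection is torsion-free, by the form of the Koszul formula. -/
lemma leviCivita_sub_leviCivita (X Y : VField E M) (x : M) :
    leviCivita X Y x - leviCivita Y X x = VectorField.mlieBracket 𝓘(ℝ, E) X Y x := by
  rw [leviCivita, leviCivita, ← Finset.sum_sub_distrib]
  simp only [← sub_smul, koszul_sub_koszul, FiberBundle.extend_apply_self]
  conv_rhs => rw [← (stdOrthonormalBasis ℝ (TangentSpace 𝓘(ℝ, E) x)).sum_repr'
    (VectorField.mlieBracket 𝓘(ℝ, E) X Y x)]
  exact Finset.sum_congr rfl fun i _ => by rw [real_inner_comm]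

namespace Foliation

variable (F : Foliation E n M)

lemma hor_add_ver (X : VField E M) (x : M) : F.hor X x + F.ver X x = X x := by
  rw [add_comm]
  exact Submodule.starProjection_add_starProjection_orthogonal (K := F.vertical x) (X x)

lemma hor_eq_sub (X : VField E M) : F.hor X = fun x => X x - F.ver X x := by
  funext x
  rw [← F.hor_add_ver X x, add_sub_cancel_right]

lemma ver_apply_mem (X : VField E M) (x : M) : F.ver X x ∈ F.vertical x :=
  Submodule.starProjection_apply_mem _ _

lemma hor_apply_mem (X : VField E M) (x : M) : F.hor X x ∈ F.horizontal x :=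
  Submodule.starProjection_apply_mem _ _

variable {F} in
lemma inner_horizontal_vertical {x : M} {a b : TangentSpace 𝓘(ℝ, E) x}
    (ha : a ∈ F.horizontal x) (hb : b ∈ F.vertical x) : inner ℝ a b = 0 :=
  Submodule.inner_left_of_mem_orthogonal hb ha

/-- The orthogonal projection to the vertical space at `x`. -/
noncomputable abbrev verProj (x : M) : TangentSpace 𝓘(ℝ, E) x →L[ℝ] TangentSpace 𝓘(ℝ, E) x :=
  (F.vertical x).starProjection

/-- The orthogonal projection to the horizontal space at `x`. -/
noncomputable abbrev horProj (x : M) : TangentSpace 𝓘(ℝ, E) x →L[ℝ] TangentSpace 𝓘(ℝ, E) x :=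
  (F.horizontal x).starProjection

variable {F} in
lemma verProj_of_mem_vertical {x : M} {a : TangentSpace 𝓘(ℝ, E) x} (ha : a ∈ F.vertical x) :
    F.verProj x a = a :=
  Submodule.starProjection_eq_self_iff.2 ha

variable {F} in
lemma verProj_of_mem_horizontal {x : M} {a : TangentSpace 𝓘(ℝ, E) x} (ha : a ∈ F.horizontal x) :
    F.verProj x a = 0 :=
  (Submodule.starProjection_apply_eq_zero_iff _).2 ha

variable {F} in
lemma horProj_of_mem_horizontal {x : M} {a : TangentSpace 𝓘(ℝ, E) x}
    (ha : a ∈ F.horizontal x) : F.horProj x a = a :=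
  Submodule.starProjection_eq_self_iff.2 ha

lemma horProj_add_verProj (x : M) (a : TangentSpace 𝓘(ℝ, E) x) :
    F.horProj x a + F.verProj x a = a := by
  rw [add_comm]
  exact Submodule.starProjection_add_starProjection_orthogonal (K := F.vertical x) a

variable [IsContMDiffRiemannianBundle 𝓘(ℝ, E) ∞ E (fun x : M => TangentSpace 𝓘(ℝ, E) x)]

lemma isSmoothField_hor {X : VField E M} (hX : IsSmoothField X) : IsSmoothField (F.hor X) := by
  rw [hor_eq_sub]
  exact ContMDiff.sub_section hX (F.isSmoothField_ver hX)

end Foliation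

namespace SpanningFields

variable (P : SpanningFields E M ι)

/-- An extension of the tangent vector `a` to a smooth vector field on `M`. -/
noncomputable def extend {x : M} (a : TangentSpace 𝓘(ℝ, E) x) : VField E M := fun y =>
  ∑ i, P.ξ i x a • P.X i y

lemma isSmoothField_sum (c : ι → ℝ) : IsSmoothField fun y => ∑ i, c i • P.X i y :=
  fun x => ContMDiffAt.sum_section fun i _ => contMDiffAt_const.smul_section (P.smooth_X i x)

lemma isSmoothField_extend {x : M} (a : TangentSpace 𝓘(ℝ, E) x) : IsSmoothField (P.extend a) :=
  P.isSmoothField_sum _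

lemma extend_apply {x : M} (a : TangentSpace 𝓘(ℝ, E) x) : P.extend a x = a := P.sum_eq x a

variable (F : Foliation E n M)

lemma hor_eq_sum (Z : VField E M) :
    F.hor Z = fun y => ∑ j, P.ξ j y (Z y) • F.hor (P.X j) y := by
  funext y
  conv_lhs => rw [Foliation.hor, ← P.sum_eq y (Z y), map_sum]
  simp [Foliation.hor]

variable [IsContMDiffRiemannianBundle 𝓘(ℝ, E) ∞ E (fun x : M => TangentSpace 𝓘(ℝ, E) x)]

lemma mdifferentiableAt_hor (P : SpanningFields E M ι) (F : Foliation E n M) {Z : VField E M}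
    {x : M} (hZ : MDiffAt (T% Z) x) :
    MDiffAt (T% (F.hor Z)) x := by
  rw [P.hor_eq_sum F Z]
  exact MDifferentiableAt.sum_section fun j _ =>
    ((P.smooth_ξ j).mdifferentiableAt_apply_field hZ).smul_section
      ((F.isSmoothField_hor (P.smooth_X j)).mdifferentiableAt x)

lemma mdifferentiableAt_ver (P : SpanningFields E M ι) (F : Foliation E n M) {Z : VField E M}
    {x : M} (hZ : MDiffAt (T% Z) x) :
    MDiffAt (T% (F.ver Z)) x := by
  have h : F.ver Z = fun y => Z y - F.hor Z y := by
    funext y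
    rw [← F.hor_add_ver Z y, add_sub_cancel_left]
  rw [h]
  exact mdifferentiableAt_sub_section hZ (P.mdifferentiableAt_hor F hZ)

/-- The terms of the Bott torsion: the Levi-Civita connection contributes brackets only. -/
lemma bottTorsion_eq (P : SpanningFields E M ι) (F : Foliation E n M) (x : M)
    (a b : TangentSpace 𝓘(ℝ, E) x) :
    F.bottTorsion x a b =
      - F.horProj x (VectorField.mlieBracket 𝓘(ℝ, E) (F.ver (ext a)) (F.ver (ext b)) x)
      - F.verProj x (VectorField.mlieBracket 𝓘(ℝ, E) (F.hor (ext a)) (F.hor (ext b)) x) := by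
  set Y : VField E M := ext a
  set Z : VField E M := ext b
  have hY : MDiffAt (T% Y) x := mdifferentiableAt_ext a
  have hZ : MDiffAt (T% Z) x := mdifferentiableAt_ext b
  have hsum : ∀ W : VField E M, W = F.hor W + F.ver W := fun W => by
    funext y
    exact (F.hor_add_ver W y).symm
  have hbr : VectorField.mlieBracket 𝓘(ℝ, E) Y Z x =
      VectorField.mlieBracket 𝓘(ℝ, E) (F.hor Y) (F.hor Z) x +
      VectorField.mlieBracket 𝓘(ℝ, E) (F.hor Y) (F.ver Z) x +
      (VectorField.mlieBracket 𝓘(ℝ, E) (F.ver Y) (F.hor Z) x +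
      VectorField.mlieBracket 𝓘(ℝ, E) (F.ver Y) (F.ver Z) x) := by
    conv_lhs => rw [hsum Y, hsum Z]
    rw [VectorField.mlieBracket_add_left (P.mdifferentiableAt_hor F hY)
      (P.mdifferentiableAt_ver F hY),
      VectorField.mlieBracket_add_right (P.mdifferentiableAt_hor F hZ)
        (P.mdifferentiableAt_ver F hZ),
      VectorField.mlieBracket_add_right (P.mdifferentiableAt_hor F hZ)
        (P.mdifferentiableAt_ver F hZ)]
  have h1 := leviCivita_sub_leviCivita (F.hor Y) (F.hor Z) x
  have h2 := leviCivita_sub_leviCivita (F.ver Y) (F.ver Z) x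
  have h3 : F.bott Y Z x - F.bott Z Y x =
      F.horProj x (VectorField.mlieBracket 𝓘(ℝ, E) (F.hor Y) (F.hor Z) x) +
      F.horProj x (VectorField.mlieBracket 𝓘(ℝ, E) (F.ver Y) (F.hor Z) x) +
      F.verProj x (VectorField.mlieBracket 𝓘(ℝ, E) (F.hor Y) (F.ver Z) x) +
      F.verProj x (VectorField.mlieBracket 𝓘(ℝ, E) (F.ver Y) (F.ver Z) x) +
      (F.horProj x (VectorField.mlieBracket 𝓘(ℝ, E) (F.hor Y) (F.ver Z) x) +
      F.verProj x (VectorField.mlieBracket 𝓘(ℝ, E) (F.ver Y) (F.hor Z) x)) := by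
    have hb : ∀ Y Z : VField E M, F.bott Y Z x =
        F.horProj x (leviCivita (F.hor Y) (F.hor Z) x) +
        F.horProj x (VectorField.mlieBracket 𝓘(ℝ, E) (F.ver Y) (F.hor Z) x) +
        F.verProj x (VectorField.mlieBracket 𝓘(ℝ, E) (F.hor Y) (F.ver Z) x) +
        F.verProj x (leviCivita (F.ver Y) (F.ver Z) x) := fun _ _ => rfl
    rw [hb, hb, ← h1, ← h2, VectorField.mlieBracket_swap_apply (V := F.ver Z) (W := F.hor Y),
      VectorField.mlieBracket_swap_apply (V := F.hor Z) (W := F.ver Y), map_sub, map_sub, map_neg,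
      map_neg]
    abel
  rw [Foliation.bottTorsion, h3, hbr]
  conv_lhs =>
    rw [← F.horProj_add_verProj x (VectorField.mlieBracket 𝓘(ℝ, E) (F.hor Y) (F.hor Z) x +
      VectorField.mlieBracket 𝓘(ℝ, E) (F.hor Y) (F.ver Z) x +
      (VectorField.mlieBracket 𝓘(ℝ, E) (F.ver Y) (F.hor Z) x +
      VectorField.mlieBracket 𝓘(ℝ, E) (F.ver Y) (F.ver Z) x))]
  simp only [map_add]
  abel

/-- On horizontal vectors, the Bott torsion is minus the vertical part of the bracket of horizontal
extensions. -/
lemma bottTorsion_eq_of_mem_horizontal (P : SpanningFields E M ι) {F : Foliation E n M} {x : M}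
    {a b : TangentSpace 𝓘(ℝ, E) x} (ha : a ∈ F.horizontal x) (hb : b ∈ F.horizontal x) :
    F.bottTorsion x a b =
      - F.verProj x (VectorField.mlieBracket 𝓘(ℝ, E) (F.hor (ext a)) (F.hor (ext b)) x) := by
  have h0 : ∀ {c : TangentSpace 𝓘(ℝ, E) x}, c ∈ F.horizontal x → F.ver (ext c) x = 0 :=
    fun {c} hc => by
      change F.verProj x (ext c x) = 0
      rw [ext_self, Foliation.verProj_of_mem_horizontal hc]
  have h1 : VectorField.mlieBracket 𝓘(ℝ, E) (F.ver (ext a)) (F.ver (ext b)) x = 0 := by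
    rw [← VectorField.mlieBracketWithin_univ]
    exact VectorField.mlieBracketWithin_eq_zero_of_eq_zero (h0 ha) (h0 hb)
  rw [P.bottTorsion_eq, h1, map_zero, neg_zero, zero_sub]

end SpanningFields

namespace IsAdapted

variable [IsContMDiffRiemannianBundle 𝓘(ℝ, E) ∞ E (fun x : M => TangentSpace 𝓘(ℝ, E) x)]
  {F : Foliation E n M} {D D' : Connection E M}

lemma cov_mem_horizontal (hD : IsAdapted F D) (P : SpanningFields E M ι) {X : VField E M}
    (hX : IsSmoothField X) (hXh : ∀ x, X x ∈ F.horizontal x) {x : M}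
    (a : TangentSpace 𝓘(ℝ, E) x) : D X x a ∈ F.horizontal x := by
  have := hD.horizontal (P.extend a) X (P.isSmoothField_extend a) hX hXh x
  rwa [P.extend_apply] at this

lemma cov_mem_vertical (hD : IsAdapted F D) (P : SpanningFields E M ι) {X : VField E M}
    (hX : IsSmoothField X) (hXv : ∀ x, X x ∈ F.vertical x) {x : M}
    (a : TangentSpace 𝓘(ℝ, E) x) : D X x a ∈ F.vertical x := by
  have := hD.vertical (P.extend a) X (P.isSmoothField_extend a) hX hXv x
  rwa [P.extend_apply] at this

/-- The vertical projection is parallel. -/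
lemma cov_ver (hD : IsAdapted F D) (P : SpanningFields E M ι) {X : VField E M}
    (hX : IsSmoothField X) {x : M} (a : TangentSpace 𝓘(ℝ, E) x) :
    D (F.ver X) x a = F.verProj x (D X x a) := by
  have h1 : X = F.hor X + F.ver X := by
    funext y
    exact (F.hor_add_ver X y).symm
  have h2 := cov_mem_horizontal hD P (F.isSmoothField_hor hX) (F.hor_apply_mem X) a
  have h3 := cov_mem_vertical hD P (F.isSmoothField_ver hX) (F.ver_apply_mem X) a
  conv_rhs => rw [h1, D.isCovariantDerivativeOnUniv.add
    ((F.isSmoothField_hor hX).mdifferentiableAt x) ((F.isSmoothField_ver hX).mdifferentiableAt x)]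
  rw [_root_.add_apply, map_add, Foliation.verProj_of_mem_horizontal h2,
    Foliation.verProj_of_mem_vertical h3, zero_add]

lemma cov_hor_mem_horizontal (hD : IsAdapted F D) (P : SpanningFields E M ι) {Z : VField E M}
    {x : M} (hZ : MDiffAt (T% Z) x) (a : TangentSpace 𝓘(ℝ, E) x) :
    D (F.hor Z) x a ∈ F.horizontal x := by
  rw [P.hor_eq_sum F Z, cov_sum D (fun j => (P.smooth_ξ j).mdifferentiableAt_apply_field hZ)
    (fun j => (F.isSmoothField_hor (P.smooth_X j)).mdifferentiableAt x)]
  refine Submodule.sum_mem _ fun j _ => Submodule.add_mem _ (Submodule.smul_mem _ _ ?_)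
    (Submodule.smul_mem _ _ (F.hor_apply_mem _ x))
  exact cov_mem_horizontal hD P (F.isSmoothField_hor (P.smooth_X j)) (F.hor_apply_mem _) a

lemma verProj_torsion_of_mem_horizontal (hD : IsAdapted F D) (P : SpanningFields E M ι) {x : M}
    {a b : TangentSpace 𝓘(ℝ, E) x} (ha : a ∈ F.horizontal x) (hb : b ∈ F.horizontal x) :
    F.verProj x (D.torsion x a b) = F.bottTorsion x a b := by
  have h0 : ∀ {c : TangentSpace 𝓘(ℝ, E) x}, c ∈ F.horizontal x → F.hor (ext c) x = c :=
    fun {c} hc => by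
      change F.horProj x (ext c x) = c
      rw [ext_self, Foliation.horProj_of_mem_horizontal hc]
  have h1 := D.torsion_apply (P.mdifferentiableAt_hor F (mdifferentiableAt_ext a))
    (P.mdifferentiableAt_hor F (mdifferentiableAt_ext b))
  rw [h0 ha, h0 hb] at h1
  rw [h1, map_sub, map_sub, P.bottTorsion_eq_of_mem_horizontal ha hb,
    Foliation.verProj_of_mem_horizontal (hD.cov_hor_mem_horizontal P (mdifferentiableAt_ext a) b),
    Foliation.verProj_of_mem_horizontal (hD.cov_hor_mem_horizontal P (mdifferentiableAt_ext b) a),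
    sub_zero, zero_sub]

lemma verProj_torsion_of_mem_vertical (hD : IsAdapted F D) (P : SpanningFields E M ι) {x : M}
    {a z : TangentSpace 𝓘(ℝ, E) x} (ha : a ∈ F.horizontal x) (hz : z ∈ F.vertical x) :
    F.verProj x (D.torsion x a z) = 0 := by
  set A : VField E M := F.hor (P.extend a) with hA_def
  set Z : VField E M := F.ver (P.extend z) with hZ_def
  have hA : IsSmoothField A := F.isSmoothField_hor (P.isSmoothField_extend a)
  have hZ : IsSmoothField Z := F.isSmoothField_ver (P.isSmoothField_extend z)
  have hAx : A x = a := by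
    change F.horProj x (P.extend a x) = a
    rw [P.extend_apply, Foliation.horProj_of_mem_horizontal ha]
  have hZx : Z x = z := by
    change F.verProj x (P.extend z x) = z
    rw [P.extend_apply, Foliation.verProj_of_mem_vertical hz]
  have hAh : ∀ y, A y ∈ F.horizontal y := F.hor_apply_mem _
  have hZv : ∀ y, Z y ∈ F.vertical y := F.ver_apply_mem _
  have h1 : F.hor A = A := funext fun y => Foliation.horProj_of_mem_horizontal (hAh y)
  have h2 : F.ver A = 0 := funext fun y => Foliation.verProj_of_mem_horizontal (hAh y)
  have h3 : F.ver Z = Z := funext fun y => Foliation.verProj_of_mem_vertical (hZv y)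
  have hT := D.torsion_apply (hA.mdifferentiableAt x) (hZ.mdifferentiableAt x)
  have hB := hD.eq_bott A Z hA hZ hAh x
  have hZA := hD.horizontal Z A hZ hA hAh x
  have hver : F.verProj x (D Z x (A x)) =
      F.verProj x (VectorField.mlieBracket 𝓘(ℝ, E) A Z x) := by
    have h4 : F.bott A Z x = F.horProj x (leviCivita (F.hor A) (F.hor Z) x) +
        F.horProj x (VectorField.mlieBracket 𝓘(ℝ, E) (F.ver A) (F.hor Z) x) +
        F.verProj x (VectorField.mlieBracket 𝓘(ℝ, E) (F.hor A) (F.ver Z) x) +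
        F.verProj x (leviCivita (F.ver A) (F.ver Z) x) := rfl
    have h5 : leviCivita (0 : VField E M) Z x = 0 := congrFun (leviCivita_zero_left Z) x
    have h6 : ∀ w, F.verProj x (F.horProj x w) = 0 := fun w =>
      Foliation.verProj_of_mem_horizontal (Submodule.starProjection_apply_mem _ _)
    have h7 : ∀ w, F.verProj x (F.verProj x w) = F.verProj x w := fun w =>
      Foliation.verProj_of_mem_vertical (Submodule.starProjection_apply_mem _ _)
    rw [hB, h4, h2, h1, h3, h5, map_add, map_add, map_add, h6, h6, h7, map_zero, map_zero]
    abel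
  rw [hAx, hZx] at hT
  rw [hT, map_sub, map_sub, ← hAx, hver, ← hZx, Foliation.verProj_of_mem_horizontal hZA]
  abel

/-- For horizontal `a`, the vertical part of the torsion `Tᴰ(a, ·)` is the Bott torsion of the
horizontal part of the argument. -/
theorem verProj_torsion (hD : IsAdapted F D) (P : SpanningFields E M ι) {x : M}
    {a b z : TangentSpace 𝓘(ℝ, E) x} (ha : a ∈ F.horizontal x) (hb : b ∈ F.horizontal x)
    (hz : z ∈ F.vertical x) :
    F.verProj x (D.torsion x a (b + z)) = F.bottTorsion x a b := by
  rw [map_add, map_add, hD.verProj_torsion_of_mem_horizontal P ha hb,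
    hD.verProj_torsion_of_mem_vertical P ha hz, add_zero]

/-- Adapted connections differ in vertical directions only. -/
lemma cov_eq_cov (hD : IsAdapted F D) (hD' : IsAdapted F D') (P : SpanningFields E M ι)
    {Z : VField E M} {x : M} (hZ : MDiffAt (T% Z) x) {a : TangentSpace 𝓘(ℝ, E) x}
    (ha : a ∈ F.horizontal x) : D Z x a = D' Z x a := by
  have hA : IsSmoothField (F.hor (P.extend a)) := F.isSmoothField_hor (P.isSmoothField_extend a)
  have hAx : F.hor (P.extend a) x = a := by
    change F.horProj x (P.extend a x) = a
    rw [P.extend_apply, Foliation.horProj_of_mem_horizontal ha]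
  have h1 : ∀ j, D (P.X j) x a = D' (P.X j) x a := fun j => by
    have h2 := hD.eq_bott _ _ hA (P.smooth_X j) (F.hor_apply_mem _) x
    have h3 := hD'.eq_bott _ _ hA (P.smooth_X j) (F.hor_apply_mem _) x
    rw [hAx] at h2 h3
    rw [h2, h3]
  have h4 : Z = fun y => ∑ j, P.ξ j y (Z y) • P.X j y := funext fun y => (P.sum_eq y _).symm
  rw [h4, cov_sum D (fun j => (P.smooth_ξ j).mdifferentiableAt_apply_field hZ)
    (fun j => (P.smooth_X j).mdifferentiableAt x),
    cov_sum D' (fun j => (P.smooth_ξ j).mdifferentiableAt_apply_field hZ)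
    (fun j => (P.smooth_X j).mdifferentiableAt x)]
  simp only [h1]

end IsAdapted

end Adapted

/-! ### Parallel fields along a path -/

section Parallel

variable {E : Type*} [NormedAddCommGroup E] [NormedSpace ℝ E] [FiniteDimensional ℝ E] {n : ℕ}
  {M : Type*} [TopologicalSpace M] [ChartedSpace E M] [IsManifold 𝓘(ℝ, E) ∞ M]
  {ι : Type*} [Fintype ι]

lemma uniqueMDiffOn_Icc : UniqueMDiffOn 𝓘(ℝ, ℝ) (Icc (0 : ℝ) 1) :=
  (uniqueDiffOn_Icc one_pos).uniqueMDiffOn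

/-- The derivative of a smooth map in a fixed direction, as a map to `TM`. -/
lemma contMDiffOn_mfderivWithin_apply {G : Type*} [NormedAddCommGroup G] [NormedSpace ℝ G]
    {f : G → M} {S : Set G} (hf : ContMDiffOn 𝓘(ℝ, G) 𝓘(ℝ, E) ∞ f S) (hS : UniqueDiffOn ℝ S)
    (v : G) :
    ContMDiffOn 𝓘(ℝ, G) 𝓘(ℝ, E).tangent ∞
      (fun q => (⟨f q, mfderivWithin 𝓘(ℝ, G) 𝓘(ℝ, E) f S q v⟩ : TangentBundle 𝓘(ℝ, E) M)) S := by
  have h1 := hf.contMDiffOn_tangentMapWithin (m := ∞) (by simp) hS.uniqueMDiffOn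
  have h2 : ContMDiff 𝓘(ℝ, G) 𝓘(ℝ, G).tangent ∞
      (fun q => (⟨q, v⟩ : TangentBundle 𝓘(ℝ, G) G)) :=
    (contMDiff_vectorSpace_iff_contDiff (V := fun _ => v)).2 contDiff_const
  exact h1.comp h2.contMDiffOn (fun q hq => hq)

/-- Velocities of smooth paths are smooth. -/
lemma contMDiffOn_velocity {β : ℝ → M} (hβ : ContMDiffOn 𝓘(ℝ, ℝ) 𝓘(ℝ, E) ∞ β (Icc 0 1)) :
    ContMDiffOn 𝓘(ℝ, ℝ) 𝓘(ℝ, E).tangent ∞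
      (fun s => (⟨β s, velocity (E := E) β s⟩ : TangentBundle 𝓘(ℝ, E) M)) (Icc 0 1) :=
  contMDiffOn_mfderivWithin_apply hβ (uniqueDiffOn_Icc one_pos) 1

lemma velocity_congr {β β' : ℝ → M} (h : EqOn β β' (Icc 0 1)) {s : ℝ} (hs : s ∈ Icc (0 : ℝ) 1) :
    (⟨β s, velocity (E := E) β s⟩ : TangentBundle 𝓘(ℝ, E) M) =
      ⟨β' s, velocity (E := E) β' s⟩ := by
  have h1 : (mfderivWithin 𝓘(ℝ, ℝ) 𝓘(ℝ, E) β (Icc 0 1) s : ℝ →L[ℝ] E) =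
      mfderivWithin 𝓘(ℝ, ℝ) 𝓘(ℝ, E) β' (Icc 0 1) s := mfderivWithin_congr h (h hs)
  have h2 : (velocity (E := E) β s : E) = velocity (E := E) β' s :=
    congrArg (fun l : ℝ →L[ℝ] E => l 1) h1
  exact Bundle.TotalSpace.ext (h hs) (heq_of_eq h2)

lemma IsSmoothForm.contDiffOn_comp {G : Type*} [NormedAddCommGroup G] [NormedSpace ℝ G]
    {θ : (x : M) → TangentSpace 𝓘(ℝ, E) x →L[ℝ] ℝ} (hθ : IsSmoothForm θ)
    {f : G → TangentBundle 𝓘(ℝ, E) M} {S : Set G}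
    (hf : ContMDiffOn 𝓘(ℝ, G) 𝓘(ℝ, E).tangent ∞ f S) :
    ContDiffOn ℝ ∞ (fun q => θ (f q).1 (f q).2) S :=
  contMDiffOn_iff_contDiffOn.1 fun q hq => hθ.comp (hf q hq)

namespace SpanningFields

variable (P : SpanningFields E M ι)

/-- A combination of the spanning fields with smooth coefficients is smooth along a smooth map. -/
lemma contMDiffOn_sum {G : Type*} [NormedAddCommGroup G] [NormedSpace ℝ G]
    {f : G → M} {S : Set G} (hf : ContMDiffOn 𝓘(ℝ, G) 𝓘(ℝ, E) ∞ f S) {c : ι → G → ℝ}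
    (hc : ∀ k, ContDiffOn ℝ ∞ (c k) S) :
    ContMDiffOn 𝓘(ℝ, G) 𝓘(ℝ, E).tangent ∞
      (fun q => (⟨f q, ∑ k, c k q • P.X k (f q)⟩ : TangentBundle 𝓘(ℝ, E) M)) S := by
  intro q hq
  refine (Bundle.contMDiffWithinAt_totalSpace (F := E)
    (E := (TangentSpace 𝓘(ℝ, E) : M → Type _))).2 ⟨hf q hq, ?_⟩
  let e := trivializationAt E (TangentSpace 𝓘(ℝ, E) : M → Type _) (f q)
  have hb : f q ∈ e.baseSet := FiberBundle.mem_baseSet_trivializationAt' _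
  have h1 : ∀ k, ContMDiffWithinAt 𝓘(ℝ, G) 𝓘(ℝ, E) ∞
      (fun q => (e ⟨f q, P.X k (f q)⟩).2) S q := fun k =>
    ((Bundle.contMDiffWithinAt_totalSpace (F := E)
      (E := (TangentSpace 𝓘(ℝ, E) : M → Type _))).1
      (ContMDiffAt.comp_contMDiffWithinAt q (P.smooth_X k (f q)) (hf q hq))).2
  have h2 : ContMDiffWithinAt 𝓘(ℝ, G) 𝓘(ℝ, E) ∞
      (fun q => ∑ k, c k q • (e ⟨f q, P.X k (f q)⟩).2) S q :=
    ContMDiffWithinAt.sum fun k _ => (hc k q hq).contMDiffWithinAt.smul (h1 k)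
  have h3 : ∀ r, f r ∈ e.baseSet → (e ⟨f r, ∑ k, c k r • P.X k (f r)⟩).2 =
      ∑ k, c k r • (e ⟨f r, P.X k (f r)⟩).2 := by
    intro r hr
    have h4 : ∀ a, (e ⟨f r, a⟩).2 = e.continuousLinearMapAt ℝ (f r) a := fun a => by
      rw [Trivialization.continuousLinearMapAt_apply, e.coe_linearMapAt_of_mem hr]
    simp only [h4, map_sum, map_smul]
  refine h2.congr_of_eventuallyEq ?_ (h3 q hb)
  filter_upwards [(hf q hq).continuousWithinAt.eventually (e.open_baseSet.mem_nhds hb)] with r hr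
  exact h3 r hr

/-- The field `∑ₖ cᵏ Xₖ` along the path `β` is `D`-parallel. -/
def IsParallel (D : Connection E M) (β : ℝ → M) (c : ℝ → ι → ℝ) : Prop :=
  ∀ s ∈ Icc (0 : ℝ) 1, ∃ c' : ι → ℝ, HasDerivWithinAt c c' (Icc 0 1) s ∧
    ∑ k, (c' k • P.X k (β s) + c s k • D (P.X k) (β s) (velocity (E := E) β s)) = 0

variable {P} {D : Connection E M} {β β' : ℝ → M}

lemma IsParallel.congr {c : ℝ → ι → ℝ} (hc : P.IsParallel D β c) (h : EqOn β β' (Icc 0 1)) :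
    P.IsParallel D β' c := by
  intro s hs
  obtain ⟨c', hc', h0⟩ := hc s hs
  refine ⟨c', hc', ?_⟩
  have key : ∀ p q : TangentBundle 𝓘(ℝ, E) M, p = q →
      ∑ k, (c' k • P.X k p.1 + c s k • D (P.X k) p.1 p.2) = 0 →
      ∑ k, (c' k • P.X k q.1 + c s k • D (P.X k) q.1 q.2) = 0 := by
    rintro p q rfl hp
    exact hp
  exact key _ _ (velocity_congr h hs) h0

lemma IsParallel.sum {κ : Type*} [Fintype κ] {c : κ → ℝ → ι → ℝ}
    (hc : ∀ i, P.IsParallel D β (c i)) (a : κ → ℝ) :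
    P.IsParallel D β (fun s k => ∑ i, a i * c i s k) := by
  intro s hs
  choose c' hc' h0 using fun i => hc i s hs
  refine ⟨fun k => ∑ i, a i * c' i k, ?_, ?_⟩
  · rw [hasDerivWithinAt_pi]
    intro k
    exact HasDerivWithinAt.fun_sum fun i _ => ((hasDerivWithinAt_pi.1 (hc' i)) k).const_mul (a i)
  · have : ∑ k, ((∑ i, a i * c' i k) • P.X k (β s) +
        (∑ i, a i * c i s k) • D (P.X k) (β s) (velocity (E := E) β s)) =
        ∑ i, a i • ∑ k, (c' i k • P.X k (β s) +
          c i s k • D (P.X k) (β s) (velocity (E := E) β s)) := by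
      simp only [Finset.smul_sum, Finset.sum_smul, smul_add, ← Finset.sum_add_distrib, mul_smul]
      rw [Finset.sum_comm]
    rw [this]
    simp [h0]

/-- The derivative of a parallel field, in terms of the connection forms. -/
lemma isParallel_of_hasDerivWithinAt {c : ℝ → ι → ℝ}
    (hc : ∀ s ∈ Icc (0 : ℝ) 1, HasDerivWithinAt c
      (fun k => -∑ j, P.connForm D k j (β s) (velocity (E := E) β s) * c s j) (Icc 0 1) s) :
    P.IsParallel D β c := by
  intro s hs
  refine ⟨_, hc s hs, ?_⟩
  simp only [Finset.sum_add_distrib, neg_smul, Finset.sum_smul, P.cov_X, Finset.smul_sum,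
    smul_smul, Finset.sum_neg_distrib]
  rw [Finset.sum_comm]
  simp [mul_comm]

variable [RiemannianBundle (fun x : M => TangentSpace 𝓘(ℝ, E) x)]
  [IsContMDiffRiemannianBundle 𝓘(ℝ, E) ∞ E (fun x : M => TangentSpace 𝓘(ℝ, E) x)]

/-- Parallel transport preserves the metric. -/
lemma IsParallel.inner_eq
    (hD : CovariantDerivative.IsMetricCompatible (V := (TangentSpace 𝓘(ℝ, E) : M → Type _)) D)
    (hβ : ContMDiffOn 𝓘(ℝ, ℝ) 𝓘(ℝ, E) ∞ β (Icc 0 1)) {c d : ℝ → ι → ℝ}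
    (hc : P.IsParallel D β c) (hd : P.IsParallel D β d) {s : ℝ} (hs : s ∈ Icc (0 : ℝ) 1) :
    inner ℝ (∑ k, c s k • P.X k (β s)) (∑ k, d s k • P.X k (β s)) =
      inner ℝ (∑ k, c 0 k • P.X k (β 0)) (∑ k, d 0 k • P.X k (β 0)) := by
  refine eq_of_hasDerivWithinAt_zero (f := fun s =>
    inner ℝ (∑ k, c s k • P.X k (β s)) (∑ k, d s k • P.X k (β s))) (fun r hr => ?_) hs
  obtain ⟨c', hc', hc0⟩ := hc r hr
  obtain ⟨d', hd', hd0⟩ := hd r hr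
  have h := hasDerivWithinAt_inner_sum hD P.smooth_X P.smooth_X
    ((hβ r hr).mdifferentiableWithinAt (by simp)) (hasDerivWithinAt_pi.1 hc')
    (hasDerivWithinAt_pi.1 hd')
  refine h.congr_deriv ?_
  erw [hc0, hd0]
  rw [inner_zero_left, inner_zero_right, add_zero]

/-- Parallel transport for an adapted connection commutes with the vertical projection. -/
lemma IsParallel.inner_ver_eq {F : Foliation E n M} (hD : IsAdapted F D)
    (hβ : ContMDiffOn 𝓘(ℝ, ℝ) 𝓘(ℝ, E) ∞ β (Icc 0 1)) {c d : ℝ → ι → ℝ}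
    (hc : P.IsParallel D β c) (hd : P.IsParallel D β d) {s : ℝ} (hs : s ∈ Icc (0 : ℝ) 1) :
    inner ℝ (F.verProj (β s) (∑ k, c s k • P.X k (β s))) (∑ k, d s k • P.X k (β s)) =
      inner ℝ (F.verProj (β 0) (∑ k, c 0 k • P.X k (β 0))) (∑ k, d 0 k • P.X k (β 0)) := by
  have hver : ∀ s, F.verProj (β s) (∑ k, c s k • P.X k (β s)) =
      ∑ k, c s k • F.ver (P.X k) (β s) := fun s => by
    simp only [map_sum, map_smul]
    rfl
  rw [hver, hver]
  refine eq_of_hasDerivWithinAt_zero (f := fun s =>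
    inner ℝ (∑ k, c s k • F.ver (P.X k) (β s)) (∑ k, d s k • P.X k (β s))) (fun r hr => ?_) hs
  obtain ⟨c', hc', hc0⟩ := hc r hr
  obtain ⟨d', hd', hd0⟩ := hd r hr
  have h := hasDerivWithinAt_inner_sum hD.metric (fun k => F.isSmoothField_ver (P.smooth_X k))
    P.smooth_X ((hβ r hr).mdifferentiableWithinAt (by simp)) (hasDerivWithinAt_pi.1 hc')
    (hasDerivWithinAt_pi.1 hd')
  refine h.congr_deriv ?_
  have h1 : ∑ k, (c' k • F.ver (P.X k) (β r) +
      c r k • D (F.ver (P.X k)) (β r) (velocity (E := E) β r)) = 0 := by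
    rw [← map_zero (F.verProj (β r)), ← hc0, map_sum]
    refine Finset.sum_congr rfl fun k _ => ?_
    rw [hD.cov_ver P (P.smooth_X k), map_add, map_smul, map_smul]
    rfl
  erw [h1, hd0]
  rw [inner_zero_left, inner_zero_right, add_zero]

end SpanningFields

end Parallel

/-! ### Horizontal lifts and anti-developments -/

section Lifts

variable {E : Type*} [NormedAddCommGroup E] [NormedSpace ℝ E] [FiniteDimensional ℝ E] {n m : ℕ}
  {M : Type*} [TopologicalSpace M] [ChartedSpace E M] [IsManifold 𝓘(ℝ, E) ∞ M]
  {ι : Type*} [Fintype ι]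
  [RiemannianBundle (fun x : M => TangentSpace 𝓘(ℝ, E) x)]

/-- The standard basis of `ℝⁿ⁺ᵐ`. -/
noncomputable abbrev stdVec (i : Fin n ⊕ Fin m) : Eucl n m := EuclideanSpace.single i 1

lemma inner_stdVec (i : Fin n ⊕ Fin m) (a : Eucl n m) : inner ℝ (stdVec i) a = a i := by
  simp [stdVec, EuclideanSpace.inner_single_left]

lemma sum_smul_stdVec (a : Eucl n m) : ∑ i, a i • stdVec i = a := by
  refine (Finset.sum_congr rfl fun i _ => ?_).trans ((EuclideanSpace.basisFun _ ℝ).sum_repr a)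
  simp

lemma hasDerivWithinAt_dot_apply {w : ℝ → Eucl n m} (hw : ContDiffOn ℝ ∞ w (Icc 0 1)) {s : ℝ}
    (hs : s ∈ Icc (0 : ℝ) 1) (i : Fin n ⊕ Fin m) :
    HasDerivWithinAt (fun r => w r i) (dot w s i) (Icc 0 1) s :=
  (EuclideanSpace.proj i : Eucl n m →L[ℝ] ℝ).hasFDerivAt.comp_hasDerivWithinAt s
    ((hw.differentiableOn (by simp)) s hs).hasDerivWithinAt

lemma OFrame.sum_smul_iso (u : OFrame E n m M) (a : Eucl n m) :
    ∑ i, a i • u.iso (stdVec i) = u.iso a := by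
  conv_rhs => rw [← sum_smul_stdVec a]
  simp only [map_sum, map_smul]

lemma OFrame.iso_symm_apply (u : OFrame E n m M) (a : TangentSpace 𝓘(ℝ, E) u.pt)
    (i : Fin n ⊕ Fin m) : u.iso.symm a i = inner ℝ (u.iso (stdVec i)) a := by
  rw [← inner_stdVec, ← u.iso.inner_map_map, u.iso.apply_symm_apply]

namespace SpanningFields

variable (P : SpanningFields E M ι) (D : Connection E M)

/-- The linear differential equation `c' = - θ(a) c`, `w' = ∑ cᵏ ⟨Xₖ, a⟩` satisfied, for `a` the
velocity of a path, by the coefficients `c` of a parallel vector `U = ∑ cᵏ Xₖ` and by the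
corresponding component `w = ∫ ⟨U, a⟩` of the anti-development. -/
noncomputable def system (x : M) (a : TangentSpace 𝓘(ℝ, E) x) :
    ((ι → ℝ) × ℝ) →L[ℝ] ((ι → ℝ) × ℝ) :=
  LinearMap.toContinuousLinearMap
    { toFun := fun y => (fun k => -∑ j, P.connForm D k j x a * y.1 j,
        ∑ k, innerForm (P.X k) x a * y.1 k)
      map_add' := fun y z => by
        ext <;> simp [mul_add, Finset.sum_add_distrib]
        ring
      map_smul' := fun r y => by
        ext <;> simp [Finset.mul_sum, mul_left_comm] }

lemma system_apply (x : M) (a : TangentSpace 𝓘(ℝ, E) x) (y : (ι → ℝ) × ℝ) :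
    P.system D x a y = (fun k => -∑ j, P.connForm D k j x a * y.1 j,
      ∑ k, innerForm (P.X k) x a * y.1 k) := rfl

variable {D}

lemma contDiffOn_system [IsContMDiffRiemannianBundle 𝓘(ℝ, E) ∞ E
      (fun x : M => TangentSpace 𝓘(ℝ, E) x)]
    (hD : CovariantDerivative.ContMDiffCovariantDerivative D ∞)
    {G : Type*} [NormedAddCommGroup G] [NormedSpace ℝ G]
    {f : G → TangentBundle 𝓘(ℝ, E) M} {S : Set G}
    (hf : ContMDiffOn 𝓘(ℝ, G) 𝓘(ℝ, E).tangent ∞ f S) :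
    ContDiffOn ℝ ∞ (fun q => P.system D (f q).1 (f q).2) S := by
  rw [contDiffOn_clm_apply]
  intro y
  simp only [system_apply]
  refine ContDiffOn.prodMk ?_ ?_
  · refine contDiffOn_pi.2 fun k => (ContDiffOn.sum fun j _ => ?_).neg
    exact ((P.isSmoothForm_connForm hD k j).contDiffOn_comp hf).mul contDiffOn_const
  · refine ContDiffOn.sum fun k _ => ?_
    exact ((isSmoothForm_innerForm (P.smooth_X k)).contDiffOn_comp hf).mul contDiffOn_const

variable (D) in
/-- The solutions `y i = (cᵢ, wᵢ)` of the linear system along the path `β` for which `∑ cᵢᵏ Xₖ` is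
the parallel field starting at the vector `u₀ eᵢ`. -/
structure IsSolution (u₀ : OFrame E n m M) (β : ℝ → M)
    (y : Fin n ⊕ Fin m → ℝ → (ι → ℝ) × ℝ) : Prop where
  start : ∀ i, y i 0 = (fun k => P.ξ k u₀.pt (u₀.iso (stdVec i)), 0)
  deriv : ∀ i, ∀ s ∈ Icc (0 : ℝ) 1, HasDerivWithinAt (y i)
    (P.system D (β s) (velocity (E := E) β s) (y i s)) (Icc 0 1) s

variable [IsContMDiffRiemannianBundle 𝓘(ℝ, E) ∞ E (fun x : M => TangentSpace 𝓘(ℝ, E) x)]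
variable {P} {u₀ : OFrame E n m M} {β : ℝ → M} {y : Fin n ⊕ Fin m → ℝ → (ι → ℝ) × ℝ}

variable (P) in
lemma exists_isSolution (hD : CovariantDerivative.ContMDiffCovariantDerivative D ∞)
    (u₀ : OFrame E n m M) (hβ : ContMDiffOn 𝓘(ℝ, ℝ) 𝓘(ℝ, E) ∞ β (Icc 0 1)) :
    ∃ y, P.IsSolution D u₀ β y := by
  choose y hy using fun i : Fin n ⊕ Fin m => exists_solution_linear
    (P.contDiffOn_system hD (contMDiffOn_velocity hβ)).continuousOn
    ((fun k => P.ξ k u₀.pt (u₀.iso (stdVec i)), (0 : ℝ)) : (ι → ℝ) × ℝ)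
  exact ⟨y, fun i => (hy i).1, fun i => (hy i).2⟩

lemma IsSolution.contDiffOn (hD : CovariantDerivative.ContMDiffCovariantDerivative D ∞)
    (hβ : ContMDiffOn 𝓘(ℝ, ℝ) 𝓘(ℝ, E) ∞ β (Icc 0 1)) (hy : P.IsSolution D u₀ β y)
    (i : Fin n ⊕ Fin m) : ContDiffOn ℝ ∞ (y i) (Icc 0 1) := by
  refine ODE.contDiffOn_enat_Icc_of_hasDerivWithinAt (n := ⊤) (u := univ)
    (f := fun s z => P.system D (β s) (velocity (E := E) β s) z) ?_ (hy.deriv i)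
    (fun _ _ => mem_univ _)
  have h1 := (P.contDiffOn_system hD (contMDiffOn_velocity hβ)).comp
    (contDiff_fst (𝕜 := ℝ) (F := (ι → ℝ) × ℝ)).contDiffOn
    (s := Icc (0 : ℝ) 1 ×ˢ univ) (fun p hp => hp.1)
  exact h1.clm_apply contDiff_snd.contDiffOn

lemma IsSolution.isParallel (hy : P.IsSolution D u₀ β y) (i : Fin n ⊕ Fin m) :
    P.IsParallel D β (fun s => (y i s).1) :=
  isParallel_of_hasDerivWithinAt fun s hs => (hy.deriv i s hs).fst

lemma IsSolution.sum_start (hy : P.IsSolution D u₀ β y) (i : Fin n ⊕ Fin m) :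
    ∑ k, (y i 0).1 k • P.X k u₀.pt = u₀.iso (stdVec i) := by
  rw [hy.start i]
  exact P.sum_eq _ _

lemma IsSolution.inner_eq
    (hD : CovariantDerivative.IsMetricCompatible (V := (TangentSpace 𝓘(ℝ, E) : M → Type _)) D)
    (hβ : ContMDiffOn 𝓘(ℝ, ℝ) 𝓘(ℝ, E) ∞ β (Icc 0 1)) (hβ0 : β 0 = u₀.pt)
    (hy : P.IsSolution D u₀ β y) {s : ℝ} (hs : s ∈ Icc (0 : ℝ) 1) (i j : Fin n ⊕ Fin m) :
    inner ℝ (∑ k, (y i s).1 k • P.X k (β s)) (∑ k, (y j s).1 k • P.X k (β s)) =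
      if i = j then (1 : ℝ) else 0 := by
  rw [IsParallel.inner_eq hD hβ (hy.isParallel i) (hy.isParallel j) hs, hβ0, hy.sum_start,
    hy.sum_start, u₀.iso.inner_map_map, inner_stdVec]
  simp [stdVec]

/-- The frame given by an orthonormal family of tangent vectors. -/
lemma _root_.FoliatedPaths.OFrame.exists_iso (u₀ : OFrame E n m M) {x : M}
    {U : Fin n ⊕ Fin m → TangentSpace 𝓘(ℝ, E) x} (hU : Orthonormal ℝ U) :
    ∃ f : Eucl n m ≃ₗᵢ[ℝ] TangentSpace 𝓘(ℝ, E) x, ∀ i, f (stdVec i) = U i := by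
  have hfin : Fintype.card (Fin n ⊕ Fin m) = Module.finrank ℝ (TangentSpace 𝓘(ℝ, E) x) := by
    have h1 := u₀.iso.toLinearEquiv.finrank_eq
    rw [finrank_euclideanSpace] at h1
    exact h1
  let b := OrthonormalBasis.mk hU (hU.linearIndependent.span_eq_top_of_card_eq_finrank' hfin).ge
  refine ⟨b.repr.symm, fun i => ?_⟩
  rw [b.repr_symm_single]
  simp [b]

lemma _root_.FoliatedPaths.OFrame.eq_of_iso_eq {u u' : OFrame E n m M}
    (h : ∀ a, (⟨u.pt, u.iso a⟩ : TangentBundle 𝓘(ℝ, E) M) = ⟨u'.pt, u'.iso a⟩) : u = u' := by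
  obtain ⟨x, f⟩ := u
  obtain ⟨x', f'⟩ := u'
  obtain rfl : x = x' := congrArg TotalSpace.proj (h 0)
  congr 1
  ext a
  exact eq_of_heq (TotalSpace.mk.inj (h a)).2

variable (P) in
/-- Two frames with the same inner products of their vectors are equal; the vectors of the second
frame are transported to the base point of the first by means of the spanning fields. -/
lemma frame_eq_of_inner_eq {u u' : OFrame E n m M} (hpt : u.pt = u'.pt)
    (h : ∀ a b, inner ℝ (u.iso a) (∑ k, P.ξ k u'.pt (u'.iso b) • P.X k u.pt) = inner ℝ a b) :
    u = u' := by
  obtain ⟨x, f⟩ := u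
  obtain ⟨x', f'⟩ := u'
  obtain rfl : x = x' := hpt
  simp only [P.sum_eq] at h
  congr 1
  ext a
  rw [← sub_eq_zero, ← inner_self_eq_zero (𝕜 := ℝ), inner_sub_left, inner_sub_right,
    inner_sub_right, h, f.inner_map_map, f'.inner_map_map,
    real_inner_comm (f a) (f' a), h]
  ring

variable (P) in
/-- The solutions of the linear system yield a lift. -/
lemma IsSolution.exists_isLift
    (hDs : CovariantDerivative.ContMDiffCovariantDerivative D ∞)
    (hD : CovariantDerivative.IsMetricCompatible (V := (TangentSpace 𝓘(ℝ, E) : M → Type _)) D)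
    (hβ : ContMDiffOn 𝓘(ℝ, ℝ) 𝓘(ℝ, E) ∞ β (Icc 0 1)) (hβ0 : β 0 = u₀.pt)
    (hy : P.IsSolution D u₀ β y) :
    ∃ u, IsLift D u₀ u ∧ ∀ s ∈ Icc (0 : ℝ) 1, (u s).pt = β s ∧
      ∀ i, (u s).iso (stdVec i) = ∑ k, (y i s).1 k • P.X k (u s).pt := by
  have hfr : ∀ s ∈ Icc (0 : ℝ) 1, ∃ f : Eucl n m ≃ₗᵢ[ℝ] TangentSpace 𝓘(ℝ, E) (β s),
      ∀ i, f (stdVec i) = ∑ k, (y i s).1 k • P.X k (β s) := fun s hs =>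
    u₀.exists_iso (orthonormal_iff_ite.2 fun i j => hy.inner_eq hD hβ hβ0 hs i j)
  choose f hf using hfr
  classical
  let u : ℝ → OFrame E n m M := fun s => if hs : s ∈ Icc (0 : ℝ) 1 then ⟨β s, f s hs⟩ else u₀
  have hu : ∀ s (hs : s ∈ Icc (0 : ℝ) 1), u s = ⟨β s, f s hs⟩ := fun s hs => dif_pos hs
  have hspec : ∀ s ∈ Icc (0 : ℝ) 1, (u s).pt = β s ∧
      ∀ i, (u s).iso (stdVec i) = ∑ k, (y i s).1 k • P.X k (u s).pt := fun s hs => by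
    rw [hu s hs]
    exact ⟨rfl, hf s hs⟩
  have hiso : ∀ a, ∀ s ∈ Icc (0 : ℝ) 1,
      (u s).iso a = ∑ k, (∑ i, a i * (y i s).1 k) • P.X k (u s).pt := fun a s hs => by
    rw [← OFrame.sum_smul_iso]
    simp only [(hspec s hs).2, Finset.smul_sum, smul_smul, Finset.sum_smul]
    rw [Finset.sum_comm]
  have hptβ : EqOn β (fun s => (u s).pt) (Icc 0 1) := fun s hs => (hspec s hs).1.symm
  have hpt : ContMDiffOn 𝓘(ℝ, ℝ) 𝓘(ℝ, E) ∞ (fun s => (u s).pt) (Icc 0 1) :=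
    hβ.congr fun s hs => (hspec s hs).1
  refine ⟨u, ⟨fun a => ?_, ?_, fun a s hs => ?_⟩, hspec⟩
  · have h1 := P.contMDiffOn_sum hpt (c := fun k s => ∑ i, a i * (y i s).1 k) fun k =>
      ContDiffOn.sum fun i _ => contDiffOn_const.mul
        (contDiffOn_pi.1 (hy.contDiffOn hDs hβ i).fst k)
    refine h1.congr fun s hs => ?_
    rw [hiso a s hs]
  · have h0 : (0 : ℝ) ∈ Icc (0 : ℝ) 1 := by simp
    have hpt0 : (u 0).pt = u₀.pt := (hspec 0 h0).1.trans hβ0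
    refine OFrame.eq_of_iso_eq fun a => ?_
    rw [hiso a 0 h0, hpt0]
    congr 1
    rw [← OFrame.sum_smul_iso]
    simp only [← hy.sum_start, Finset.smul_sum, smul_smul, Finset.sum_smul]
    rw [Finset.sum_comm]
  · obtain ⟨c', hc', h0⟩ := (IsParallel.sum (fun i => hy.isParallel i) a).congr hptβ s hs
    rw [covDerivAlong_sum D P.smooth_X hs ((hpt s hs).mdifferentiableWithinAt (by simp))
      (fun r hr => hiso a r hr) (hasDerivWithinAt_pi.1 hc')]
    exact h0

end SpanningFields

variable [IsContMDiffRiemannianBundle 𝓘(ℝ, E) ∞ E (fun x : M => TangentSpace 𝓘(ℝ, E) x)]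
  {D : Connection E M} {u₀ : OFrame E n m M} {u u' : ℝ → OFrame E n m M} {β : ℝ → M}

lemma IsLift.contMDiffOn_pt (hu : IsLift D u₀ u) :
    ContMDiffOn 𝓘(ℝ, ℝ) 𝓘(ℝ, E) ∞ (fun s => (u s).pt) (Icc 0 1) := fun s hs =>
  ((Bundle.contMDiffWithinAt_totalSpace (F := E)
    (E := (TangentSpace 𝓘(ℝ, E) : M → Type _))).1 (hu.smooth 0 s hs)).1

lemma IsLift.isParallel (hu : IsLift D u₀ u) (P : SpanningFields E M ι) (a : Eucl n m) :
    P.IsParallel D (fun s => (u s).pt) (fun s k => P.ξ k (u s).pt ((u s).iso a)) := by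
  intro s hs
  have hc : ∀ k, HasDerivWithinAt (fun s => P.ξ k (u s).pt ((u s).iso a))
      (derivWithin (fun s => P.ξ k (u s).pt ((u s).iso a)) (Icc 0 1) s) (Icc 0 1) s := fun k =>
    (((P.smooth_ξ k).contDiffOn_comp (hu.smooth a)).differentiableOn (by simp) s
      hs).hasDerivWithinAt
  refine ⟨_, hasDerivWithinAt_pi.2 hc, ?_⟩
  have h1 := covDerivAlong_sum D P.smooth_X (w := fun s => (u s).iso a) hs
    ((hu.contMDiffOn_pt s hs).mdifferentiableWithinAt (by simp))
    (fun r _ => (P.sum_eq _ _).symm) hc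
  rw [hu.parallel a s hs] at h1
  exact h1.symm

/-- Lifts are unique: the inner product of two parallel fields is constant. -/
lemma IsLift.eqOn (P : SpanningFields E M ι)
    (hD : CovariantDerivative.IsMetricCompatible (V := (TangentSpace 𝓘(ℝ, E) : M → Type _)) D)
    (hu : IsLift D u₀ u) (hu' : IsLift D u₀ u')
    (h : ∀ s ∈ Icc (0 : ℝ) 1, (u s).pt = (u' s).pt) : EqOn u u' (Icc 0 1) := by
  intro s hs
  refine P.frame_eq_of_inner_eq (h s hs) fun a b => ?_
  have h1 := SpanningFields.IsParallel.inner_eq hD hu.contMDiffOn_pt (hu.isParallel P a)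
    ((hu'.isParallel P b).congr fun r hr => (h r hr).symm) hs
  simp only [P.sum_eq] at h1
  rw [h1, hu.start, hu'.start, P.sum_eq, u₀.iso.inner_map_map]

/-- Parallel frames of an adapted connection respect the horizontal and vertical bundles. -/
lemma IsLift.isHorFrame (P : SpanningFields E M ι) {F : Foliation E n M} (hD : IsAdapted F D)
    (hu₀ : F.IsHorFrame u₀) (hu : IsLift D u₀ u) {s : ℝ} (hs : s ∈ Icc (0 : ℝ) 1) :
    F.IsHorFrame (u s) := by
  have h1 : ∀ a b, inner ℝ (F.verProj (u s).pt ((u s).iso a)) ((u s).iso b) =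
      inner ℝ (F.verProj u₀.pt (u₀.iso a)) (u₀.iso b) := fun a b => by
    have h2 := SpanningFields.IsParallel.inner_ver_eq hD hu.contMDiffOn_pt (hu.isParallel P a)
      (hu.isParallel P b) hs
    simp only [P.sum_eq] at h2
    rw [h2, hu.start]
  refine ⟨fun a ha => ?_, fun a ha => ?_⟩
  · refine (Submodule.starProjection_apply_eq_zero_iff _).1
      (ext_inner_right ℝ (fun b => ?_) : F.verProj (u s).pt ((u s).iso a) = 0)
    obtain ⟨b, rfl⟩ := (u s).iso.surjective b
    rw [h1, Foliation.verProj_of_mem_horizontal (hu₀.1 a ha), inner_zero_left, inner_zero_left]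
  · refine Submodule.starProjection_eq_self_iff.1
      (ext_inner_right ℝ (fun b => ?_) : F.verProj (u s).pt ((u s).iso a) = (u s).iso a)
    obtain ⟨b, rfl⟩ := (u s).iso.surjective b
    rw [h1, Foliation.verProj_of_mem_vertical (hu₀.2 a ha), u₀.iso.inner_map_map,
      (u s).iso.inner_map_map]

lemma IsAntiDev.dot_eq (P : SpanningFields E M ι)
    (hD : CovariantDerivative.IsMetricCompatible (V := (TangentSpace 𝓘(ℝ, E) : M → Type _)) D)
    {w : ℝ → Eucl n m} (hw : IsAntiDev D u₀ β w) (hu : IsLift D u₀ u)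
    (hpt : ∀ s ∈ Icc (0 : ℝ) 1, (u s).pt = β s) {s : ℝ} (hs : s ∈ Icc (0 : ℝ) 1) :
    (u s).iso (dot w s) = velocity (E := E) (fun r => (u r).pt) s := by
  obtain ⟨-, u', ⟨hu', hroll⟩, hpt'⟩ := hw
  have h1 := IsLift.eqOn P hD hu' hu (fun r hr => (hpt' r hr).trans (hpt r hr).symm)
  have h2 := velocity_congr (E := E) (β := fun r => (u' r).pt) (β' := fun r => (u r).pt)
    (fun r hr => congrArg OFrame.pt (h1 hr)) hs
  rw [hroll s hs] at h2
  have key : ∀ {v v' : OFrame E n m M} (_ : v = v') (b : TangentSpace 𝓘(ℝ, E) v'.pt),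
      (⟨v.pt, v.iso (dot w s)⟩ : TangentBundle 𝓘(ℝ, E) M) = ⟨v'.pt, b⟩ →
      v'.iso (dot w s) = b := by
    rintro v v' rfl b hb
    exact eq_of_heq (TotalSpace.mk.inj hb).2
  exact key (h1 hs) _ h2

lemma IsAntiDev.eqOn (P : SpanningFields E M ι)
    (hD : CovariantDerivative.IsMetricCompatible (V := (TangentSpace 𝓘(ℝ, E) : M → Type _)) D)
    {w w' : ℝ → Eucl n m} (hw : IsAntiDev D u₀ β w) (hw' : IsAntiDev D u₀ β w') :
    EqOn w w' (Icc 0 1) := by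
  obtain ⟨u, ⟨hu, -⟩, hpt⟩ := hw.2
  refine eq_of_derivWithin_eq (hw.1.1.differentiableOn (by simp))
    (hw'.1.1.differentiableOn (by simp)) (fun s hs => ?_) (hw.1.2.trans hw'.1.2.symm)
  refine (u s).iso.injective ?_
  exact (hw.dot_eq P hD hu hpt (Ico_subset_Icc_self hs)).trans
    (hw'.dot_eq P hD hu hpt (Ico_subset_Icc_self hs)).symm

lemma dLift_spec (h : ∃ u, IsLift D u₀ u ∧ ∀ s ∈ Icc (0 : ℝ) 1, (u s).pt = β s) :
    IsLift D u₀ (dLift D u₀ β) ∧ ∀ s ∈ Icc (0 : ℝ) 1, (dLift D u₀ β s).pt = β s := by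
  rw [dLift, dif_pos h]
  exact h.choose_spec

lemma antiDev_spec (h : ∃ w, IsAntiDev D u₀ β w) : IsAntiDev D u₀ β (antiDev D u₀ β) := by
  rw [antiDev, dif_pos h]
  exact h.choose_spec

namespace SpanningFields

variable {P : SpanningFields E M ι} {y : Fin n ⊕ Fin m → ℝ → (ι → ℝ) × ℝ}

lemma IsSolution.isAntiDev
    (hDs : CovariantDerivative.ContMDiffCovariantDerivative D ∞)
    (hβ : ContMDiffOn 𝓘(ℝ, ℝ) 𝓘(ℝ, E) ∞ β (Icc 0 1)) (hy : P.IsSolution D u₀ β y)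
    (hu : IsLift D u₀ u) (hpt : ∀ s ∈ Icc (0 : ℝ) 1, (u s).pt = β s)
    (hiso : ∀ s ∈ Icc (0 : ℝ) 1,
      ∀ i, (u s).iso (stdVec i) = ∑ k, (y i s).1 k • P.X k (u s).pt) :
    IsAntiDev D u₀ β (fun s => WithLp.toLp 2 (fun i => (y i s).2)) := by
  have hsm : ContDiffOn ℝ ∞ (fun s => (WithLp.toLp 2 (fun i => (y i s).2) : Eucl n m))
      (Icc 0 1) :=
    contDiffOn_euclidean.2 fun i => (hy.contDiffOn hDs hβ i).snd
  refine ⟨⟨hsm, ?_⟩, u, ⟨hu, fun s hs => ?_⟩, hpt⟩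
  · ext i
    simp [hy.start i]
  · rw [← LinearIsometryEquiv.symm_apply_eq]
    ext i
    have h1 := (uniqueDiffOn_Icc one_pos s hs).eq_deriv _
      (hasDerivWithinAt_dot_apply hsm hs i) (hy.deriv i s hs).snd
    have h2 : ∀ p q : TangentBundle 𝓘(ℝ, E) M, p = q →
        ∑ k, innerForm (P.X k) p.1 p.2 * (y i s).1 k =
        inner ℝ (∑ k, (y i s).1 k • P.X k q.1) q.2 := by
      rintro p q rfl
      rw [sum_inner]
      refine Finset.sum_congr rfl fun k _ => ?_
      rw [real_inner_smul_left, mul_comm]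
      rfl
    rw [OFrame.iso_symm_apply, hiso s hs, h1]
    exact (h2 _ _ (velocity_congr (fun r hr => (hpt r hr).symm) hs)).symm

/-- The lift and the anti-development of a path, in terms of the solutions of the linear system. -/
theorem IsSolution.dLift_antiDev
    (hDs : CovariantDerivative.ContMDiffCovariantDerivative D ∞)
    (hD : CovariantDerivative.IsMetricCompatible (V := (TangentSpace 𝓘(ℝ, E) : M → Type _)) D)
    (hβ : ContMDiffOn 𝓘(ℝ, ℝ) 𝓘(ℝ, E) ∞ β (Icc 0 1)) (hβ0 : β 0 = u₀.pt)
    (hy : P.IsSolution D u₀ β y) :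
    IsLift D u₀ (dLift D u₀ β) ∧ (∀ s ∈ Icc (0 : ℝ) 1, (dLift D u₀ β s).pt = β s) ∧
    (∀ s ∈ Icc (0 : ℝ) 1, ∀ i, (dLift D u₀ β s).iso (stdVec i) =
      ∑ k, (y i s).1 k • P.X k (dLift D u₀ β s).pt) ∧
    IsAntiDev D u₀ β (antiDev D u₀ β) ∧
    ∀ s ∈ Icc (0 : ℝ) 1, ∀ i, antiDev D u₀ β s i = (y i s).2 := by
  obtain ⟨u, hu, hus⟩ := hy.exists_isLift P hDs hD hβ hβ0
  obtain ⟨hd, hdpt⟩ := dLift_spec ⟨u, hu, fun s hs => (hus s hs).1⟩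
  have heq := IsLift.eqOn P hD hd hu (fun s hs => (hdpt s hs).trans (hus s hs).1.symm)
  have hA := hy.isAntiDev hDs hβ hu (fun s hs => (hus s hs).1) (fun s hs => (hus s hs).2)
  have hA' := antiDev_spec ⟨_, hA⟩
  refine ⟨hd, hdpt, fun s hs i => ?_, hA', fun s hs i => ?_⟩
  · rw [heq hs]
    exact (hus s hs).2 i
  · rw [hA'.eqOn P hD hA hs]

end SpanningFields

end Lifts

/-! ### Horizontal paths -/

section HorPaths

variable {E : Type*} [NormedAddCommGroup E] [NormedSpace ℝ E] [FiniteDimensional ℝ E] {n m : ℕ}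
  {M : Type*} [TopologicalSpace M] [ChartedSpace E M] [IsManifold 𝓘(ℝ, E) ∞ M]
  {ι : Type*} [Fintype ι]
  [RiemannianBundle (fun x : M => TangentSpace 𝓘(ℝ, E) x)]
  [IsContMDiffRiemannianBundle 𝓘(ℝ, E) ∞ E (fun x : M => TangentSpace 𝓘(ℝ, E) x)]
  {F : Foliation E n M} {D D' : Connection E M} {u₀ : OFrame E n m M}
  {u : ℝ → OFrame E n m M} {β : ℝ → M}

lemma Foliation.IsHorFrame.stdVec_inl {u : OFrame E n m M} (hu : F.IsHorFrame u) (i : Fin n) :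
    u.iso (stdVec (Sum.inl i)) ∈ F.horizontal u.pt :=
  hu.1 _ fun j => by simp [stdVec]

lemma Foliation.IsHorFrame.stdVec_inr {u : OFrame E n m M} (hu : F.IsHorFrame u) (j : Fin m) :
    u.iso (stdVec (Sum.inr j)) ∈ F.vertical u.pt :=
  hu.2 _ fun i => by simp [stdVec]

lemma Foliation.IsHorFrame.isHorVec_of_mem {u : OFrame E n m M} (hu : F.IsHorFrame u)
    {a : Eucl n m} (ha : u.iso a ∈ F.horizontal u.pt) : IsHorVec a := fun j => by
  rw [← u.iso.symm_apply_apply a, OFrame.iso_symm_apply, real_inner_comm]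
  exact Foliation.inner_horizontal_vertical ha (hu.stdVec_inr j)

lemma Foliation.IsHorPath.congr {β' : ℝ → M} (hβ : F.IsHorPath β) (h : EqOn β β' (Icc 0 1)) :
    F.IsHorPath β' := by
  intro s hs
  have key : ∀ {x y : M} {a : TangentSpace 𝓘(ℝ, E) x} {b : TangentSpace 𝓘(ℝ, E) y},
      (⟨x, a⟩ : TangentBundle 𝓘(ℝ, E) M) = ⟨y, b⟩ → a ∈ F.horizontal x → b ∈ F.horizontal y := by
    intro x y a b h ha
    obtain rfl : x = y := congrArg TotalSpace.proj h
    rwa [← eq_of_heq (TotalSpace.mk.inj h).2]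
  exact key (velocity_congr (E := E) h hs) (hβ s hs)

lemma velocity_mem_horizontal (hβ : F.IsHorPath β)
    (hpt : ∀ s ∈ Icc (0 : ℝ) 1, (u s).pt = β s) {s : ℝ} (hs : s ∈ Icc (0 : ℝ) 1) :
    velocity (E := E) (fun r => (u r).pt) s ∈ F.horizontal (u s).pt :=
  hβ.congr (β' := fun r => (u r).pt) (fun r hr => (hpt r hr).symm) s hs

lemma IsAntiDev.isHorVec_dot (P : SpanningFields E M ι) (hD : IsAdapted F D)
    (hu₀ : F.IsHorFrame u₀) (hβ : F.IsHorPath β) {w : ℝ → Eucl n m} (hw : IsAntiDev D u₀ β w)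
    {s : ℝ} (hs : s ∈ Icc (0 : ℝ) 1) : IsHorVec (dot w s) := by
  obtain ⟨u, ⟨hu, -⟩, hpt⟩ := hw.2
  refine (hu.isHorFrame P hD hu₀ hs).isHorVec_of_mem ?_
  rw [hw.dot_eq P hD.metric hu hpt hs]
  exact velocity_mem_horizontal hβ hpt hs

/-- The anti-development of a horizontal path takes values in `ℝⁿ`. -/
lemma IsAntiDev.isHorVec (P : SpanningFields E M ι) (hD : IsAdapted F D)
    (hu₀ : F.IsHorFrame u₀) (hβ : F.IsHorPath β) {w : ℝ → Eucl n m} (hw : IsAntiDev D u₀ β w)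
    {s : ℝ} (hs : s ∈ Icc (0 : ℝ) 1) : IsHorVec (w s) := by
  intro j
  have h1 := eq_of_hasDerivWithinAt_zero (f := fun r => w r (Sum.inr j))
    (fun r hr => by
      have := hasDerivWithinAt_dot_apply hw.1.1 hr (Sum.inr j)
      rwa [hw.isHorVec_dot P hD hu₀ hβ hr j] at this) hs
  rw [h1, hw.1.2]
  rfl

lemma horAntiDev_spec (P : SpanningFields E M ι) (hD : IsAdapted F D)
    (hu₀ : F.IsHorFrame u₀) (hβ : F.IsHorPath β) (h : ∃ w, IsAntiDev D u₀ β w) :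
    IsAntiDev D u₀ β (horAntiDev D u₀ β) := by
  obtain ⟨w, hw⟩ := h
  have h' : ∃ w, IsAntiDev D u₀ β w ∧ ∀ s ∈ Icc (0 : ℝ) 1, IsHorVec (w s) :=
    ⟨w, hw, fun s hs => hw.isHorVec P hD hu₀ hβ hs⟩
  rw [horAntiDev, dif_pos h']
  exact h'.choose_spec.1

lemma covDerivAlong_eq_of_mem_horizontal (P : SpanningFields E M ι) (hD : IsAdapted F D)
    (hD' : IsAdapted F D') {W : ℝ → TangentBundle 𝓘(ℝ, E) M} {s : ℝ}
    (h : velocity (E := E) (fun r => (W r).proj) s ∈ F.horizontal (W s).proj) :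
    covDerivAlong D W s = covDerivAlong D' W s := by
  unfold covDerivAlong
  simp only
  congr 1
  refine hD.cov_eq_cov hD' P ?_ h
  refine ((contMDiffAt_symmL (W s).proj (trivializationAt E (TangentSpace 𝓘(ℝ, E) : M → Type _)
    (W s).proj (W s)).2).mdifferentiableAt
    (by simp)).congr_of_eventuallyEq ?_
  filter_upwards [(trivializationAt E (TangentSpace 𝓘(ℝ, E) : M → Type _)
    (W s).proj).open_baseSet.mem_nhds (mem_baseSet_trivializationAt _ _ _)] with y hy
  rw [Trivialization.symmL_apply _ hy]

open Classical in
lemma dite_choose_congr {α : Type*} {p q : α → Prop} (d : α) (h : p = q) :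
    (if h : ∃ a, p a then h.choose else d) = if h : ∃ a, q a then h.choose else d := by
  subst h
  rfl

/-- Adapted connections agree in horizontal directions, hence so do their lifts of horizontal
paths. -/
lemma isLift_iff_of_isHorPath (P : SpanningFields E M ι) (hD : IsAdapted F D)
    (hD' : IsAdapted F D') (hβ : F.IsHorPath β) (hpt : ∀ s ∈ Icc (0 : ℝ) 1, (u s).pt = β s) :
    IsLift D u₀ u ↔ IsLift D' u₀ u := by
  have h : ∀ a, ∀ s ∈ Icc (0 : ℝ) 1,
      covDerivAlong D (fun r => (⟨(u r).pt, (u r).iso a⟩ : TangentBundle 𝓘(ℝ, E) M)) s =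
      covDerivAlong D' (fun r => (⟨(u r).pt, (u r).iso a⟩ : TangentBundle 𝓘(ℝ, E) M)) s :=
    fun a s hs => covDerivAlong_eq_of_mem_horizontal P hD hD'
      (velocity_mem_horizontal hβ hpt hs)
  exact ⟨fun hu => ⟨hu.smooth, hu.start, fun a s hs => (h a s hs).symm.trans (hu.parallel a s hs)⟩,
    fun hu => ⟨hu.smooth, hu.start, fun a s hs => (h a s hs).trans (hu.parallel a s hs)⟩⟩

lemma dLift_eq_of_isHorPath (P : SpanningFields E M ι) (hD : IsAdapted F D)
    (hD' : IsAdapted F D') (hβ : F.IsHorPath β) : dLift D u₀ β = dLift D' u₀ β := by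
  have h : (fun u => IsLift D u₀ u ∧ ∀ s ∈ Icc (0 : ℝ) 1, (u s).pt = β s) =
      fun u => IsLift D' u₀ u ∧ ∀ s ∈ Icc (0 : ℝ) 1, (u s).pt = β s := by
    ext u
    exact and_congr_left fun hu => isLift_iff_of_isHorPath P hD hD' hβ hu
  exact dite_choose_congr _ h

lemma horAntiDev_eq_of_isHorPath (P : SpanningFields E M ι) (hD : IsAdapted F D)
    (hD' : IsAdapted F D') (hβ : F.IsHorPath β) : horAntiDev D u₀ β = horAntiDev D' u₀ β := by
  have h : (fun w => IsAntiDev D u₀ β w ∧ ∀ s ∈ Icc (0 : ℝ) 1, IsHorVec (w s)) =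
      fun w => IsAntiDev D' u₀ β w ∧ ∀ s ∈ Icc (0 : ℝ) 1, IsHorVec (w s) := by
    ext w
    refine and_congr_left fun _ => and_congr_right fun _ => exists_congr fun u =>
      and_congr_left fun hu => and_congr_left fun _ => ?_
    exact isLift_iff_of_isHorPath P hD hD' hβ hu
  exact dite_choose_congr _ h

lemma bottVariation_eq_of_isHorPath (P : SpanningFields E M ι) (hD : IsAdapted F D)
    (hD' : IsAdapted F D') (hβ : F.IsHorPath β) (v : ℝ → Eucl n m) (s : ℝ) :
    F.bottVariation D u₀ v β s = F.bottVariation D' u₀ v β s := by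
  unfold Foliation.bottVariation
  rw [dLift_eq_of_isHorPath P hD hD' hβ, horAntiDev_eq_of_isHorPath P hD hD' hβ]

/-- The right-hand side of the variation formula depends only on the restriction of the path to
`[0, 1]`. -/
lemma hsuVariation_congr {β' : ℝ → M} (h : EqOn β β' (Icc 0 1)) (v : ℝ → Eucl n m) (s : ℝ) :
    hsuVariation D u₀ v β s = hsuVariation D u₀ v β' s ∧
      F.bottVariation D u₀ v β s = F.bottVariation D u₀ v β' s := by
  have h0 : ∀ u : ℝ → OFrame E n m M, (∀ s ∈ Icc (0 : ℝ) 1, (u s).pt = β s) ↔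
      ∀ s ∈ Icc (0 : ℝ) 1, (u s).pt = β' s := fun u =>
    forall₂_congr fun s hs => by rw [h hs]
  have h1 : dLift D u₀ β = dLift D u₀ β' :=
    dite_choose_congr _ (funext fun u => by rw [h0])
  have h2 : horAntiDev D u₀ β = horAntiDev D u₀ β' :=
    dite_choose_congr _ (funext fun w => by simp only [IsAntiDev, h0])
  simp only [hsuVariation, Foliation.bottVariation, h1, h2, and_self]

end HorPaths

/-! ### Variations of paths and of solutions of the linear system -/

section Variations

variable {E : Type*} [NormedAddCommGroup E] [NormedSpace ℝ E] [FiniteDimensional ℝ E] {n m : ℕ}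
  {M : Type*} [TopologicalSpace M] [ChartedSpace E M] [IsManifold 𝓘(ℝ, E) ∞ M]
  {ι : Type*} [Fintype ι]

/-- The parameter space `ℝ × [0, 1]` of the variations of a path. -/
abbrev strip : Set (ℝ × ℝ) := univ ×ˢ Icc 0 1

lemma uniqueDiffOn_strip : UniqueDiffOn ℝ strip :=
  uniqueDiffOn_univ.prod (uniqueDiffOn_Icc one_pos)

lemma mk_mem_strip {t s : ℝ} (hs : s ∈ Icc (0 : ℝ) 1) : (t, s) ∈ strip := ⟨mem_univ _, hs⟩

lemma strip_mem_nhds {t s : ℝ} (hs : s ∈ Ioo (0 : ℝ) 1) : strip ∈ 𝓝 (t, s) :=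
  prod_mem_nhds Filter.univ_mem (Icc_mem_nhds hs.1 hs.2)

/-- The partial derivative `∂Γ/∂t` of a variation `Γ(t, s)` of a path. -/
noncomputable def partialFst (Γ : ℝ × ℝ → M) (q : ℝ × ℝ) : TangentSpace 𝓘(ℝ, E) (Γ q) :=
  mfderivWithin 𝓘(ℝ, ℝ × ℝ) 𝓘(ℝ, E) Γ strip q ((1, 0) : ℝ × ℝ)

/-- The partial derivative `∂Γ/∂s` of a variation `Γ(t, s)` of a path. -/
noncomputable def partialSnd (Γ : ℝ × ℝ → M) (q : ℝ × ℝ) : TangentSpace 𝓘(ℝ, E) (Γ q) :=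
  mfderivWithin 𝓘(ℝ, ℝ × ℝ) 𝓘(ℝ, E) Γ strip q ((0, 1) : ℝ × ℝ)

variable {Γ : ℝ × ℝ → M}

lemma contMDiffOn_partialFst (hΓ : ContMDiffOn 𝓘(ℝ, ℝ × ℝ) 𝓘(ℝ, E) ∞ Γ strip) :
    ContMDiffOn 𝓘(ℝ, ℝ × ℝ) 𝓘(ℝ, E).tangent ∞
      (fun q => (⟨Γ q, partialFst Γ q⟩ : TangentBundle 𝓘(ℝ, E) M)) strip :=
  contMDiffOn_mfderivWithin_apply hΓ uniqueDiffOn_strip _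

lemma contMDiffOn_partialSnd (hΓ : ContMDiffOn 𝓘(ℝ, ℝ × ℝ) 𝓘(ℝ, E) ∞ Γ strip) :
    ContMDiffOn 𝓘(ℝ, ℝ × ℝ) 𝓘(ℝ, E).tangent ∞
      (fun q => (⟨Γ q, partialSnd Γ q⟩ : TangentBundle 𝓘(ℝ, E) M)) strip :=
  contMDiffOn_mfderivWithin_apply hΓ uniqueDiffOn_strip _

lemma contDiff_mk_left (t : ℝ) : ContDiff ℝ ∞ (fun r : ℝ => (t, r)) :=
  contDiff_const.prodMk contDiff_id

lemma mapsTo_mk_strip (t : ℝ) : MapsTo (fun r : ℝ => (t, r)) (Icc 0 1) strip :=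
  fun _ hr => mk_mem_strip hr

lemma contMDiffOn_slice (hΓ : ContMDiffOn 𝓘(ℝ, ℝ × ℝ) 𝓘(ℝ, E) ∞ Γ strip) (t : ℝ) :
    ContMDiffOn 𝓘(ℝ, ℝ) 𝓘(ℝ, E) ∞ (fun s => Γ (t, s)) (Icc 0 1) :=
  hΓ.comp (contDiff_mk_left t).contMDiff.contMDiffOn (mapsTo_mk_strip t)

lemma velocity_slice (hΓ : ContMDiffOn 𝓘(ℝ, ℝ × ℝ) 𝓘(ℝ, E) ∞ Γ strip) (t : ℝ) {s : ℝ}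
    (hs : s ∈ Icc (0 : ℝ) 1) :
    velocity (E := E) (fun r => Γ (t, r)) s = partialSnd Γ (t, s) := by
  have h1 : HasMFDerivWithinAt 𝓘(ℝ, ℝ) 𝓘(ℝ, ℝ × ℝ) (fun r : ℝ => (t, r)) (Icc 0 1) s
      ((0 : ℝ →L[ℝ] ℝ).prod (ContinuousLinearMap.id ℝ ℝ)) :=
    (((hasFDerivAt_const t s).prodMk (hasFDerivAt_id s)).hasFDerivWithinAt).hasMFDerivWithinAt
  have h2 := (hΓ (t, s) (mk_mem_strip hs)).mdifferentiableWithinAt (by simp)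
  have h3 := HasMFDerivWithinAt.comp s h2.hasMFDerivWithinAt h1 (mapsTo_mk_strip t)
  have h4 := h3.mfderivWithin (uniqueMDiffOn_Icc s hs)
  change mfderivWithin 𝓘(ℝ, ℝ) 𝓘(ℝ, E) (Γ ∘ fun r : ℝ => (t, r)) (Icc 0 1) s (1 : ℝ) = _
  rw [h4]
  rfl

lemma hasMFDerivAt_mk_right (t s : ℝ) :
    HasMFDerivAt 𝓘(ℝ, ℝ) 𝓘(ℝ, ℝ × ℝ) (fun r : ℝ => (r, s)) t
      ((ContinuousLinearMap.id ℝ ℝ).prod (0 : ℝ →L[ℝ] ℝ)) :=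
  ((hasFDerivAt_id t).prodMk (hasFDerivAt_const s t)).hasMFDerivAt

lemma hasMFDerivAt_slice (hΓ : ContMDiffOn 𝓘(ℝ, ℝ × ℝ) 𝓘(ℝ, E) ∞ Γ strip) (t : ℝ) {s : ℝ}
    (hs : s ∈ Icc (0 : ℝ) 1) :
    HasMFDerivAt 𝓘(ℝ, ℝ) 𝓘(ℝ, E) (fun r => Γ (r, s)) t
      ((mfderivWithin 𝓘(ℝ, ℝ × ℝ) 𝓘(ℝ, E) Γ strip (t, s)).comp
        ((ContinuousLinearMap.id ℝ ℝ).prod (0 : ℝ →L[ℝ] ℝ))) := by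
  have h2 := (hΓ (t, s) (mk_mem_strip hs)).mdifferentiableWithinAt (by simp)
  rw [← hasMFDerivWithinAt_univ]
  exact HasMFDerivWithinAt.comp t h2.hasMFDerivWithinAt
    (hasMFDerivAt_mk_right t s).hasMFDerivWithinAt (fun r _ => mk_mem_strip hs)

lemma mfderiv_slice (hΓ : ContMDiffOn 𝓘(ℝ, ℝ × ℝ) 𝓘(ℝ, E) ∞ Γ strip) (t : ℝ) {s : ℝ}
    (hs : s ∈ Icc (0 : ℝ) 1) :
    mfderiv 𝓘(ℝ, ℝ) 𝓘(ℝ, E) (fun r => Γ (r, s)) t (1 : ℝ) = partialFst Γ (t, s) := by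
  rw [(hasMFDerivAt_slice hΓ t hs).mfderiv]
  rfl

lemma hasDerivWithinAt_slice {V : Type*} [NormedAddCommGroup V] [NormedSpace ℝ V]
    {f : ℝ × ℝ → V} (hf : ContDiffOn ℝ ∞ f strip) (t : ℝ) {s : ℝ} (hs : s ∈ Icc (0 : ℝ) 1) :
    HasDerivWithinAt (fun r => f (t, r)) (fderivWithin ℝ f strip (t, s) (0, 1)) (Icc 0 1) s := by
  have h1 : HasDerivWithinAt (fun r : ℝ => (t, r)) ((0 : ℝ), (1 : ℝ)) (Icc 0 1) s :=
    (hasDerivWithinAt_const s _ t).prodMk (hasDerivWithinAt_id s _)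
  exact ((hf.differentiableOn (by simp)) (t, s)
    (mk_mem_strip hs)).hasFDerivWithinAt.comp_hasDerivWithinAt s h1 (mapsTo_mk_strip t)

lemma continuousOn_fderivWithin_slice {V : Type*} [NormedAddCommGroup V] [NormedSpace ℝ V]
    {f : ℝ × ℝ → V} (hf : ContDiffOn ℝ ∞ f strip) (t : ℝ) (z : ℝ × ℝ) :
    ContinuousOn (fun s => fderivWithin ℝ f strip (t, s) z) (Icc 0 1) :=
  ((hf.continuousOn_fderivWithin uniqueDiffOn_strip (by simp)).clm_apply
    continuousOn_const).comp (contDiff_mk_left t).continuous.continuousOn (mapsTo_mk_strip t)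

/-- The variation formula for a one-form along the path `s ↦ Γ(0, s)`:
`∂ₜ(θ(∂ₛΓ)) = ∂ₛ(θ(∂ₜΓ)) + dθ(∂ₜΓ, ∂ₛΓ)`. -/
lemma IsSmoothForm.extDeriv_variation
    {θ : (x : M) → TangentSpace 𝓘(ℝ, E) x →L[ℝ] ℝ} (hθ : IsSmoothForm θ)
    (hΓ : ContMDiffOn 𝓘(ℝ, ℝ × ℝ) 𝓘(ℝ, E) ∞ Γ strip) (t : ℝ) {s : ℝ}
    (hs : s ∈ Ioo (0 : ℝ) 1) :
    fderivWithin ℝ (fun q => θ (Γ q) (partialSnd Γ q)) strip (t, s) (1, 0)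
      - fderivWithin ℝ (fun q => θ (Γ q) (partialFst Γ q)) strip (t, s) (0, 1)
      = FoliatedPaths.extDeriv θ (Γ (t, s)) (partialFst Γ (t, s)) (partialSnd Γ (t, s)) := by
  have hn := strip_mem_nhds (t := t) hs
  have hev : ∀ᶠ q in 𝓝 (t, s), strip ∈ 𝓝 q := eventually_mem_nhds_iff.2 hn
  have h0 := hθ.fderiv_pullback_sub ((hΓ (t, s) (mem_of_mem_nhds hn)).contMDiffAt hn)
    ((1, 0) : ℝ × ℝ) ((0, 1) : ℝ × ℝ)
  have h1 : (fun q => θ (Γ q) (partialSnd Γ q)) =ᶠ[𝓝 (t, s)]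
      fun q => θ (Γ q) (mfderiv 𝓘(ℝ, ℝ × ℝ) 𝓘(ℝ, E) Γ q ((0, 1) : ℝ × ℝ)) := by
    filter_upwards [hev] with q hq
    rw [partialSnd, mfderivWithin_of_mem_nhds hq]
  have h2 : (fun q => θ (Γ q) (partialFst Γ q)) =ᶠ[𝓝 (t, s)]
      fun q => θ (Γ q) (mfderiv 𝓘(ℝ, ℝ × ℝ) 𝓘(ℝ, E) Γ q ((1, 0) : ℝ × ℝ)) := by
    filter_upwards [hev] with q hq
    rw [partialFst, mfderivWithin_of_mem_nhds hq]
  rw [fderivWithin_of_mem_nhds hn, fderivWithin_of_mem_nhds hn, h1.fderiv_eq, h2.fderiv_eq, h0,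
    partialFst, partialSnd, mfderivWithin_of_mem_nhds hn]

/-- The inhomogeneous equation `b' = A b + h` is the linear equation on `V × ℝ` whose last component
is constantly `1`. -/
lemma exists_solution_affine {V : Type*} [NormedAddCommGroup V] [NormedSpace ℝ V]
    [FiniteDimensional ℝ V] {A : ℝ → V →L[ℝ] V} (hA : ContinuousOn A (Icc 0 1)) {h : ℝ → V}
    (hh : ContinuousOn h (Icc 0 1)) :
    ∃ b : ℝ → V, b 0 = 0 ∧
      ∀ s ∈ Icc (0 : ℝ) 1, HasDerivWithinAt b (A s (b s) + h s) (Icc 0 1) s := by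
  let A' : ℝ → (V × ℝ) →L[ℝ] (V × ℝ) := fun s =>
    ((A s).comp (ContinuousLinearMap.fst ℝ V ℝ) +
      (ContinuousLinearMap.snd ℝ V ℝ).smulRight (h s)).prod 0
  have hA' : ContinuousOn A' (Icc 0 1) := by
    rw [continuousOn_clm_apply]
    intro z
    refine ContinuousOn.prodMk ?_ continuousOn_const
    exact (hA.clm_apply continuousOn_const).add (continuousOn_const.smul hh)
  obtain ⟨z, hz0, hz⟩ := exists_solution_linear hA' ((0, 1) : V × ℝ)
  have h1 : ∀ s ∈ Icc (0 : ℝ) 1, (z s).2 = 1 := fun s hs => by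
    rw [eq_of_hasDerivWithinAt_zero (f := fun s => (z s).2)
      (fun r hr => (hz r hr).snd) hs, hz0]
  refine ⟨fun s => (z s).1, by simp [hz0], fun s hs => ?_⟩
  have h2 : HasDerivWithinAt (fun s => (z s).1) (A' s (z s)).1 (Icc 0 1) s := (hz s hs).fst
  exact h2.congr_deriv (by simp [A', h1 s hs])

namespace SpanningFields

variable [RiemannianBundle (fun x : M => TangentSpace 𝓘(ℝ, E) x)]
  [IsContMDiffRiemannianBundle 𝓘(ℝ, E) ∞ E (fun x : M => TangentSpace 𝓘(ℝ, E) x)]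
  (P : SpanningFields E M ι) {D : Connection E M} {u₀ : OFrame E n m M}
  {y : ℝ → Fin n ⊕ Fin m → ℝ → (ι → ℝ) × ℝ}

lemma fderivWithin_system_apply (hD : CovariantDerivative.ContMDiffCovariantDerivative D ∞)
    (hΓ : ContMDiffOn 𝓘(ℝ, ℝ × ℝ) 𝓘(ℝ, E) ∞ Γ strip) {q : ℝ × ℝ} (hq : q ∈ strip)
    (v : ℝ × ℝ) (z : (ι → ℝ) × ℝ) :
    fderivWithin ℝ (fun q => P.system D (Γ q) (partialSnd Γ q)) strip q v z =
      (fun k => -∑ j,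
          fderivWithin ℝ (fun q => P.connForm D k j (Γ q) (partialSnd Γ q)) strip q v * z.1 j,
        ∑ k, fderivWithin ℝ (fun q => innerForm (P.X k) (Γ q) (partialSnd Γ q)) strip q v *
          z.1 k) := by
  have hu := uniqueDiffOn_strip q hq
  have hS := contMDiffOn_partialSnd hΓ
  have h1 := ((P.contDiffOn_system hD hS).differentiableOn (by simp) q hq).hasFDerivWithinAt
  have h2 := h1.clm_apply (hasFDerivWithinAt_const z q strip)
  have h3 : ∀ k j, HasFDerivWithinAt (fun q => P.connForm D k j (Γ q) (partialSnd Γ q)) _ strip q :=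
    fun k j => (((P.isSmoothForm_connForm hD k j).contDiffOn_comp hS).differentiableOn
      (by simp) q hq).hasFDerivWithinAt
  have h4 : ∀ k, HasFDerivWithinAt (fun q => innerForm (P.X k) (Γ q) (partialSnd Γ q)) _ strip q :=
    fun k => (((isSmoothForm_innerForm (P.smooth_X k)).contDiffOn_comp hS).differentiableOn
      (by simp) q hq).hasFDerivWithinAt
  have h5 := (hasFDerivWithinAt_pi.2 fun k => (HasFDerivWithinAt.fun_sum
    (u := Finset.univ) fun j _ => (h3 k j).mul_const (z.1 j)).neg).prodMk
    (HasFDerivWithinAt.fun_sum (u := Finset.univ) fun k _ => (h4 k).mul_const (z.1 k))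
  have h6 := congrArg (fun L : (ℝ × ℝ) →L[ℝ] ((ι → ℝ) × ℝ) => L v) (hu.eq h2 h5)
  simp only [ContinuousLinearMap.comp_zero, zero_add, ContinuousLinearMap.flip_apply] at h6
  refine h6.trans ?_
  ext <;> simp [mul_comm]

/-- The solutions of the linear system along the paths `s ↦ Γ(t, s)` are differentiable in `t` at
`t = 0`, and the derivative solves the linearized equation. -/
lemma exists_variation (hD : CovariantDerivative.ContMDiffCovariantDerivative D ∞)
    (hΓ : ContMDiffOn 𝓘(ℝ, ℝ × ℝ) 𝓘(ℝ, E) ∞ Γ strip)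
    (hy : ∀ t, P.IsSolution D u₀ (fun s => Γ (t, s)) (y t)) (i : Fin n ⊕ Fin m) :
    ∃ b : ℝ → (ι → ℝ) × ℝ, b 0 = 0 ∧
      (∀ s ∈ Icc (0 : ℝ) 1, HasDerivAt (fun t => y t i s) (b s) 0) ∧
      ∀ s ∈ Icc (0 : ℝ) 1, HasDerivWithinAt b
        (P.system D (Γ (0, s)) (partialSnd Γ (0, s)) (b s) +
          fderivWithin ℝ (fun q => P.system D (Γ q) (partialSnd Γ q)) strip (0, s) (1, 0)
            (y 0 i s)) (Icc 0 1) s := by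
  have hB := P.contDiffOn_system hD (contMDiffOn_partialSnd hΓ)
  have hB0 : ContinuousOn (fun s : ℝ => P.system D (Γ (0, s)) (partialSnd Γ (0, s))) (Icc 0 1) :=
    hB.continuousOn.comp (contDiff_mk_left 0).continuous.continuousOn (mapsTo_mk_strip 0)
  have hB' := continuousOn_fderivWithin_slice hB 0 (1, 0)
  have hyc : ContinuousOn (y 0 i) (Icc 0 1) := fun s hs =>
    ((hy 0).deriv i s hs).continuousWithinAt
  obtain ⟨b, hb0, hb⟩ := exists_solution_affine hB0 (hB'.clm_apply hyc)
  refine ⟨b, hb0, fun s hs => ?_, hb⟩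
  refine hasDerivAt_solution_param
    (B := fun t s => P.system D (Γ (t, s)) (partialSnd Γ (t, s))) hB0 hB'
    (fun ε hε => uniform_expansion_of_contDiffOn hB hε) (y := fun t => y t i) (fun t => ?_)
    (fun t r hr => ?_) hb0 hb hs
  · rw [(hy t).start, (hy 0).start]
  · have h1 := (hy t).deriv i r hr
    rwa [velocity_slice hΓ t hr] at h1

end SpanningFields

end Variations

/-! ### Variation of parallel frames and of anti-developments -/

section FrameVariation

variable {E : Type*} [NormedAddCommGroup E] [NormedSpace ℝ E] [FiniteDimensional ℝ E] {n m : ℕ}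
  {M : Type*} [TopologicalSpace M] [ChartedSpace E M] [IsManifold 𝓘(ℝ, E) ∞ M]
  {ι : Type*} [Fintype ι] {Γ : ℝ × ℝ → M}

/-- The value `dθ(∂ₜΓ, ∂ₛΓ)` at `(0, s)` of the exterior derivative of a one-form, written as
`∂ₜ(θ(∂ₛΓ)) - ∂ₛ(θ(∂ₜΓ))` with derivatives within `ℝ × [0, 1]`; the latter is continuous up to the
end points of `[0, 1]`. -/
noncomputable def extCoeff (θ : (x : M) → TangentSpace 𝓘(ℝ, E) x →L[ℝ] ℝ) (Γ : ℝ × ℝ → M)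
    (s : ℝ) : ℝ :=
  fderivWithin ℝ (fun q => θ (Γ q) (partialSnd Γ q)) strip (0, s) (1, 0)
    - fderivWithin ℝ (fun q => θ (Γ q) (partialFst Γ q)) strip (0, s) (0, 1)

lemma IsSmoothForm.contDiffOn_partialFst {θ : (x : M) → TangentSpace 𝓘(ℝ, E) x →L[ℝ] ℝ}
    (hθ : IsSmoothForm θ) (hΓ : ContMDiffOn 𝓘(ℝ, ℝ × ℝ) 𝓘(ℝ, E) ∞ Γ strip) :
    ContDiffOn ℝ ∞ (fun q => θ (Γ q) (partialFst Γ q)) strip :=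
  hθ.contDiffOn_comp (contMDiffOn_partialFst hΓ)

lemma IsSmoothForm.contDiffOn_partialSnd {θ : (x : M) → TangentSpace 𝓘(ℝ, E) x →L[ℝ] ℝ}
    (hθ : IsSmoothForm θ) (hΓ : ContMDiffOn 𝓘(ℝ, ℝ × ℝ) 𝓘(ℝ, E) ∞ Γ strip) :
    ContDiffOn ℝ ∞ (fun q => θ (Γ q) (partialSnd Γ q)) strip :=
  hθ.contDiffOn_comp (contMDiffOn_partialSnd hΓ)

lemma continuousOn_slice {f : ℝ × ℝ → ℝ} (hf : ContDiffOn ℝ ∞ f strip) :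
    ContinuousOn (fun s : ℝ => f (0, s)) (Icc 0 1) :=
  hf.continuousOn.comp (contDiff_mk_left 0).continuous.continuousOn (mapsTo_mk_strip 0)

lemma IsSmoothForm.continuousOn_extCoeff {θ : (x : M) → TangentSpace 𝓘(ℝ, E) x →L[ℝ] ℝ}
    (hθ : IsSmoothForm θ) (hΓ : ContMDiffOn 𝓘(ℝ, ℝ × ℝ) 𝓘(ℝ, E) ∞ Γ strip) :
    ContinuousOn (extCoeff θ Γ) (Icc 0 1) :=
  (continuousOn_fderivWithin_slice (hθ.contDiffOn_partialSnd hΓ) 0 _).sub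
    (continuousOn_fderivWithin_slice (hθ.contDiffOn_partialFst hΓ) 0 _)

/-- The algebra behind the `s`-derivative of the coefficients of `Qᵢ`: here `S` and `Y` are the
connection forms on `∂ₛΓ` and `∂ₜΓ`, and `p - r` stands for the exterior derivative. -/
lemma sum_variation_identity (S Y : ι → ι → ℝ) (p r c b : ι → ℝ) (k : ι) :
    -∑ j, S k j * b j + -∑ j, p j * c j + ∑ j, (r j * c j + Y k j * -∑ l, S j l * c l) =
      -∑ j, S k j * (b j + ∑ l, Y j l * c l) -
        ∑ j, (p j - r j + ∑ l, (Y k l * S l j - S k l * Y l j)) * c j := by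
  have h1 : ∑ j, ∑ l, Y k l * S l j * c j = ∑ j, ∑ l, Y k j * (S j l * c l) := by
    rw [Finset.sum_comm]
    simp only [mul_assoc]
  have h2 : ∑ j, ∑ l, S k l * Y l j * c j = ∑ j, ∑ l, S k j * (Y j l * c l) := by
    rw [Finset.sum_comm]
    simp only [mul_assoc]
  simp only [mul_add, add_mul, sub_mul, Finset.sum_add_distrib, Finset.sum_sub_distrib, mul_neg,
    Finset.sum_neg_distrib, Finset.mul_sum, Finset.sum_mul, h1, h2]
  ring

/-- The algebra behind the `s`-derivative of `ηᵢ - ⟪Uᵢ, ∂ₜΓ⟫`: here `S` and `Y` are the connection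
forms on `∂ₛΓ` and `∂ₜΓ`, `gS` and `gY` the products of the `Xₖ` with them, and `p - r` stands for
the exterior derivative of the forms `⟪Xₖ, ·⟫`. -/
lemma sum_antiDev_identity (S Y : ι → ι → ℝ) (p r c b gS gY : ι → ℝ) :
    ∑ k, gS k * b k + ∑ k, p k * c k - ∑ k, ((-∑ j, S k j * c j) * gY k + c k * r k) =
      ∑ k, (b k + ∑ j, Y k j * c j) * gS k +
        ∑ k, c k * (p k - r k - ∑ l, (Y l k * gS l - S l k * gY l)) := by
  have h1 : ∑ k, ∑ l, c k * (Y l k * gS l) = ∑ k, ∑ j, Y k j * c j * gS k := by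
    rw [Finset.sum_comm]
    exact Finset.sum_congr rfl fun k _ => Finset.sum_congr rfl fun j _ => by ring
  have h2 : ∑ k, ∑ l, c k * (S l k * gY l) = ∑ k, ∑ j, S k j * c j * gY k := by
    rw [Finset.sum_comm]
    exact Finset.sum_congr rfl fun k _ => Finset.sum_congr rfl fun j _ => by ring
  simp only [mul_sub, add_mul, neg_mul, Finset.sum_add_distrib, Finset.sum_sub_distrib,
    Finset.sum_neg_distrib, Finset.mul_sum, Finset.sum_mul, h1, h2, mul_comm (gS _),
    mul_comm (p _)]
  ring

namespace SpanningFields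

variable (P : SpanningFields E M ι) (D : Connection E M)

/-- The coefficients `∂ₜcᵏ + ∑ θᵏⱼ(∂ₜΓ) cʲ` of the covariant derivative of `∑ cᵏ Xₖ` in the
direction of the variation, where `b = ∂ₜc`. -/
noncomputable def varCoeff (Γ : ℝ × ℝ → M) (c b : ι → ℝ) (s : ℝ) (k : ι) : ℝ :=
  b k + ∑ j, P.connForm D k j (Γ (0, s)) (partialFst Γ (0, s)) * c j

/-- The curvature forms on `(∂ₜΓ, ∂ₛΓ)`, in a form which is continuous up to the end points. -/
noncomputable def curvCoeff (Γ : ℝ × ℝ → M) (k j : ι) (s : ℝ) : ℝ :=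
  extCoeff (P.connForm D k j) Γ s +
    ∑ l, (P.connForm D k l (Γ (0, s)) (partialFst Γ (0, s)) *
        P.connForm D l j (Γ (0, s)) (partialSnd Γ (0, s)) -
      P.connForm D k l (Γ (0, s)) (partialSnd Γ (0, s)) *
        P.connForm D l j (Γ (0, s)) (partialFst Γ (0, s)))

variable {D}

lemma curvCoeff_eq (hD : CovariantDerivative.ContMDiffCovariantDerivative D ∞)
    (hΓ : ContMDiffOn 𝓘(ℝ, ℝ × ℝ) 𝓘(ℝ, E) ∞ Γ strip) (k j : ι) {s : ℝ}
    (hs : s ∈ Ioo (0 : ℝ) 1) : P.curvCoeff D Γ k j s =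
      P.curvForm D k j (Γ (0, s)) (partialFst Γ (0, s)) (partialSnd Γ (0, s)) := by
  rw [curvCoeff, extCoeff, (P.isSmoothForm_connForm hD k j).extDeriv_variation hΓ 0 hs]
  rfl

lemma continuousOn_curvCoeff (hD : CovariantDerivative.ContMDiffCovariantDerivative D ∞)
    (hΓ : ContMDiffOn 𝓘(ℝ, ℝ × ℝ) 𝓘(ℝ, E) ∞ Γ strip) (k j : ι) :
    ContinuousOn (P.curvCoeff D Γ k j) (Icc 0 1) := by
  have h1 := fun k j =>
    continuousOn_slice ((P.isSmoothForm_connForm hD k j).contDiffOn_partialFst hΓ)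
  have h2 := fun k j =>
    continuousOn_slice ((P.isSmoothForm_connForm hD k j).contDiffOn_partialSnd hΓ)
  exact ((P.isSmoothForm_connForm hD k j).continuousOn_extCoeff hΓ).add
    (continuousOn_finsetSum _ fun l _ => ((h1 k l).mul (h2 l j)).sub ((h2 k l).mul (h1 l j)))

variable [RiemannianBundle (fun x : M => TangentSpace 𝓘(ℝ, E) x)]

variable (D) in
/-- The torsion component `⟪Xₖ, T(∂ₜΓ, ∂ₛΓ)⟫`, in a form which is continuous up to the end
points. -/
noncomputable def torsionCoeff (Γ : ℝ × ℝ → M) (k : ι) (s : ℝ) : ℝ :=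
  extCoeff (innerForm (P.X k)) Γ s -
    ∑ l, (P.connForm D l k (Γ (0, s)) (partialFst Γ (0, s)) *
        innerForm (P.X l) (Γ (0, s)) (partialSnd Γ (0, s)) -
      P.connForm D l k (Γ (0, s)) (partialSnd Γ (0, s)) *
        innerForm (P.X l) (Γ (0, s)) (partialFst Γ (0, s)))

variable [IsContMDiffRiemannianBundle 𝓘(ℝ, E) ∞ E (fun x : M => TangentSpace 𝓘(ℝ, E) x)]

lemma continuousOn_torsionCoeff (hD : CovariantDerivative.ContMDiffCovariantDerivative D ∞)
    (hΓ : ContMDiffOn 𝓘(ℝ, ℝ × ℝ) 𝓘(ℝ, E) ∞ Γ strip) (k : ι) :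
    ContinuousOn (P.torsionCoeff D Γ k) (Icc 0 1) := by
  have h1 := fun k j =>
    continuousOn_slice ((P.isSmoothForm_connForm hD k j).contDiffOn_partialFst hΓ)
  have h2 := fun k j =>
    continuousOn_slice ((P.isSmoothForm_connForm hD k j).contDiffOn_partialSnd hΓ)
  have h3 := fun k => continuousOn_slice
    ((isSmoothForm_innerForm (P.smooth_X k)).contDiffOn_partialFst hΓ)
  have h4 := fun k => continuousOn_slice
    ((isSmoothForm_innerForm (P.smooth_X k)).contDiffOn_partialSnd hΓ)
  exact ((isSmoothForm_innerForm (P.smooth_X k)).continuousOn_extCoeff hΓ).sub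
    (continuousOn_finsetSum _ fun l _ => ((h1 l k).mul (h4 l)).sub ((h2 l k).mul (h3 l)))

lemma inner_cov_X (k : ι) {x : M} (a b : TangentSpace 𝓘(ℝ, E) x) :
    inner ℝ (D (P.X k) x a) b = ∑ l, P.connForm D l k x a * innerForm (P.X l) x b := by
  rw [P.cov_X, sum_inner]
  exact Finset.sum_congr rfl fun l _ => real_inner_smul_left _ _ _

lemma torsionCoeff_eq
    (hD : CovariantDerivative.IsMetricCompatible (V := (TangentSpace 𝓘(ℝ, E) : M → Type _)) D)
    (hΓ : ContMDiffOn 𝓘(ℝ, ℝ × ℝ) 𝓘(ℝ, E) ∞ Γ strip) (k : ι) {s : ℝ}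
    (hs : s ∈ Ioo (0 : ℝ) 1) : P.torsionCoeff D Γ k s =
      inner ℝ (P.X k (Γ (0, s)))
        (D.torsion (Γ (0, s)) (partialFst Γ (0, s)) (partialSnd Γ (0, s))) := by
  rw [torsionCoeff, extCoeff, (isSmoothForm_innerForm (P.smooth_X k)).extDeriv_variation hΓ 0 hs,
    extDeriv_innerForm hD (P.smooth_X k), inner_cov_X, inner_cov_X, Finset.sum_sub_distrib]
  ring

variable (D) in
/-- A variation `Γ(t, s)` of a path, the solutions `y t` of the linear system along the paths
`s ↦ Γ(t, s)` and the derivative `b` of these solutions at `t = 0`. -/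
structure IsVariation (u₀ : OFrame E n m M) (Γ : ℝ × ℝ → M)
    (y : ℝ → Fin n ⊕ Fin m → ℝ → (ι → ℝ) × ℝ) (b : Fin n ⊕ Fin m → ℝ → (ι → ℝ) × ℝ) :
    Prop where
  smooth : ContMDiffOn 𝓘(ℝ, ℝ × ℝ) 𝓘(ℝ, E) ∞ Γ strip
  start : ∀ t, Γ (t, 0) = u₀.pt
  isSolution : ∀ t, P.IsSolution D u₀ (fun s => Γ (t, s)) (y t)
  zero : ∀ i, b i 0 = 0
  hasDerivAt : ∀ i, ∀ s ∈ Icc (0 : ℝ) 1, HasDerivAt (fun t => y t i s) (b i s) 0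
  deriv : ∀ i, ∀ s ∈ Icc (0 : ℝ) 1, HasDerivWithinAt (b i)
    (P.system D (Γ (0, s)) (partialSnd Γ (0, s)) (b i s) +
      fderivWithin ℝ (fun q => P.system D (Γ q) (partialSnd Γ q)) strip (0, s) (1, 0)
        (y 0 i s)) (Icc 0 1) s

variable {P} {u₀ : OFrame E n m M} {y : ℝ → Fin n ⊕ Fin m → ℝ → (ι → ℝ) × ℝ}
  {b : Fin n ⊕ Fin m → ℝ → (ι → ℝ) × ℝ}

variable (P) (y b) in
/-- The frame vector `Uᵢ = ∑ cᵢᵏ Xₖ` along the path `s ↦ Γ(0, s)`. -/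
noncomputable def frameVec (Γ : ℝ × ℝ → M) (y : ℝ → Fin n ⊕ Fin m → ℝ → (ι → ℝ) × ℝ)
    (i : Fin n ⊕ Fin m) (s : ℝ) : TangentSpace 𝓘(ℝ, E) (Γ (0, s)) :=
  ∑ k, (y 0 i s).1 k • P.X k (Γ (0, s))

variable (P) (D) in
/-- The covariant derivative `Qᵢ` of the frame vector `Uᵢ` in the direction of the variation. -/
noncomputable def frameVar (Γ : ℝ × ℝ → M) (y : ℝ → Fin n ⊕ Fin m → ℝ → (ι → ℝ) × ℝ)
    (b : Fin n ⊕ Fin m → ℝ → (ι → ℝ) × ℝ)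
    (i : Fin n ⊕ Fin m) (s : ℝ) : TangentSpace 𝓘(ℝ, E) (Γ (0, s)) :=
  ∑ k, P.varCoeff D Γ (y 0 i s).1 (b i s).1 s k • P.X k (Γ (0, s))

variable (P) in
lemma sum_smul_add_cov (c b : ι → ℝ) {x : M} (a : TangentSpace 𝓘(ℝ, E) x) :
    ∑ k, (b k • P.X k x + c k • D (P.X k) x a) =
      ∑ k, (b k + ∑ j, P.connForm D k j x a * c j) • P.X k x := by
  simp only [P.cov_X, Finset.smul_sum, smul_smul, add_smul, Finset.sum_add_distrib, Finset.sum_smul]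
  congr 1
  rw [Finset.sum_comm]
  refine Finset.sum_congr rfl fun k _ => Finset.sum_congr rfl fun j _ => ?_
  rw [mul_comm]

namespace IsVariation

/-- The covariant derivatives of orthonormal vectors form a skew-symmetric matrix. -/
lemma inner_add_inner
    (hD : CovariantDerivative.IsMetricCompatible (V := (TangentSpace 𝓘(ℝ, E) : M → Type _)) D)
    (h : P.IsVariation D u₀ Γ y b) {s : ℝ} (hs : s ∈ Icc (0 : ℝ) 1) (i j : Fin n ⊕ Fin m) :
    inner ℝ (P.frameVar D Γ y b i s) (P.frameVec Γ y j s) +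
      inner ℝ (P.frameVec Γ y i s) (P.frameVar D Γ y b j s) = 0 := by
  have hmd := (hasMFDerivAt_slice h.smooth 0 hs).mdifferentiableAt.mdifferentiableWithinAt
    (s := univ)
  have hc : ∀ i k, HasDerivWithinAt (fun t => (y t i s).1 k) ((b i s).1 k) univ 0 := fun i k =>
    hasDerivWithinAt_pi.1 (h.hasDerivAt i s hs).hasDerivWithinAt.fst k
  have h1 := hasDerivWithinAt_inner_sum hD P.smooth_X P.smooth_X hmd (hc i) (hc j)
  rw [mfderivWithin_univ, mfderiv_slice h.smooth 0 hs] at h1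
  rw [sum_smul_add_cov, sum_smul_add_cov, hasDerivWithinAt_univ] at h1
  have h2 : (fun t => inner ℝ (∑ k, (y t i s).1 k • P.X k (Γ (t, s)))
      (∑ k, (y t j s).1 k • P.X k (Γ (t, s)))) = fun _ => if i = j then (1 : ℝ) else 0 := by
    funext t
    exact (h.isSolution t).inner_eq hD (contMDiffOn_slice h.smooth t) (h.start t) hs i j
  rw [h2] at h1
  exact h1.unique (hasDerivAt_const _ _)

/-- The covariant derivative of a horizontal frame vector is horizontal, because the frames along
all the paths of the variation respect the horizontal and vertical bundles. -/
lemma inner_frameVar_inl_inr {F : Foliation E n M} (hD : IsAdapted F D) (hu₀ : F.IsHorFrame u₀)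
    (h : P.IsVariation D u₀ Γ y b) {s : ℝ} (hs : s ∈ Icc (0 : ℝ) 1) (d : Fin n) (a : Fin m) :
    inner ℝ (P.frameVar D Γ y b (Sum.inl d) s) (P.frameVec Γ y (Sum.inr a) s) = 0 := by
  have hframe : ∀ t, F.verProj (Γ (t, s)) (∑ k, (y t (Sum.inl d) s).1 k • P.X k (Γ (t, s))) = 0 ∧
      ∑ k, (y t (Sum.inr a) s).1 k • P.X k (Γ (t, s)) ∈ F.vertical (Γ (t, s)) := fun t => by
    obtain ⟨hl, hpt, hiso, -⟩ := (h.isSolution t).dLift_antiDev hD.smooth hD.metric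
      (contMDiffOn_slice h.smooth t) (h.start t)
    have hf := hl.isHorFrame P hD hu₀ hs
    have h1 := hf.stdVec_inl d
    have h2 := hf.stdVec_inr a
    rw [hiso s hs] at h1 h2
    rw [← hpt s hs]
    exact ⟨Foliation.verProj_of_mem_horizontal h1, h2⟩
  have hmd := (hasMFDerivAt_slice h.smooth 0 hs).mdifferentiableAt.mdifferentiableWithinAt
    (s := univ)
  have hc : ∀ i k, HasDerivWithinAt (fun t => (y t i s).1 k) ((b i s).1 k) univ 0 := fun i k =>
    hasDerivWithinAt_pi.1 (h.hasDerivAt i s hs).hasDerivWithinAt.fst k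
  have h1 := hasDerivWithinAt_inner_sum hD.metric (fun k => F.isSmoothField_ver (P.smooth_X k))
    P.smooth_X hmd (hc (Sum.inl d)) (hc (Sum.inr a))
  rw [mfderivWithin_univ, mfderiv_slice h.smooth 0 hs, hasDerivWithinAt_univ] at h1
  have hv : ∀ (x : M) (c : ι → ℝ), ∑ k, c k • F.ver (P.X k) x =
      F.verProj x (∑ k, c k • P.X k x) := fun x c => by
    simp only [map_sum, map_smul]
    rfl
  have hvc : ∑ k, ((b (Sum.inl d) s).1 k • F.ver (P.X k) (Γ (0, s)) +
      (y 0 (Sum.inl d) s).1 k • D (F.ver (P.X k)) (Γ (0, s)) (partialFst Γ (0, s))) =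
      F.verProj (Γ (0, s)) (P.frameVar D Γ y b (Sum.inl d) s) := by
    simp only [frameVar, varCoeff]
    rw [← sum_smul_add_cov, map_sum]
    refine Finset.sum_congr rfl fun k _ => ?_
    rw [hD.cov_ver P (P.smooth_X k), map_add, map_smul, map_smul]
    rfl
  simp only [hv, (hframe _).1, inner_zero_left, add_zero] at h1
  rw [hvc] at h1
  have h2 := h1.unique (hasDerivAt_const _ _)
  rw [Submodule.inner_starProjection_left_eq_right,
    Submodule.starProjection_eq_self_iff.2 (hframe 0).2] at h2
  exact h2

lemma velocity_eq (h : P.IsVariation D u₀ Γ y b) {s : ℝ} (hs : s ∈ Icc (0 : ℝ) 1) :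
    mfderivWithin 𝓘(ℝ, ℝ) 𝓘(ℝ, E) (fun r => Γ (0, r)) (Icc 0 1) s (1 : ℝ) =
      partialSnd Γ (0, s) :=
  velocity_slice h.smooth 0 hs

lemma hasDerivWithinAt_coeff (h : P.IsVariation D u₀ Γ y b) {s : ℝ} (hs : s ∈ Icc (0 : ℝ) 1)
    (i : Fin n ⊕ Fin m) (k : ι) :
    HasDerivWithinAt (fun r => (y 0 i r).1 k)
      (-∑ j, P.connForm D k j (Γ (0, s)) (partialSnd Γ (0, s)) * (y 0 i s).1 j) (Icc 0 1) s := by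
  have h1 := (h.isSolution 0).deriv i s hs
  rw [velocity_slice h.smooth 0 hs] at h1
  exact hasDerivWithinAt_pi.1 h1.fst k

/-- The equation of parallel transport, differentiated with respect to the variation, contains the
curvature. -/
lemma hasDerivWithinAt_varCoeff (hD : CovariantDerivative.ContMDiffCovariantDerivative D ∞)
    (h : P.IsVariation D u₀ Γ y b) {s : ℝ} (hs : s ∈ Icc (0 : ℝ) 1) (i : Fin n ⊕ Fin m) (k : ι) :
    HasDerivWithinAt (fun r => P.varCoeff D Γ (y 0 i r).1 (b i r).1 r k)
      (-∑ j, P.connForm D k j (Γ (0, s)) (partialSnd Γ (0, s)) *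
          P.varCoeff D Γ (y 0 i s).1 (b i s).1 s j
        - ∑ j, P.curvCoeff D Γ k j s * (y 0 i s).1 j) (Icc 0 1) s := by
  have hb := h.deriv i s hs
  rw [P.fderivWithin_system_apply hD h.smooth (mk_mem_strip hs)] at hb
  have hb1 := hasDerivWithinAt_pi.1 hb.fst k
  have h1 : ∀ j, HasDerivWithinAt
      (fun r => P.connForm D k j (Γ (0, r)) (partialFst Γ (0, r))) _ (Icc 0 1) s := fun j =>
    hasDerivWithinAt_slice ((P.isSmoothForm_connForm hD k j).contDiffOn_partialFst h.smooth) 0 hs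
  have h2 := hb1.add (HasDerivWithinAt.fun_sum (u := Finset.univ) fun j _ =>
    (h1 j).mul (h.hasDerivWithinAt_coeff hs i j))
  refine h2.congr_deriv ?_
  exact sum_variation_identity (fun k j => P.connForm D k j (Γ (0, s)) (partialSnd Γ (0, s)))
    (fun k j => P.connForm D k j (Γ (0, s)) (partialFst Γ (0, s))) _ _ _ _ k

/-- `∂ₛ⟪Qᵢ, Uⱼ⟫ = ⟪R(∂ₛΓ, ∂ₜΓ)Uᵢ, Uⱼ⟫`, with the curvature in terms of the curvature forms. -/
lemma hasDerivWithinAt_inner_frameVar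
    (hDs : CovariantDerivative.ContMDiffCovariantDerivative D ∞)
    (hD : CovariantDerivative.IsMetricCompatible (V := (TangentSpace 𝓘(ℝ, E) : M → Type _)) D)
    (h : P.IsVariation D u₀ Γ y b) {s : ℝ} (hs : s ∈ Icc (0 : ℝ) 1) (i j : Fin n ⊕ Fin m) :
    HasDerivWithinAt (fun r => inner ℝ (P.frameVar D Γ y b i r) (P.frameVec Γ y j r))
      (inner ℝ (-∑ k, (∑ j, P.curvCoeff D Γ k j s * (y 0 i s).1 j) • P.X k (Γ (0, s)))
        (P.frameVec Γ y j s)) (Icc 0 1) s := by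
  have hmd := ((contMDiffOn_slice h.smooth 0) s hs).mdifferentiableWithinAt (by simp)
  have h1 := hasDerivWithinAt_inner_sum hD P.smooth_X P.smooth_X hmd
    (h.hasDerivWithinAt_varCoeff hDs hs i) (h.hasDerivWithinAt_coeff hs j)
  rw [h.velocity_eq hs, sum_smul_add_cov, sum_smul_add_cov] at h1
  refine h1.congr_deriv ?_
  have h2 : ∑ k, (-∑ l, P.connForm D k l (Γ (0, s)) (partialSnd Γ (0, s)) * (y 0 j s).1 l +
      ∑ l, P.connForm D k l (Γ (0, s)) (partialSnd Γ (0, s)) * (y 0 j s).1 l) •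
      P.X k (Γ (0, s)) = 0 := by
    simp
  have h3 : ∀ p q : ℝ, -p - q + p = -q := fun p q => by ring
  rw [h2, inner_zero_right, add_zero]
  simp only [h3, neg_smul, Finset.sum_neg_distrib]
  rfl

/-- The variation of the anti-development: `∂ₛ(ηᵢ - ⟪Uᵢ, ∂ₜΓ⟫) = ⟪Qᵢ, ∂ₛΓ⟫ + ⟪Uᵢ, T(∂ₜΓ, ∂ₛΓ)⟫`. -/
lemma hasDerivWithinAt_antiDev_sub (hD : CovariantDerivative.ContMDiffCovariantDerivative D ∞)
    (h : P.IsVariation D u₀ Γ y b) {s : ℝ} (hs : s ∈ Icc (0 : ℝ) 1) (i : Fin n ⊕ Fin m) :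
    HasDerivWithinAt (fun r => (b i r).2 - inner ℝ (P.frameVec Γ y i r) (partialFst Γ (0, r)))
      (inner ℝ (P.frameVar D Γ y b i s) (partialSnd Γ (0, s)) +
        ∑ k, (y 0 i s).1 k * P.torsionCoeff D Γ k s) (Icc 0 1) s := by
  have hb := h.deriv i s hs
  rw [P.fderivWithin_system_apply hD h.smooth (mk_mem_strip hs)] at hb
  have h1 : ∀ k, HasDerivWithinAt
      (fun r => innerForm (P.X k) (Γ (0, r)) (partialFst Γ (0, r))) _ (Icc 0 1) s := fun k =>
    hasDerivWithinAt_slice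
      ((isSmoothForm_innerForm (P.smooth_X k)).contDiffOn_partialFst h.smooth) 0 hs
  have hb2 : HasDerivWithinAt (fun r => (b i r).2) _ (Icc 0 1) s := hb.snd
  have h2 := hb2.sub (HasDerivWithinAt.fun_sum (u := Finset.univ) fun k _ =>
    (h.hasDerivWithinAt_coeff hs i k).mul (h1 k))
  have hin : ∀ (c : ι → ℝ) (x : M) (a : TangentSpace 𝓘(ℝ, E) x),
      inner ℝ (∑ k, c k • P.X k x) a = ∑ k, c k * innerForm (P.X k) x a := fun c x a => by
    rw [sum_inner]
    exact Finset.sum_congr rfl fun k _ => real_inner_smul_left _ _ _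
  simp only [frameVec, frameVar, hin]
  exact h2.congr_deriv (sum_antiDev_identity
    (fun k j => P.connForm D k j (Γ (0, s)) (partialSnd Γ (0, s)))
    (fun k j => P.connForm D k j (Γ (0, s)) (partialFst Γ (0, s))) _ _ _ _ _ _)

end IsVariation

end SpanningFields

end FrameVariation

/-! ### Torsion and curvature forms at a frame -/

section Forms

variable {E : Type*} [NormedAddCommGroup E] [NormedSpace ℝ E] [FiniteDimensional ℝ E] {n m : ℕ}
  {M : Type*} [TopologicalSpace M] [ChartedSpace E M] [IsManifold 𝓘(ℝ, E) ∞ M]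
  {ι : Type*} [Fintype ι]
  [RiemannianBundle (fun x : M => TangentSpace 𝓘(ℝ, E) x)]
  [IsContMDiffRiemannianBundle 𝓘(ℝ, E) ∞ E (fun x : M => TangentSpace 𝓘(ℝ, E) x)]
  {F : Foliation E n M} {D : Connection E M} {u : OFrame E n m M} {a b : Eucl n m}

lemma Foliation.IsHorFrame.bottTorsion_eq (P : SpanningFields E M ι) (hD : IsAdapted F D)
    (hu : F.IsHorFrame u) (ha : IsHorVec a) :
    F.bottTorsion u.pt (u.iso a) (u.iso (horPart b)) =
      F.verProj u.pt (D.torsion u.pt (u.iso a) (u.iso b)) := by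
  have h1 : u.iso (b - horPart b) ∈ F.vertical u.pt := hu.2 _ fun i => by simp [horPart]
  rw [← hD.verProj_torsion P (hu.1 a ha) (hu.1 (horPart b) fun j => by simp [horPart]) h1,
    ← map_add, add_sub_cancel]

/-- The torsion form of the Bott connection on horizontal vectors is the vertical part of the
torsion form of any adapted connection. -/
lemma Foliation.IsHorFrame.bottTorsionForm_inr (P : SpanningFields E M ι) (hD : IsAdapted F D)
    (hu : F.IsHorFrame u) (ha : IsHorVec a) (j : Fin m) :
    F.bottTorsionForm u a (horPart b) (Sum.inr j) = torsionForm D u a b (Sum.inr j) := by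
  rw [bottTorsionForm, torsionForm, OFrame.iso_symm_apply, OFrame.iso_symm_apply,
    hu.bottTorsion_eq P hD ha, ← Submodule.inner_starProjection_left_eq_right,
    Submodule.starProjection_eq_self_iff.2 (hu.stdVec_inr j)]

lemma Foliation.IsHorFrame.bottTorsionForm_inl (P : SpanningFields E M ι) (hD : IsAdapted F D)
    (hu : F.IsHorFrame u) (ha : IsHorVec a) (i : Fin n) :
    F.bottTorsionForm u a (horPart b) (Sum.inl i) = 0 := by
  rw [bottTorsionForm, OFrame.iso_symm_apply, hu.bottTorsion_eq P hD ha]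
  exact Foliation.inner_horizontal_vertical (hu.stdVec_inl i)
    (Submodule.starProjection_apply_mem _ _)

namespace SpanningFields

variable (P : SpanningFields E M ι)

lemma curvForm_swap (k j : ι) {x : M} (a b : TangentSpace 𝓘(ℝ, E) x) :
    P.curvForm D k j x a b = -P.curvForm D k j x b a := by
  simp only [curvForm, FoliatedPaths.extDeriv, Finset.sum_sub_distrib]
  ring

/-- The curvature form at a frame `u` with `u eᵢ = ∑ cᵢᵏ Xₖ`. -/
lemma curvatureForm_apply (hD : CovariantDerivative.ContMDiffCovariantDerivative D ∞)
    {c : Fin n ⊕ Fin m → ι → ℝ} (hc : ∀ i, u.iso (stdVec i) = ∑ k, c i k • P.X k u.pt)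
    (w : Eucl n m) (i : Fin n ⊕ Fin m) :
    curvatureForm D u a b w i = ∑ d, w d * inner ℝ
      (-∑ k, (∑ j, P.curvForm D k j u.pt (u.iso b) (u.iso a) * c d j) • P.X k u.pt)
      (u.iso (stdVec i)) := by
  have h1 : u.iso w = ∑ j, (∑ d, w d * c d j) • P.X j u.pt := by
    rw [← OFrame.sum_smul_iso]
    simp only [hc, Finset.smul_sum, smul_smul, Finset.sum_smul]
    rw [Finset.sum_comm]
  rw [curvatureForm, OFrame.iso_symm_apply, h1, P.curvature_sum hD, real_inner_comm, sum_inner]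
  simp only [inner_neg_left, sum_inner, real_inner_smul_left, mul_neg, neg_mul, Finset.mul_sum,
    Finset.sum_mul, P.curvForm_swap _ _ (u.iso a), Finset.sum_neg_distrib]
  refine congrArg Neg.neg ((Finset.sum_congr rfl fun k _ => Finset.sum_comm).trans
    (Finset.sum_comm.trans ?_))
  refine Finset.sum_congr rfl fun d _ => Finset.sum_congr rfl fun k _ =>
    Finset.sum_congr rfl fun j _ => ?_
  ring

end SpanningFields

end Forms

/-! ### Integrals over subintervals of `[0, 1]` -/

section Integrals

variable {n m : ℕ}

lemma integral_eq_sub_of_hasDerivWithinAt {f f' : ℝ → ℝ}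
    (hf : ∀ s ∈ Icc (0 : ℝ) 1, HasDerivWithinAt f (f' s) (Icc 0 1) s)
    (hf' : ContinuousOn f' (Icc 0 1)) {s : ℝ} (hs : s ∈ Icc (0 : ℝ) 1) :
    ∫ r in (0 : ℝ)..s, f' r = f s - f 0 := by
  have hsub : Icc 0 s ⊆ Icc (0 : ℝ) 1 := Icc_subset_Icc_right hs.2
  refine intervalIntegral.integral_eq_sub_of_hasDerivAt_of_le hs.1
    (fun r hr => (hf r (hsub hr)).continuousWithinAt.mono hsub) (fun r hr => ?_)
    ((hf'.mono (by rwa [uIcc_of_le hs.1])).intervalIntegrable)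
  exact (hf r (hsub (Ioo_subset_Icc_self hr))).hasDerivAt
    (Icc_mem_nhds hr.1 (hr.2.trans_le hs.2))

/-- The components of an integral, when the integrand has continuous components up to its values at
the end points of `[0, 1]`. -/
lemma integral_apply_of_eqOn {f : ℝ → Eucl n m} {g : Fin n ⊕ Fin m → ℝ → ℝ}
    (hg : ∀ i, ContinuousOn (g i) (Icc 0 1)) (hfg : ∀ r ∈ Ioo (0 : ℝ) 1, ∀ i, f r i = g i r)
    {s : ℝ} (hs : s ∈ Icc (0 : ℝ) 1) (i : Fin n ⊕ Fin m) :
    (∫ r in (0 : ℝ)..s, f r) i = ∫ r in (0 : ℝ)..s, g i r := by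
  have h1 : ∫ r in (0 : ℝ)..s, f r = ∫ r in (0 : ℝ)..s, (WithLp.toLp 2 fun i => g i r : Eucl n m) :=
    intervalIntegral.integral_congr_Ioo_of_le hs.1 fun r hr => by
      ext i
      exact hfg r ⟨hr.1, hr.2.trans_le hs.2⟩ i
  have h2 : ContinuousOn (fun r => (WithLp.toLp 2 fun i => g i r : Eucl n m)) (uIcc 0 s) := by
    refine (PiLp.continuous_toLp 2 _).comp_continuousOn (continuousOn_pi.2 fun i => ?_)
    exact (hg i).mono (by rw [uIcc_of_le hs.1]; exact Icc_subset_Icc_right hs.2)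
  rw [h1]
  exact ((EuclideanSpace.proj i : Eucl n m →L[ℝ] ℝ).intervalIntegral_comp_comm
    h2.intervalIntegrable).symm

end Integrals

/-! ### The first variation of the anti-development -/

section FirstVariation

variable {E : Type*} [NormedAddCommGroup E] [NormedSpace ℝ E] [FiniteDimensional ℝ E] {n m : ℕ}
  {M : Type*} [TopologicalSpace M] [ChartedSpace E M] [IsManifold 𝓘(ℝ, E) ∞ M]
  {ι : Type*} [Fintype ι]
  [RiemannianBundle (fun x : M => TangentSpace 𝓘(ℝ, E) x)]
  [IsContMDiffRiemannianBundle 𝓘(ℝ, E) ∞ E (fun x : M => TangentSpace 𝓘(ℝ, E) x)]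
  {F : Foliation E n M} {D : Connection E M} {u₀ : OFrame E n m M} {Γ : ℝ × ℝ → M}

namespace SpanningFields

variable {P : SpanningFields E M ι} {y : ℝ → Fin n ⊕ Fin m → ℝ → (ι → ℝ) × ℝ}
  {b : Fin n ⊕ Fin m → ℝ → (ι → ℝ) × ℝ}

variable (P D) in
/-- The function `⟪R(∂ₛΓ, ∂ₜΓ)Uᵢ, Uⱼ⟫`, in a form which is continuous up to the end points. -/
noncomputable def curvInner (Γ : ℝ × ℝ → M) (y : ℝ → Fin n ⊕ Fin m → ℝ → (ι → ℝ) × ℝ)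
    (i j : Fin n ⊕ Fin m) (s : ℝ) : ℝ :=
  inner ℝ (-∑ k, (∑ l, P.curvCoeff D Γ k l s * (y 0 i s).1 l) • P.X k (Γ (0, s)))
    (P.frameVec Γ y j s)

variable (P D) in
/-- The function `⟪Uᵢ, T(∂ₛΓ, ∂ₜΓ)⟫`, in a form which is continuous up to the end points. -/
noncomputable def torsionInner (Γ : ℝ × ℝ → M) (y : ℝ → Fin n ⊕ Fin m → ℝ → (ι → ℝ) × ℝ)
    (i : Fin n ⊕ Fin m) (s : ℝ) : ℝ :=
  -∑ k, (y 0 i s).1 k * P.torsionCoeff D Γ k s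

namespace IsVariation

variable {v w : ℝ → Eucl n m}

/-- The lift of the path `s ↦ Γ(0, s)` as a frame in the tangent space at `Γ(0, s)`; the velocity
is `u w'` and the variation field is `u v`. -/
lemma exists_iso (h : P.IsVariation D u₀ Γ y b)
    (hDs : CovariantDerivative.ContMDiffCovariantDerivative D ∞)
    (hD : CovariantDerivative.IsMetricCompatible (V := (TangentSpace 𝓘(ℝ, E) : M → Type _)) D)
    (hw : IsAntiDev D u₀ (fun s => Γ (0, s)) w) {s : ℝ} (hs : s ∈ Icc (0 : ℝ) 1)
    (hv : (⟨Γ (0, s), partialFst Γ (0, s)⟩ : TangentBundle 𝓘(ℝ, E) M) =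
      pathField D u₀ v (fun s => Γ (0, s)) s) :
    ∃ f : Eucl n m ≃ₗᵢ[ℝ] TangentSpace 𝓘(ℝ, E) (Γ (0, s)),
      dLift D u₀ (fun s => Γ (0, s)) s = ⟨Γ (0, s), f⟩ ∧
      (∀ i, f (stdVec i) = P.frameVec Γ y i s) ∧
      f (dot w s) = partialSnd Γ (0, s) ∧ f (v s) = partialFst Γ (0, s) := by
  obtain ⟨hl, hpt, hiso, -⟩ := (h.isSolution 0).dLift_antiDev hDs hD
    (contMDiffOn_slice h.smooth 0) (h.start 0)
  have h1 := hw.dot_eq P hD hl hpt hs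
  have h2 := velocity_congr (E := E) (β' := fun s => Γ (0, s)) hpt hs
  rw [velocity_slice h.smooth 0 hs, ← h1] at h2
  have h3 := hiso s hs
  have h4 := hpt s hs
  unfold pathField at hv
  generalize dLift D u₀ (fun s => Γ (0, s)) s = u at h2 h3 h4 hv
  obtain ⟨x, f⟩ := u
  obtain rfl : x = Γ (0, s) := h4
  exact ⟨f, rfl, h3, eq_of_heq (TotalSpace.mk.inj h2).2, (eq_of_heq (TotalSpace.mk.inj hv).2).symm⟩

lemma continuousOn_coeff (h : P.IsVariation D u₀ Γ y b) (i : Fin n ⊕ Fin m) (k : ι) :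
    ContinuousOn (fun s => (y 0 i s).1 k) (Icc 0 1) := fun _ hs =>
  (h.hasDerivWithinAt_coeff hs i k).continuousWithinAt

lemma continuousOn_curvInner (h : P.IsVariation D u₀ Γ y b)
    (hDs : CovariantDerivative.ContMDiffCovariantDerivative D ∞) (i j : Fin n ⊕ Fin m) :
    ContinuousOn (P.curvInner D Γ y i j) (Icc 0 1) := by
  have hβ := contMDiffOn_slice h.smooth 0
  have h1 : ∀ k, ContinuousOn
      (fun s => innerForm (P.X k) (Γ (0, s)) (P.frameVec Γ y j s)) (Icc 0 1) := fun k =>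
    ((isSmoothForm_innerForm (P.smooth_X k)).contDiffOn_comp
      (P.contMDiffOn_sum hβ (c := fun k s => (y 0 j s).1 k) fun k =>
        contDiffOn_pi.1 ((h.isSolution 0).contDiffOn hDs hβ j).fst k)).continuousOn
  have h2 : P.curvInner D Γ y i j = fun s => -∑ k, (∑ l, P.curvCoeff D Γ k l s * (y 0 i s).1 l) *
      innerForm (P.X k) (Γ (0, s)) (P.frameVec Γ y j s) := by
    funext s
    rw [curvInner, inner_neg_left, sum_inner]
    simp only [real_inner_smul_left]
    rfl
  rw [h2]
  exact (continuousOn_finsetSum _ fun k _ => (continuousOn_finsetSum _ fun l _ =>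
    (P.continuousOn_curvCoeff hDs h.smooth k l).mul (h.continuousOn_coeff i l)).mul (h1 k)).neg

lemma continuousOn_torsionInner (h : P.IsVariation D u₀ Γ y b)
    (hDs : CovariantDerivative.ContMDiffCovariantDerivative D ∞) (i : Fin n ⊕ Fin m) :
    ContinuousOn (P.torsionInner D Γ y i) (Icc 0 1) :=
  (continuousOn_finsetSum _ fun k _ => (h.continuousOn_coeff i k).mul
    (P.continuousOn_torsionCoeff hDs h.smooth k)).neg

lemma continuousOn_inner_frameVar (h : P.IsVariation D u₀ Γ y b)
    (hDs : CovariantDerivative.ContMDiffCovariantDerivative D ∞)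
    (hD : CovariantDerivative.IsMetricCompatible (V := (TangentSpace 𝓘(ℝ, E) : M → Type _)) D)
    (i j : Fin n ⊕ Fin m) :
    ContinuousOn (fun r => inner ℝ (P.frameVar D Γ y b i r) (P.frameVec Γ y j r)) (Icc 0 1) :=
  fun _ hs => (h.hasDerivWithinAt_inner_frameVar hDs hD hs i j).continuousWithinAt

/-- The matrix `⟪Qᵢ, Uⱼ⟫` is the integral of the curvature. -/
lemma integral_curvInner (h : P.IsVariation D u₀ Γ y b)
    (hDs : CovariantDerivative.ContMDiffCovariantDerivative D ∞)
    (hD : CovariantDerivative.IsMetricCompatible (V := (TangentSpace 𝓘(ℝ, E) : M → Type _)) D)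
    (h0 : partialFst (E := E) Γ (0, 0) = 0) {s : ℝ} (hs : s ∈ Icc (0 : ℝ) 1)
    (i j : Fin n ⊕ Fin m) :
    ∫ r in (0 : ℝ)..s, P.curvInner D Γ y i j r =
      inner ℝ (P.frameVar D Γ y b i s) (P.frameVec Γ y j s) := by
  rw [integral_eq_sub_of_hasDerivWithinAt
    (f := fun r => inner ℝ (P.frameVar D Γ y b i r) (P.frameVec Γ y j r))
    (f' := P.curvInner D Γ y i j) (fun r hr => h.hasDerivWithinAt_inner_frameVar hDs hD hr i j)
    (h.continuousOn_curvInner hDs i j) hs]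
  have h1 : P.frameVar D Γ y b i 0 = 0 := by
    simp [frameVar, varCoeff, h.zero, h0]
  rw [h1, inner_zero_left, sub_zero]

lemma continuousOn_sum_dot (h : P.IsVariation D u₀ Γ y b)
    (hDs : CovariantDerivative.ContMDiffCovariantDerivative D ∞)
    (hD : CovariantDerivative.IsMetricCompatible (V := (TangentSpace 𝓘(ℝ, E) : M → Type _)) D)
    (hw : IsSmoothPath₀ w) (i : Fin n ⊕ Fin m) :
    ContinuousOn (fun r => ∑ d, dot w r d *
      inner ℝ (P.frameVar D Γ y b d r) (P.frameVec Γ y i r)) (Icc 0 1) := by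
  refine continuousOn_finsetSum _ fun d _ => ?_
  exact ((EuclideanSpace.proj d : Eucl n m →L[ℝ] ℝ).continuous.comp_continuousOn
    (hw.1.continuousOn_derivWithin (uniqueDiffOn_Icc one_pos) (by simp))).mul
    (h.continuousOn_inner_frameVar hDs hD d i)

/-- The variation `η` of the anti-development. -/
lemma variation_eq (h : P.IsVariation D u₀ Γ y b)
    (hDs : CovariantDerivative.ContMDiffCovariantDerivative D ∞)
    (hD : CovariantDerivative.IsMetricCompatible (V := (TangentSpace 𝓘(ℝ, E) : M → Type _)) D)
    (hw : IsAntiDev D u₀ (fun s => Γ (0, s)) w) (hv0 : v 0 = 0)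
    (hv : ∀ s ∈ Icc (0 : ℝ) 1, (⟨Γ (0, s), partialFst Γ (0, s)⟩ : TangentBundle 𝓘(ℝ, E) M) =
      pathField D u₀ v (fun s => Γ (0, s)) s)
    {s : ℝ} (hs : s ∈ Icc (0 : ℝ) 1) (i : Fin n ⊕ Fin m) :
    (b i s).2 = v s i - (∫ r in (0 : ℝ)..s, P.torsionInner D Γ y i r) -
      ∫ r in (0 : ℝ)..s, ∑ d, dot w r d *
        inner ℝ (P.frameVar D Γ y b d r) (P.frameVec Γ y i r) := by
  have hsub : uIcc 0 s ⊆ Icc (0 : ℝ) 1 := by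
    rw [uIcc_of_le hs.1]
    exact Icc_subset_Icc_right hs.2
  have hsum := h.continuousOn_sum_dot hDs hD hw.1 i
  -- `⟪Qᵢ, u w'⟫ = - ∑ w'ᵈ ⟪Q_d, Uᵢ⟫` by skew-symmetry.
  have hder : ∀ r ∈ Icc (0 : ℝ) 1, HasDerivWithinAt
      (fun r => (b i r).2 - inner ℝ (P.frameVec Γ y i r) (partialFst Γ (0, r)))
      (-∑ d, dot w r d * inner ℝ (P.frameVar D Γ y b d r) (P.frameVec Γ y i r)
        - P.torsionInner D Γ y i r) (Icc 0 1) r := fun r hr => by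
    refine (h.hasDerivWithinAt_antiDev_sub hDs hr i).congr_deriv ?_
    obtain ⟨f, -, hf1, hf2, -⟩ := h.exists_iso hDs hD hw hr (hv r hr)
    rw [torsionInner, sub_neg_eq_add, add_left_inj, ← hf2, ← sum_smul_stdVec (dot w r), map_sum,
      inner_sum, ← Finset.sum_neg_distrib]
    refine Finset.sum_congr rfl fun d _ => ?_
    rw [map_smul, hf1, real_inner_smul_right, sum_smul_stdVec,
      eq_neg_of_add_eq_zero_left (h.inner_add_inner hD hr i d), real_inner_comm, mul_neg]
  have hin : ∀ r ∈ Icc (0 : ℝ) 1,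
      inner ℝ (P.frameVec Γ y i r) (partialFst Γ (0, r)) = v r i := fun r hr => by
    obtain ⟨f, -, hf1, -, hf3⟩ := h.exists_iso hDs hD hw hr (hv r hr)
    rw [← hf3, ← hf1, f.inner_map_map, inner_stdVec]
  have hneg : ContinuousOn (fun r => -∑ d, dot w r d *
      inner ℝ (P.frameVar D Γ y b d r) (P.frameVec Γ y i r)) (Icc 0 1) := hsum.neg
  have h1 := integral_eq_sub_of_hasDerivWithinAt hder
    (hneg.sub (h.continuousOn_torsionInner hDs i)) hs
  rw [intervalIntegral.integral_sub (hneg.mono hsub).intervalIntegrable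
    ((h.continuousOn_torsionInner hDs i).mono hsub).intervalIntegrable,
    intervalIntegral.integral_neg, hin s hs, hin 0 (by simp), h.zero, hv0] at h1
  simp only [PiLp.zero_apply, Prod.snd_zero] at h1
  linarith

lemma torsionForm_eq (h : P.IsVariation D u₀ Γ y b)
    (hDs : CovariantDerivative.ContMDiffCovariantDerivative D ∞)
    (hD : CovariantDerivative.IsMetricCompatible (V := (TangentSpace 𝓘(ℝ, E) : M → Type _)) D)
    (hw : IsAntiDev D u₀ (fun s => Γ (0, s)) w) {s : ℝ} (hs : s ∈ Ioo (0 : ℝ) 1)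
    (hv : (⟨Γ (0, s), partialFst Γ (0, s)⟩ : TangentBundle 𝓘(ℝ, E) M) =
      pathField D u₀ v (fun s => Γ (0, s)) s) (i : Fin n ⊕ Fin m) :
    torsionForm D (dLift D u₀ (fun s => Γ (0, s)) s) (dot w s) (v s) i =
      P.torsionInner D Γ y i s := by
  obtain ⟨f, hu, hf1, hf2, hf3⟩ := h.exists_iso hDs hD hw (Ioo_subset_Icc_self hs) hv
  rw [hu, torsionForm, OFrame.iso_symm_apply]
  simp only
  rw [hf1, hf2, hf3, D.torsion_antisymm, inner_neg_right, torsionInner, frameVec, sum_inner]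
  simp only [real_inner_smul_left, P.torsionCoeff_eq hD h.smooth _ hs]

lemma curvatureForm_eq (h : P.IsVariation D u₀ Γ y b)
    (hDs : CovariantDerivative.ContMDiffCovariantDerivative D ∞)
    (hD : CovariantDerivative.IsMetricCompatible (V := (TangentSpace 𝓘(ℝ, E) : M → Type _)) D)
    (hw : IsAntiDev D u₀ (fun s => Γ (0, s)) w) {s : ℝ} (hs : s ∈ Ioo (0 : ℝ) 1)
    (hv : (⟨Γ (0, s), partialFst Γ (0, s)⟩ : TangentBundle 𝓘(ℝ, E) M) =
      pathField D u₀ v (fun s => Γ (0, s)) s) (z : Eucl n m) (i : Fin n ⊕ Fin m) :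
    curvatureForm D (dLift D u₀ (fun s => Γ (0, s)) s) (dot w s) (v s) z i =
      ∑ d, z d * P.curvInner D Γ y d i s := by
  obtain ⟨f, hu, hf1, hf2, hf3⟩ := h.exists_iso hDs hD hw (Ioo_subset_Icc_self hs) hv
  rw [hu, P.curvatureForm_apply hDs (c := fun i => (y 0 i s).1) hf1]
  simp only [hf1, hf2, hf3, curvInner, P.curvCoeff_eq hDs h.smooth _ _ hs]

lemma integral_curvatureForm (h : P.IsVariation D u₀ Γ y b)
    (hDs : CovariantDerivative.ContMDiffCovariantDerivative D ∞)
    (hD : CovariantDerivative.IsMetricCompatible (V := (TangentSpace 𝓘(ℝ, E) : M → Type _)) D)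
    (hw : IsAntiDev D u₀ (fun s => Γ (0, s)) w) (h0 : partialFst (E := E) Γ (0, 0) = 0)
    (hv : ∀ s ∈ Icc (0 : ℝ) 1, (⟨Γ (0, s), partialFst Γ (0, s)⟩ : TangentBundle 𝓘(ℝ, E) M) =
      pathField D u₀ v (fun s => Γ (0, s)) s)
    {s : ℝ} (hs : s ∈ Icc (0 : ℝ) 1) (z : Eucl n m) (i : Fin n ⊕ Fin m) :
    (∫ r in (0 : ℝ)..s,
      curvatureForm D (dLift D u₀ (fun s => Γ (0, s)) r) (dot w r) (v r) z) i =
      ∑ d, z d * inner ℝ (P.frameVar D Γ y b d s) (P.frameVec Γ y i s) := by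
  have hc : ∀ i, ContinuousOn (fun r => ∑ d, z d * P.curvInner D Γ y d i r) (Icc 0 1) := fun i =>
    continuousOn_finsetSum _ fun d _ => continuousOn_const.mul (h.continuousOn_curvInner hDs d i)
  have hsub : uIcc 0 s ⊆ Icc (0 : ℝ) 1 := by
    rw [uIcc_of_le hs.1]
    exact Icc_subset_Icc_right hs.2
  have hi : ∀ d, IntervalIntegrable (fun r => z d * P.curvInner D Γ y d i r)
      MeasureTheory.volume 0 s := fun d =>
    ((h.continuousOn_curvInner hDs d i).mono hsub).intervalIntegrable.const_mul _
  rw [integral_apply_of_eqOn hc (fun r hr i => h.curvatureForm_eq hDs hD hw hr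
    (hv r (Ioo_subset_Icc_self hr)) z i) hs, intervalIntegral.integral_finsetSum fun d _ => hi d]
  refine Finset.sum_congr rfl fun d _ => ?_
  rw [intervalIntegral.integral_const_mul, h.integral_curvInner hDs hD h0 hs]

lemma partialFst_zero (hv0 : v 0 = 0)
    (hv : (⟨Γ (0, 0), partialFst Γ (0, 0)⟩ : TangentBundle 𝓘(ℝ, E) M) =
      pathField D u₀ v (fun s => Γ (0, s)) 0) : partialFst (E := E) Γ (0, 0) = 0 := by
  unfold pathField at hv
  rw [hv0, map_zero] at hv
  have key : ∀ {x z : M} {a : TangentSpace 𝓘(ℝ, E) x},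
      (⟨x, a⟩ : TangentBundle 𝓘(ℝ, E) M) = ⟨z, 0⟩ → a = 0 := by
    intro x z a h
    obtain rfl : x = z := congrArg TotalSpace.proj h
    exact eq_of_heq (TotalSpace.mk.inj h).2
  exact key hv

/-- The variation of the anti-development in terms of the torsion and curvature forms. -/
lemma hsuVariation_apply (h : P.IsVariation D u₀ Γ y b)
    (hDs : CovariantDerivative.ContMDiffCovariantDerivative D ∞)
    (hD : CovariantDerivative.IsMetricCompatible (V := (TangentSpace 𝓘(ℝ, E) : M → Type _)) D)
    (hw : IsAntiDev D u₀ (fun s => Γ (0, s)) (horAntiDev D u₀ (fun s => Γ (0, s))))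
    (hv0 : v 0 = 0)
    (hv : ∀ s ∈ Icc (0 : ℝ) 1, (⟨Γ (0, s), partialFst Γ (0, s)⟩ : TangentBundle 𝓘(ℝ, E) M) =
      pathField D u₀ v (fun s => Γ (0, s)) s)
    {s : ℝ} (hs : s ∈ Icc (0 : ℝ) 1) (i : Fin n ⊕ Fin m) :
    hsuVariation D u₀ v (fun s => Γ (0, s)) s i = (b i s).2 := by
  have h0 := partialFst_zero hv0 (hv 0 (by simp))
  rw [hsuVariation, PiLp.sub_apply, PiLp.sub_apply, h.variation_eq hDs hD hw hv0 hv hs,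
    integral_apply_of_eqOn (h.continuousOn_torsionInner hDs) (fun r hr i =>
      h.torsionForm_eq hDs hD hw hr (hv r (Ioo_subset_Icc_self hr)) i) hs,
    integral_apply_of_eqOn (h.continuousOn_sum_dot hDs hD hw.1) (fun r hr i =>
      h.integral_curvatureForm hDs hD hw h0 hv (Ioo_subset_Icc_self hr) _ i) hs]

/-- The vertical part of the variation: the curvature term vanishes, since the covariant derivatives
of horizontal frame vectors are horizontal, and only the torsion of the Bott connection remains. -/
lemma bottVariation_inr (h : P.IsVariation D u₀ Γ y b) (hD : IsAdapted F D)
    (hu₀ : F.IsHorFrame u₀) (hγ : F.IsHorPath (fun s => Γ (0, s)))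
    (hw : IsAntiDev D u₀ (fun s => Γ (0, s)) (horAntiDev D u₀ (fun s => Γ (0, s))))
    (hv0 : v 0 = 0)
    (hv : ∀ s ∈ Icc (0 : ℝ) 1, (⟨Γ (0, s), partialFst Γ (0, s)⟩ : TangentBundle 𝓘(ℝ, E) M) =
      pathField D u₀ v (fun s => Γ (0, s)) s)
    {s : ℝ} (hs : s ∈ Icc (0 : ℝ) 1) (a : Fin m) :
    F.bottVariation D u₀ v (fun s => Γ (0, s)) s (Sum.inr a) = (b (Sum.inr a) s).2 := by
  obtain ⟨hl, -⟩ := (h.isSolution 0).dLift_antiDev hD.smooth hD.metric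
    (contMDiffOn_slice h.smooth 0) (h.start 0)
  have hz : ∫ r in (0 : ℝ)..s, ∑ d, dot (horAntiDev D u₀ (fun s => Γ (0, s))) r d *
      inner ℝ (P.frameVar D Γ y b d r) (P.frameVec Γ y (Sum.inr a) r) = 0 := by
    rw [intervalIntegral.integral_congr_Ioo_of_le hs.1 (g := fun _ => (0 : ℝ)),
      intervalIntegral.integral_zero]
    intro r hr
    have hr' : r ∈ Icc (0 : ℝ) 1 := ⟨hr.1.le, hr.2.le.trans hs.2⟩
    simp only [Fintype.sum_sum_type]
    simp only [h.inner_frameVar_inl_inr hD hu₀ hr', hw.isHorVec_dot P hD hu₀ hγ hr' _, mul_zero,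
      zero_mul, Finset.sum_const_zero, add_zero]
  rw [Foliation.bottVariation, PiLp.sub_apply, h.variation_eq hD.smooth hD.metric hw hv0 hv hs, hz,
    sub_zero, integral_apply_of_eqOn
      (g := Sum.elim (fun _ _ => 0) fun j => P.torsionInner D Γ y (Sum.inr j)) ?_ ?_ hs]
  · rfl
  · rintro (i | j)
    · exact continuousOn_const
    · exact h.continuousOn_torsionInner hD.smooth _
  · intro r hr i
    have hr' := Ioo_subset_Icc_self hr
    have hf := hl.isHorFrame P hD hu₀ hr'
    have hd := hw.isHorVec_dot P hD hu₀ hγ hr'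
    rcases i with i | j
    · exact hf.bottTorsionForm_inl P hD hd i
    · rw [hf.bottTorsionForm_inr P hD hd, h.torsionForm_eq hD.smooth hD.metric hw hr (hv r hr')]
      rfl

end IsVariation

end SpanningFields

end FirstVariation

/-! ### Flows and tangent paths -/

section TangentPaths

variable {E : Type*} [NormedAddCommGroup E] [NormedSpace ℝ E] [FiniteDimensional ℝ E] {n m : ℕ}
  {M : Type*} [TopologicalSpace M] [ChartedSpace E M] [IsManifold 𝓘(ℝ, E) ∞ M]
  {ι : Type*} [Fintype ι]
  [RiemannianBundle (fun x : M => TangentSpace 𝓘(ℝ, E) x)]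
  [IsContMDiffRiemannianBundle 𝓘(ℝ, E) ∞ E (fun x : M => TangentSpace 𝓘(ℝ, E) x)]
  {F : Foliation E n M} {D : Connection E M} {u₀ : OFrame E n m M} {v : ℝ → Eucl n m}
  {γ : SmoothPath E u₀.pt} {ζ : ℝ → SmoothPath E u₀.pt → SmoothPath E u₀.pt}

/-- The first variation of the anti-development under the flow of `𝐃_v`, and its vertical part. -/
theorem IsFlow.hasDerivAt_antiDev (P : SpanningFields E M ι) (hζ : IsFlow D u₀ v ζ)
    (hD : IsAdapted F D) (hu₀ : F.IsHorFrame u₀) (hv0 : v 0 = 0) (hγ : F.IsHorPath γ.1)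
    {s : ℝ} (hs : s ∈ Icc (0 : ℝ) 1) :
    HasDerivAt (fun t => antiDev D u₀ (ζ t γ).1 s) (hsuVariation D u₀ v γ.1 s) 0 ∧
      ∀ a, F.bottVariation D u₀ v γ.1 s (Sum.inr a) = hsuVariation D u₀ v γ.1 s (Sum.inr a) := by
  let Γ : ℝ × ℝ → M := fun p => (ζ p.1 γ).1 p.2
  have hΓ : ContMDiffOn 𝓘(ℝ, ℝ × ℝ) 𝓘(ℝ, E) ∞ Γ strip := hζ.smooth γ
  have hΓ0 : ∀ t, Γ (t, 0) = u₀.pt := fun t => (ζ t γ).2.2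
  choose y hy using fun t => P.exists_isSolution hD.smooth u₀ (contMDiffOn_slice hΓ t)
  choose b hb0 hbt hbs using fun i => P.exists_variation hD.smooth hΓ hy i
  have h : P.IsVariation D u₀ Γ y b := ⟨hΓ, hΓ0, hy, hb0, hbt, hbs⟩
  have hv : ∀ s ∈ Icc (0 : ℝ) 1, (⟨Γ (0, s), partialFst Γ (0, s)⟩ : TangentBundle 𝓘(ℝ, E) M) =
      pathField D u₀ v (fun s => Γ (0, s)) s := fun s hs => by
    rw [← mfderiv_slice hΓ 0 hs]
    exact hζ.deriv γ 0 s hs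
  have heq : EqOn γ.1 (fun s => Γ (0, s)) (Icc 0 1) := fun s hs => (hζ.zero γ s hs).symm
  have hγ' := hγ.congr heq
  have hanti := fun t => ((hy t).dLift_antiDev hD.smooth hD.metric (contMDiffOn_slice hΓ t)
    (hΓ0 t)).2.2.2
  have hw := horAntiDev_spec P hD hu₀ hγ' ⟨_, (hanti 0).1⟩
  obtain ⟨h1, h2⟩ := hsuVariation_congr (F := F) (D := D) (u₀ := u₀) heq v s
  rw [h1, h2]
  have h3 := h.hsuVariation_apply hD.smooth hD.metric hw hv0 hv hs
  refine ⟨?_, fun a => ?_⟩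
  · have h4 : (fun t => antiDev D u₀ (ζ t γ).1 s) =
        fun t => (PiLp.continuousLinearEquiv 2 ℝ fun _ : Fin n ⊕ Fin m => ℝ).symm
          fun i => (y t i s).2 := by
      funext t
      ext i
      exact (hanti t).2 s hs i
    have h5 : hsuVariation D u₀ v (fun s => Γ (0, s)) s =
        (PiLp.continuousLinearEquiv 2 ℝ fun _ : Fin n ⊕ Fin m => ℝ).symm fun i => (b i s).2 := by
      ext i
      exact h3 i
    rw [h4, h5]
    have h6 : HasDerivAt (fun t => fun i => (y t i s).2) (fun i => (b i s).2) 0 :=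
      hasDerivAt_pi.2 fun i => (hbt i s hs).snd
    exact (PiLp.continuousLinearEquiv 2 ℝ fun _ : Fin n ⊕ Fin m =>
      ℝ).symm.toContinuousLinearMap.hasFDerivAt.comp_hasDerivAt 0 h6
  · rw [h3, h.bottVariation_inr hD hu₀ hγ' hw hv0 hv hs]

/-- Tangency in terms of the torsion of the Bott connection. -/
theorem IsFlow.isTangent_iff (P : SpanningFields E M ι) (hζ : IsFlow D u₀ v ζ)
    (hD : IsAdapted F D) (hu₀ : F.IsHorFrame u₀) (hv0 : v 0 = 0) (hγ : F.IsHorPath γ.1) :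
    IsTangent D u₀ ζ γ ↔ ∀ s ∈ Icc (0 : ℝ) 1, IsHorVec (F.bottVariation D u₀ v γ.1 s) := by
  refine forall₂_congr fun s hs => ?_
  obtain ⟨h1, h2⟩ := hζ.hasDerivAt_antiDev P hD hu₀ hv0 hγ hs
  refine ⟨fun ⟨w, hw, hw'⟩ j => ?_, fun h => ⟨_, h1, fun j => (h2 j).symm.trans (h j)⟩⟩
  rw [h2, h1.unique hw, hw' j]

end TangentPaths

end FoliatedPaths

theorem mainTheorem6 {E : Type*} [NormedAddCommGroup E] [NormedSpace ℝ E] [FiniteDimensional ℝ E]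
    {n m : ℕ} (hdim : Module.finrank ℝ E = n + m)
    {M : Type*} [TopologicalSpace M] [T2Space M] [CompactSpace M] [ConnectedSpace M]
    [ChartedSpace E M] [IsManifold 𝓘(ℝ, E) ∞ M]
    [RiemannianBundle (fun x : M => TangentSpace 𝓘(ℝ, E) x)]
    [IsContMDiffRiemannianBundle 𝓘(ℝ, E) ∞ E (fun x : M => TangentSpace 𝓘(ℝ, E) x)]
    (F : FoliatedPaths.Foliation E n M) (hF : F.IsBundleLike) (hgeo : F.IsTotallyGeodesic)
    (u₀ : FoliatedPaths.OFrame E n m M) (hu₀ : F.IsHorFrame u₀)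
    (v : ℝ → FoliatedPaths.Eucl n m) (hv : FoliatedPaths.IsSmoothPath₀ v)
    (γ : FoliatedPaths.SmoothPath E u₀.pt) (hγ : F.IsHorPath γ.1) :
    (∀ D : FoliatedPaths.Connection E M, FoliatedPaths.IsAdapted F D →
      ∀ ζ, FoliatedPaths.IsFlow D u₀ v ζ →
        (FoliatedPaths.IsTangent D u₀ ζ γ ↔
          ∀ s ∈ Set.Icc (0 : ℝ) 1, FoliatedPaths.IsHorVec (F.bottVariation D u₀ v γ.1 s)) ∧
        ∀ s ∈ Set.Icc (0 : ℝ) 1,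
          HasDerivAt (fun t => FoliatedPaths.antiDev D u₀ (ζ t γ).1 s)
            (FoliatedPaths.hsuVariation D u₀ v γ.1 s) 0) ∧
    (∀ D D' : FoliatedPaths.Connection E M,
      FoliatedPaths.IsAdapted F D → FoliatedPaths.IsAdapted F D' →
      ∀ ζ ζ', FoliatedPaths.IsFlow D u₀ v ζ → FoliatedPaths.IsFlow D' u₀ v ζ' →
        (FoliatedPaths.IsTangent D u₀ ζ γ ↔ FoliatedPaths.IsTangent D' u₀ ζ' γ)) := by
  obtain ⟨t, ⟨P⟩⟩ := FoliatedPaths.exists_spanningFields (E := E) (M := M)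
  refine ⟨fun D hD ζ hζ => ⟨hζ.isTangent_iff P hD hu₀ hv.2 hγ, fun s hs =>
    (hζ.hasDerivAt_antiDev P hD hu₀ hv.2 hγ hs).1⟩, fun D D' hD hD' ζ ζ' hζ hζ' => ?_⟩
  rw [hζ.isTangent_iff P hD hu₀ hv.2 hγ, hζ'.isTangent_iff P hD' hu₀ hv.2 hγ]
  simp only [FoliatedPaths.bottVariation_eq_of_isHorPath P hD hD' hγ]
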